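/- Let $\mu$ be a finite signed Borel measure on $\mathbb{R}$ with total variation measure $|\mu|$, and consider $$i\psi_t=-\psi_{xx}+|\psi|^2\psi\,d\mu. \qquad (\mathrm{NLS}_\mu)$$ For an interval $I\subseteq\mathbb{R}$, a *solution* on $I$ is a bounded continuous map $\psi:I\to L^2(\mathbb{R})$ with $\psi\in L^4_{I,\mathrm{loc}}C_x$ (that is, $\psi\in L^4(K;C(\mathbb{R}))$ for every compact $K\subseteq I$, where $C(\mathbb{R})$ is the space of bounded continuous functions $\mathbb R\to\mathbb C$ with the supremum norm) such that for some $t_0\in I$ and all $t\in I$ $$\psi(t)=e^{i(t-t_0)\partial_x^2}\psi(t_0)-i\int_{t_0}^t e^{i(t-s)\partial_x^2}\bigl[|\psi(s)|^2\psi(s)\,d\mu\bigr]\,ds,$$ where the propagator acts on measures, and the time integral is taken, in the sense of tempered distributions. Let $C^0(\mathbb R)\subseteq C(\mathbb R)$ be the closed subspace of functions vanishing at infinity, and let $M[f]=\int_{\mathbb R}|f|^2\,dx$. For $\psi_0\in L^2(\mathbb{R})$, the maximal (forward) existence interval is the union of all intervals $I\subseteq[0,\infty)$ containing $0$ on which there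 is a solution with $\psi(0)=\psi_0$; let $T_{\max}(\psi_0)\in[0,\infty]$ be its supremum. Then: 1. (Existence) For every $\psi_0\in L^2(\mathbb{R})$ there are $T>0$ and a solution $\psi:[0,T)\to L^2(\mathbb{R})$ with $\psi(0)=\psi_0$. 2. (Uniqueness) If $\psi$ and $\phi$ are solutions, on intervals $I$ and $J$, that agree at one time in $I\cap J$, then they agree throughout $I\cap J$. 3. (Blowup/scattering criterion) For every $\psi_0\in L^2(\mathbb R)$, $T_{\max}(\psi_0)>0$, the maximal existence interval is $[0,T_{\max}(\psi_0))$, and it carries a solution with $\psi(0)=\psi_0$ (the maximal solution). If the maximal solution satisfies $$\int_0^{T_{\max}}\int_{\mathbb{R}}|\psi(t,x)|^4\,d|\mu|(x)\,dt<\infty,\qquad(\ast)$$ then $T_{\max}(\psi_0)=\infty$ and $\psi$ scatters forward in time: there is $\psi_+\in L^2(\mathbb{R})$ with $\|\psi(t)-e^{it\partial_x^2}\psi_+\|_{L^2}\to0$ as $t\to\infty$. 4. (Small data) There is $\eta_0>0$, depending only on $\mu$, such that if $\|\psi_0\|_{L^2}\le\eta_0$ then the maximal solution satisfies $(\ast)$;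 in particular it is global and scatters forward in time. 5. (Continuous dependence) Suppose $\psi_{n,0}\to\psi_0$ in $L^2(\mathbb{R})$, let $\psi_n,\psi$ be the corresponding maximal solutions, and let $0\le T<T_{\max}(\psi_0)$. Then $T<T_{\max}(\psi_{n,0})$ for all large $n$, and $\psi_n\to\psi$ in $C([0,T];L^2(\mathbb{R}))\cap L^4([0,T];C^0(\mathbb{R}))$; in particular $\psi$, and $\psi_n$ for all large $n$, belong to $L^4([0,T];C^0(\mathbb{R}))$. Moreover $\psi_0\mapsto T_{\max}(\psi_0)$ is lower semicontinuous on $L^2(\mathbb{R})$. 6. (Mass conservation) If $\psi$ is a solution on an interval $I$, then $M[\psi(t)]=M[\psi(t_0)]$ for all $t_0,t\in I$. -/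

import Mathlib

open MeasureTheory Filter Topology Set
open scoped ENNReal FourierTransform SchwartzMap BoundedContinuousFunction

noncomputable section

namespace NLSMu

/-- The complex Hilbert space `L²(ℝ)`. -/
abbrev L2 : Type := Lp ℂ 2 (volume : Measure ℝ)

/-! ### The free Schrödinger group -/

/-- The Fourier symbol of `e^{it∂ₓ²}`. With Mathlib's convention
`(𝓕 f)(ξ) = ∫ e^{-2πixξ} f(x) dx`, the operator `∂ₓ²` is multiplication by `-4π²ξ²`. -/
def symbol (t ξ : ℝ) : ℂ :=
  Complex.exp (((-(4 * Real.pi ^ 2 * t * ξ ^ 2) : ℝ) : ℂ) * Complex.I)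

theorem norm_symbol (t ξ : ℝ) : ‖symbol t ξ‖ = 1 :=
  Complex.norm_exp_ofReal_mul_I _

theorem continuous_symbol (t : ℝ) : Continuous (symbol t) := by
  unfold symbol
  fun_prop

theorem hasTemperateGrowth_expI :
    Function.HasTemperateGrowth (fun θ : ℝ => Complex.exp ((θ : ℂ) * Complex.I)) := by
  have hd : ∀ n : ℕ, iteratedDeriv n (fun θ : ℝ => Complex.exp ((θ : ℂ) * Complex.I)) =
      fun θ : ℝ => Complex.I ^ n * Complex.exp ((θ : ℂ) * Complex.I) := by
    intro n
    induction n with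
    | zero => ext θ; simp
    | succ n ih =>
      rw [iteratedDeriv_succ, ih]
      ext θ
      have h1 : HasDerivAt (fun θ : ℝ => (θ : ℂ) * Complex.I) Complex.I θ := by
        simpa using (Complex.ofRealCLM.hasDerivAt (x := θ)).mul_const Complex.I
      have h2 := (h1.cexp).const_mul (Complex.I ^ n)
      rw [h2.deriv]
      ring
  refine ⟨?_, fun n => ⟨0, 1, fun x => ?_⟩⟩
  · exact (Complex.ofRealCLM.contDiff.mul contDiff_const).cexp
  · rw [norm_iteratedFDeriv_eq_norm_iteratedDeriv, hd n]
    simp [Complex.norm_exp_ofReal_mul_I]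

/-- The symbol is an admissible Fourier multiplier on the Schwartz space. -/
theorem hasTemperateGrowth_symbol (t : ℝ) : Function.HasTemperateGrowth (symbol t) := by
  have h : Function.HasTemperateGrowth (fun ξ : ℝ => -(4 * Real.pi ^ 2 * t * ξ ^ 2)) := by
    fun_prop
  exact hasTemperateGrowth_expI.comp h

theorem memLp_symbol_mul (t : ℝ) (f : L2) :
    MemLp (fun ξ => symbol t ξ * f ξ) 2 (volume : Measure ℝ) := by
  refine (Lp.memLp f).of_le
    ((continuous_symbol t).aestronglyMeasurable.mul (Lp.aestronglyMeasurable f))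
    (Eventually.of_forall fun ξ => ?_)
  simp [norm_symbol]

/-- The free propagator `e^{it∂ₓ²}` on `L²(ℝ)`. -/
def freeEvolution (t : ℝ) (f : L2) : L2 :=
  𝓕⁻ ((memLp_symbol_mul t (𝓕 f)).toLp (fun ξ => symbol t ξ * (𝓕 f : L2) ξ))

/-- The free propagator `e^{it∂ₓ²}` on the Schwartz space. -/
def schwartzEvolution (t : ℝ) : 𝓢(ℝ, ℂ) →L[ℂ] 𝓢(ℝ, ℂ) :=
  SchwartzMap.fourierMultiplierCLM ℂ (symbol t)

/-! ### Continuous representatives and mixed norms -/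

/-- The bounded continuous representative of `f ∈ L²(ℝ)`. It is unique when it exists; the value
is `0` by convention when there is none, and every definition below that uses it also requires
that it exists (for almost every time). -/
def contRep (f : L2) : ℝ →ᵇ ℂ :=
  open Classical in
  if h : ∃ g : ℝ →ᵇ ℂ, f =ᵐ[volume] g then h.choose else 0

theorem contRep_eq {f : L2} {g : ℝ →ᵇ ℂ} (h : f =ᵐ[volume] g) : contRep f = g := by
  have hex : ∃ g : ℝ →ᵇ ℂ, f =ᵐ[volume] g := ⟨g, h⟩
  have hc : f =ᵐ[volume] contRep f := by
    unfold contRep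
    rw [dif_pos hex]
    exact hex.choose_spec
  ext x
  exact congrFun ((Continuous.ae_eq_iff_eq volume (contRep f).continuous g.continuous).1
    (hc.symm.trans h)) x

/-- `u ∈ L⁴_J C_x`: for almost every `t ∈ J` the function `u(t)` is bounded and continuous, and
`t ↦ u(t)` belongs to the Bochner space `L⁴(J; C(ℝ))` of bounded continuous functions. -/
structure MemL4C (J : Set ℝ) (u : ℝ → L2) : Prop where
  ae_eq : ∀ᵐ t ∂(volume.restrict J), u t =ᵐ[volume] contRep (u t)
  memLp : MemLp (fun t => contRep (u t)) 4 (volume.restrict J)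

/-- `u ∈ L⁴_J C⁰_x`: in addition, `u(t)` vanishes at infinity for almost every `t ∈ J`. -/
structure MemL4C0 (J : Set ℝ) (u : ℝ → L2) : Prop extends MemL4C J u where
  vanishing : ∀ᵐ t ∂(volume.restrict J), Tendsto (contRep (u t)) (cocompact ℝ) (𝓝 0)

/-- The `L⁴_J C_x` norm. -/
def normL4C (J : Set ℝ) (u : ℝ → L2) : ℝ≥0∞ :=
  eLpNorm (fun t => contRep (u t)) 4 (volume.restrict J)

/-- The `C_J L²_x` norm. -/
def normCL2 (J : Set ℝ) (u : ℝ → L2) : ℝ≥0∞ :=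
  ⨆ t ∈ J, ‖u t‖ₑ

/-! ### Solutions -/

/-- The finite complex measure `|f|²f dμ`, for `f` bounded and continuous, as a functional:
`φ ↦ ∫ φ |f|² f dμ`. -/
def nonlinearity (μ : SignedMeasure ℝ) (f : ℝ →ᵇ ℂ) (φ : 𝓢(ℝ, ℂ)) : ℂ :=
  ∫ᵛ x, φ x * (((‖f x‖ ^ 2 : ℝ) : ℂ) * f x) ∂<•μ

/-- The Duhamel formula from time `t₀` to time `t`,
`ψ(t) = e^{i(t-t₀)∂ₓ²} ψ(t₀) - i ∫_{t₀}^t e^{i(t-s)∂ₓ²} [|ψ(s)|²ψ(s) dμ] ds`,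
as an identity of tempered distributions: the propagator acts on the measure `|ψ(s)|²ψ(s) dμ` by
duality, `(e^{iτ∂ₓ²} ν)(φ) = ν (e^{iτ∂ₓ²} φ)` (the symbol is even, so this extends the
propagator on functions), and the time integral is taken in the weak sense. -/
def Duhamel (μ : SignedMeasure ℝ) (ψ : ℝ → L2) (t₀ t : ℝ) : Prop :=
  ∀ φ : 𝓢(ℝ, ℂ),
    ∫ x, φ x * ψ t x =
      (∫ x, φ x * freeEvolution (t - t₀) (ψ t₀) x) -
        Complex.I * ∫ s in t₀..t, nonlinearity μ (contRep (ψ s)) (schwartzEvolution (t - s) φ)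

/-- `ψ` is a (strong `L²`) solution of `iψ_t = -ψ_xx + |ψ|²ψ dμ` on the interval `I`; only the
values `ψ t` with `t ∈ I` matter. -/
structure IsSolution (μ : SignedMeasure ℝ) (I : Set ℝ) (ψ : ℝ → L2) : Prop where
  interval : I.OrdConnected
  continuousOn : ContinuousOn ψ I
  bounded : ∃ C : ℝ, ∀ t ∈ I, ‖ψ t‖ ≤ C
  memL4C_loc : ∀ a ∈ I, ∀ b ∈ I, MemL4C (Icc a b) ψ
  duhamel : ∃ t₀ ∈ I, ∀ t ∈ I, Duhamel μ ψ t₀ t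

/-- The maximal forward existence interval for the data `ψ₀` at time `0`: the union of all the
intervals `I ⊆ [0, ∞)` containing `0` that carry a solution with `ψ(0) = ψ₀`. -/
def maxInterval (μ : SignedMeasure ℝ) (ψ₀ : L2) : Set ℝ :=
  {t | ∃ (I : Set ℝ) (ψ : ℝ → L2), I ⊆ Ici 0 ∧ (0 : ℝ) ∈ I ∧ t ∈ I ∧ IsSolution μ I ψ ∧ ψ 0 = ψ₀}

/-- The forward maximal existence time `T_max(ψ₀) ∈ [0, ∞]`. -/
def Tmax (μ : SignedMeasure ℝ) (ψ₀ : L2) : ℝ≥0∞ :=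
  ⨆ t ∈ maxInterval μ ψ₀, ENNReal.ofReal t

/-- `ψ` is the maximal forward solution with data `ψ₀` at time `0`. -/
structure IsMaximalSolution (μ : SignedMeasure ℝ) (ψ₀ : L2) (ψ : ℝ → L2) : Prop where
  isSolution : IsSolution μ (maxInterval μ ψ₀) ψ
  initial : ψ 0 = ψ₀

/-- `∫_0^{T_max} ∫ |ψ(t,x)|⁴ d|μ|(x) dt < ∞`. -/
def ScatteringCriterion (μ : SignedMeasure ℝ) (ψ₀ : L2) (ψ : ℝ → L2) : Prop :=
  ∫⁻ t in maxInterval μ ψ₀, ∫⁻ x, ‖contRep (ψ t) x‖ₑ ^ 4 ∂μ.totalVariation < ∞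

/-- `ψ` scatters forward in time. -/
def ScattersForward (ψ : ℝ → L2) : Prop :=
  ∃ ψplus : L2, Tendsto (fun t => ‖ψ t - freeEvolution t ψplus‖) atTop (𝓝 0)

/-- The mass `M[f] = ∫ |f|² dx`. -/
def mass (f : L2) : ℝ := ∫ x, ‖f x‖ ^ 2

end NLSMu

end

open NLSMu

open MeasureTheory Filter Topology Set
open scoped ENNReal FourierTransform SchwartzMap BoundedContinuousFunction

noncomputable section

namespace NLSMu

/-! At almost every time the measure $|\psi|^2\psi\,d\mu$ has a bounded density with respect to
$|\mu|$, so the forcing is a function of time with values in $L^1(|\mu|)$. The relevant dual pair is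
$L^4_tC_x$ against $L^{4/3}_tL^1(|\mu|)$. All linear estimates rest on one fact: the kernel of
$e^{i\tau\partial_x^2}$ is bounded by $|\tau|^{-1/2}$ uniformly in space, so a point mass is as good
a source as an integrable function.

Together with the Hardy–Littlewood–Sobolev inequality `lintegral_potential_pow_le` and its bilinear
form, this bound gives two Strichartz estimates. The homogeneous one, `strichartz`, is a $TT^*$
argument along a measurable curve $t\mapsto X(t)$ that nearly attains the supremum in $x$. The
inhomogeneous one, `memL4C0_duhamelTerm`, follows from the kernel bound directly, since a pointwise
bound survives the restriction $r\le t$. Duality turns the first estimate into `dualStrichartz`,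
which makes Duhamel terms continuous in $L^2$. Continuous representatives come from Fourier
inversion for regular data, and their decay at infinity from the Riemann–Lebesgue lemma; both pass
to limits by `memL4C0_of_tendsto`.

The cubic map sends $L^4_tC_x$ to $L^{4/3}_tL^1$ with exponents that match exactly, so short time
gives no power gain. Smallness comes instead from absolute continuity of the $L^4_tC_x$ norm of a
fixed function, or from small mass. In the small regime `exists_small_solution` is a contraction and
`stability_of_isSmallRadius` compares two solutions. Cutting a compact interval into finitely many
short pieces then yields uniqueness (`IsMild.eqOn`) and continuous dependence
(`continuous_dependence`) for data of any size.

By Hölder on the finite measure $|\mu|$, the criterion $(\ast)$ puts the forcing in $L^{4/3}_tL^1$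
over the whole lifespan (`enorm_density_rpow_le`). The Duhamel term then converges at the end of the
lifespan: at a finite endpoint the solution would extend, and at infinity the limit is the
scattering state (`lifespan_eq_and_scattersForward`).

For mass, the solution is too rough to differentiate. Since the pairing of $-i|\psi|^2\psi\,d\mu$
with $\psi$ is purely imaginary, the change of mass over $[s,t]$ is quadratic in the forcing norm
there, that is, of order $3/2$ in an additive continuous clock. Such a function is constant
(`eq_of_abs_sub_le_rpow`).

The argument is carried out for mild solutions in the interaction picture, $t\mapsto
e^{-it\partial_x^2}\psi(t)$. Testing against Schwartz functions (`duhamel_iff`) shows that they are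
the solutions of the theorem; the boundedness required of a solution is supplied by mass
conservation. -/

/-! ### The Hardy–Littlewood–Sobolev inequality for the kernel `|t|^(-1/2)` -/

/-- The dispersive decay rate `|τ|^(-1/2)`, with the value `∞` at `0`. -/
def decay (τ : ℝ) : ℝ≥0∞ := ‖τ‖ₑ ^ (-(1 / 2) : ℝ)

theorem measurable_decay : Measurable decay := by
  unfold decay; fun_prop

@[fun_prop]
theorem measurable_mul_decay {g : ℝ → ℝ≥0∞} (hg : Measurable g) (x : ℝ) :
    Measurable fun y => g y * decay (x - y) :=
  hg.mul (measurable_decay.comp (measurable_const.sub measurable_id))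

theorem decay_neg (τ : ℝ) : decay (-τ) = decay τ := by simp [decay]

theorem decay_sub_comm (s t : ℝ) : decay (s - t) = decay (t - s) := by
  rw [← decay_neg, neg_sub]

theorem decay_of_pos {τ : ℝ} (h : 0 < τ) : decay τ = ENNReal.ofReal (τ ^ (-(1 / 2) : ℝ)) := by
  rw [decay, Real.enorm_of_nonneg h.le, ENNReal.ofReal_rpow_of_pos h]

theorem setLIntegral_Iio_neg_eq (f : ℝ → ℝ≥0∞) (hf : ∀ x, f (-x) = f x) (a : ℝ) :
    ∫⁻ x in Iio (-a), f x = ∫⁻ x in Ioi a, f x := by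
  have h := (Measure.measurePreserving_neg (volume : Measure ℝ)).setLIntegral_comp_preimage_emb
    (MeasurableEquiv.neg ℝ).measurableEmbedding f (Iio (-a))
  rw [← h]
  have : (Neg.neg ⁻¹' Iio (-a) : Set ℝ) = Ioi a := by ext; simp
  rw [this]
  exact lintegral_congr fun x => hf x

theorem setLIntegral_decay_near {R : ℝ} (hR : 0 < R) :
    ∫⁻ y in {y : ℝ | |y| < R}, decay y ≤ ENNReal.ofReal (4 * R ^ (1 / 2 : ℝ)) := by
  set f : ℝ → ℝ≥0∞ := fun y => {y : ℝ | |y| < R}.indicator decay y with hf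
  have hm : MeasurableSet {y : ℝ | |y| < R} := measurableSet_lt (by fun_prop) measurable_const
  rw [← lintegral_indicator hm]
  have hpos : ∫⁻ y in Ioi 0, f y = ENNReal.ofReal (2 * R ^ (1 / 2 : ℝ)) := by
    rw [hf, setLIntegral_indicator hm]
    have e : {y : ℝ | |y| < R} ∩ Ioi 0 = Ioo 0 R := by
      ext y; simp only [mem_inter_iff, mem_ofPred_eq, mem_Ioi, mem_Ioo]
      constructor
      · rintro ⟨h1, h2⟩; exact ⟨h2, by rwa [abs_of_pos h2] at h1⟩
      · rintro ⟨h1, h2⟩; exact ⟨by rwa [abs_of_pos h1], h1⟩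
    rw [e, Measure.restrict_congr_set Ioo_ae_eq_Ioc]
    have : ∫⁻ y in Ioc 0 R, decay y = ∫⁻ y in Ioc 0 R, ENNReal.ofReal (y ^ (-(1 / 2) : ℝ)) :=
      setLIntegral_congr_fun measurableSet_Ioc fun y hy => decay_of_pos hy.1
    rw [this, ← ofReal_integral_eq_lintegral_ofReal]
    · rw [← intervalIntegral.integral_of_le hR.le, integral_rpow (by left; norm_num)]
      congr 1
      rw [Real.zero_rpow (by norm_num)]
      norm_num
      ring
    · have := (intervalIntegral.intervalIntegrable_rpow' (a := 0) (b := R)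
        (r := -(1 / 2)) (by norm_num)).1
      exact this
    · filter_upwards [ae_restrict_mem measurableSet_Ioc] with y hy
      exact Real.rpow_nonneg hy.1.le _
  have hneg : ∫⁻ y in Iio 0, f y = ∫⁻ y in Ioi 0, f y := by
    have := setLIntegral_Iio_neg_eq f (fun x => by
      simp only [hf, indicator, mem_ofPred_eq, abs_neg, decay_neg]) 0
    simpa using this
  rw [← lintegral_add_compl f (measurableSet_Ioi (a := (0 : ℝ))), compl_Ioi,
    ← Measure.restrict_congr_set Iio_ae_eq_Iic, hneg, hpos, ← ENNReal.ofReal_add (by positivity) (by positivity)]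
  apply ENNReal.ofReal_le_ofReal
  linarith

theorem setLIntegral_decay_far {R : ℝ} (hR : 0 < R) :
    ∫⁻ y in {y : ℝ | |y| < R}ᶜ, decay y ^ (4 : ℝ) ≤ ENNReal.ofReal (2 * R⁻¹) := by
  set f : ℝ → ℝ≥0∞ := fun y => {y : ℝ | |y| < R}ᶜ.indicator (fun y => decay y ^ (4 : ℝ)) y with hf
  have hm : MeasurableSet {y : ℝ | |y| < R} := measurableSet_lt (by fun_prop) measurable_const
  rw [← lintegral_indicator hm.compl]
  have hpos : ∫⁻ y in Ioi 0, f y = ENNReal.ofReal R⁻¹ := by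
    rw [hf, setLIntegral_indicator hm.compl]
    have e : {y : ℝ | |y| < R}ᶜ ∩ Ioi 0 = Ici R := by
      ext y; simp only [mem_inter_iff, mem_compl_iff, mem_ofPred_eq, mem_Ioi, mem_Ici, not_lt]
      constructor
      · rintro ⟨h1, h2⟩; rwa [abs_of_pos h2] at h1
      · intro h1; have := hR.trans_le h1; exact ⟨by rwa [abs_of_pos this], this⟩
    rw [e, ← Measure.restrict_congr_set Ioi_ae_eq_Ici]
    have : ∫⁻ y in Ioi R, decay y ^ (4 : ℝ) = ∫⁻ y in Ioi R, ENNReal.ofReal (y ^ (-2 : ℝ)) := by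
      refine setLIntegral_congr_fun measurableSet_Ioi fun y hy => ?_
      have hy' : 0 < y := hR.trans hy
      rw [decay_of_pos hy', ENNReal.ofReal_rpow_of_pos (by positivity), ← Real.rpow_mul hy'.le]
      norm_num
    rw [this, ← ofReal_integral_eq_lintegral_ofReal]
    · rw [integral_Ioi_rpow_of_lt (by norm_num) hR]
      congr 1
      norm_num
      rw [Real.rpow_neg_one]
    · exact integrableOn_Ioi_rpow_of_lt (by norm_num) hR
    · filter_upwards [ae_restrict_mem measurableSet_Ioi] with y hy
      exact Real.rpow_nonneg (hR.trans hy).le _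
  have hneg : ∫⁻ y in Iio 0, f y = ∫⁻ y in Ioi 0, f y := by
    have := setLIntegral_Iio_neg_eq f (fun x => by
      simp only [hf, indicator, mem_compl_iff, mem_ofPred_eq, abs_neg, decay_neg]) 0
    simpa using this
  rw [← lintegral_add_compl f (measurableSet_Ioi (a := (0 : ℝ))), compl_Ioi,
    ← Measure.restrict_congr_set Iio_ae_eq_Iic, hneg, hpos, ← ENNReal.ofReal_add (by positivity) (by positivity)]
  apply ENNReal.ofReal_le_ofReal
  linarith

theorem lintegral_decay_near {R : ℝ} (hR : 0 < R) (x : ℝ) :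
    ∫⁻ y in {y : ℝ | |x - y| < R}, decay (x - y) ≤ ENNReal.ofReal (4 * R ^ (1 / 2 : ℝ)) := by
  refine le_trans (le_of_eq ?_) (setLIntegral_decay_near hR)
  have hm : MeasurableSet {y : ℝ | |y| < R} := measurableSet_lt (by fun_prop) measurable_const
  have hm' : MeasurableSet {y : ℝ | |x - y| < R} :=
    measurableSet_lt (by fun_prop) measurable_const
  rw [← lintegral_indicator hm, ← lintegral_indicator hm',
    ← lintegral_sub_left_eq_self (fun y => {y : ℝ | |y| < R}.indicator decay y) x]
  rfl

theorem lintegral_decay_far {R : ℝ} (hR : 0 < R) (x : ℝ) :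
    ∫⁻ y in {y : ℝ | |x - y| < R}ᶜ, decay (x - y) ^ (4 : ℝ) ≤ ENNReal.ofReal (2 * R⁻¹) := by
  refine le_trans (le_of_eq ?_) (setLIntegral_decay_far hR)
  have hm : MeasurableSet {y : ℝ | |y| < R} := measurableSet_lt (by fun_prop) measurable_const
  have hm' : MeasurableSet {y : ℝ | |x - y| < R} :=
    measurableSet_lt (by fun_prop) measurable_const
  rw [← lintegral_indicator hm.compl, ← lintegral_indicator hm'.compl,
    ← lintegral_sub_left_eq_self (fun y => {y : ℝ | |y| < R}ᶜ.indicator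
      (fun y => decay y ^ (4 : ℝ)) y) x]
  rfl

/-- The truncated potential estimate behind the Hardy–Littlewood–Sobolev inequality. -/
theorem lintegral_truncated_mul_decay_le {g : ℝ → ℝ≥0∞} (hg : Measurable g)
    (hG : ∫⁻ y, g y ^ (4 / 3 : ℝ) ≠ ∞) {a : ℝ≥0∞} (ha0 : a ≠ 0) (ha : a ≠ ∞) (x : ℝ) :
    ∫⁻ y in {y | g y ≤ a}, g y * decay (x - y) ≤
      6 * a ^ (1 / 3 : ℝ) * (∫⁻ y, g y ^ (4 / 3 : ℝ)) ^ (1 / 2 : ℝ) := by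
  set G := ∫⁻ y, g y ^ (4 / 3 : ℝ) with hGdef
  rcases eq_or_ne G 0 with hG0 | hG0
  · have : g =ᵐ[volume] 0 := by
      rw [hGdef, lintegral_eq_zero_iff (by fun_prop)] at hG0
      filter_upwards [hG0] with y hy
      exact (ENNReal.rpow_eq_zero_iff_of_pos (by norm_num)).1 hy
    have h0 : ∫⁻ y in {y | g y ≤ a}, g y * decay (x - y) = 0 := by
      rw [← lintegral_zero (μ := volume.restrict {y | g y ≤ a})]
      refine lintegral_congr_ae ?_
      filter_upwards [ae_restrict_of_ae this] with y hy
      simp [hy]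
    rw [h0]; exact zero_le
  obtain ⟨α, hα, rfl⟩ : ∃ α : ℝ, 0 < α ∧ a = ENNReal.ofReal α :=
    ⟨a.toReal, ENNReal.toReal_pos ha0 ha, (ENNReal.ofReal_toReal ha).symm⟩
  obtain ⟨γ, hγ, hγG⟩ : ∃ γ : ℝ, 0 < γ ∧ G = ENNReal.ofReal γ :=
    ⟨G.toReal, ENNReal.toReal_pos hG0 hG, (ENNReal.ofReal_toReal hG).symm⟩
  -- This radius balances the two pieces: the near part $\alpha R^{1/2}$ and the Hölder bound
  -- $\gamma^{3/4}R^{-1/4}$ of the far part both become $\alpha^{1/3}\gamma^{1/2}$.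
  set R : ℝ := γ * α ^ (-(4 / 3) : ℝ) with hRdef
  have hR : 0 < R := by positivity
  set S : Set ℝ := {y : ℝ | |x - y| < R} with hS
  have hmS : MeasurableSet S := measurableSet_lt (by fun_prop) measurable_const
  have hmg : MeasurableSet {y | g y ≤ ENNReal.ofReal α} := measurableSet_le hg measurable_const
  have hmd : Measurable fun y => decay (x - y) := measurable_decay.comp (by fun_prop)
  have near : ∫⁻ y in {y | g y ≤ ENNReal.ofReal α} ∩ S, g y * decay (x - y) ≤
      ENNReal.ofReal (4 * α ^ (1 / 3 : ℝ) * γ ^ (1 / 2 : ℝ)) := by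
    calc ∫⁻ y in {y | g y ≤ ENNReal.ofReal α} ∩ S, g y * decay (x - y)
        ≤ ∫⁻ y in {y | g y ≤ ENNReal.ofReal α} ∩ S, ENNReal.ofReal α * decay (x - y) := by
          refine setLIntegral_mono' (hmg.inter hmS) fun y hy => ?_
          gcongr
          exact hy.1
      _ ≤ ∫⁻ y in S, ENNReal.ofReal α * decay (x - y) := lintegral_mono_set inter_subset_right
      _ = ENNReal.ofReal α * ∫⁻ y in S, decay (x - y) := lintegral_const_mul _ hmd
      _ ≤ ENNReal.ofReal α * ENNReal.ofReal (4 * R ^ (1 / 2 : ℝ)) := by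
          gcongr
          exact lintegral_decay_near hR x
      _ = _ := by
          rw [← ENNReal.ofReal_mul hα.le, hRdef, Real.mul_rpow hγ.le (by positivity),
            ← Real.rpow_mul hα.le]
          congr 1
          have : α ^ (1 / 3 : ℝ) = α * α ^ (-(4 / 3) * (1 / 2) : ℝ) := by
            nth_rewrite 2 [← Real.rpow_one α]
            rw [← Real.rpow_add hα]; norm_num
          rw [this]; ring
  have far : ∫⁻ y in {y | g y ≤ ENNReal.ofReal α} ∩ Sᶜ, g y * decay (x - y) ≤
      ENNReal.ofReal (2 * α ^ (1 / 3 : ℝ) * γ ^ (1 / 2 : ℝ)) := by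
    have hpq : Real.HolderConjugate (4 / 3) 4 := by
      rw [Real.holderConjugate_iff]; norm_num
    calc ∫⁻ y in {y | g y ≤ ENNReal.ofReal α} ∩ Sᶜ, g y * decay (x - y)
        ≤ ∫⁻ y in Sᶜ, g y * decay (x - y) := lintegral_mono_set inter_subset_right
      _ ≤ (∫⁻ y in Sᶜ, g y ^ (4 / 3 : ℝ)) ^ (1 / (4 / 3) : ℝ) *
          (∫⁻ y in Sᶜ, decay (x - y) ^ (4 : ℝ)) ^ (1 / 4 : ℝ) :=
          ENNReal.lintegral_mul_le_Lp_mul_Lq _ hpq hg.aemeasurable hmd.aemeasurable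
      _ ≤ (ENNReal.ofReal γ) ^ (1 / (4 / 3) : ℝ) * (ENNReal.ofReal (2 * R⁻¹)) ^ (1 / 4 : ℝ) := by
          gcongr
          · rw [← hγG]; exact setLIntegral_le_lintegral _ _
          · exact lintegral_decay_far hR x
      _ ≤ _ := by
          rw [ENNReal.ofReal_rpow_of_pos hγ, ENNReal.ofReal_rpow_of_pos (by positivity),
            ← ENNReal.ofReal_mul (by positivity)]
          apply ENNReal.ofReal_le_ofReal
          rw [hRdef, Real.mul_rpow (by norm_num) (by positivity), mul_inv,
            Real.mul_rpow (by positivity) (by positivity), ← Real.rpow_neg hα.le,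
            ← Real.rpow_mul hα.le, ← Real.rpow_neg_one γ, ← Real.rpow_mul hγ.le]
          have h2 : (2 : ℝ) ^ (1 / 4 : ℝ) ≤ 2 := by
            nth_rewrite 2 [← Real.rpow_one 2]
            exact Real.rpow_le_rpow_of_exponent_le (by norm_num) (by norm_num)
          have e1 : γ ^ (1 / (4 / 3) : ℝ) * γ ^ (-1 * (1 / 4) : ℝ) = γ ^ (1 / 2 : ℝ) := by
            rw [← Real.rpow_add hγ]; norm_num
          have e2 : α ^ (-(-(4 / 3)) * (1 / 4) : ℝ) = α ^ (1 / 3 : ℝ) := by norm_num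
          rw [e2]
          calc _ = (2 : ℝ) ^ (1 / 4 : ℝ) * α ^ (1 / 3 : ℝ) *
                (γ ^ (1 / (4 / 3) : ℝ) * γ ^ (-1 * (1 / 4) : ℝ)) := by ring
            _ ≤ _ := by rw [e1]; gcongr
  calc ∫⁻ y in {y | g y ≤ ENNReal.ofReal α}, g y * decay (x - y)
      = (∫⁻ y in {y | g y ≤ ENNReal.ofReal α} ∩ S, g y * decay (x - y)) +
        ∫⁻ y in {y | g y ≤ ENNReal.ofReal α} ∩ Sᶜ, g y * decay (x - y) := by
        rw [← sdiff_eq]; exact (lintegral_inter_add_sdiff _ _ hmS).symm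
    _ ≤ _ := add_le_add near far
    _ = _ := by
        rw [← ENNReal.ofReal_add (by positivity) (by positivity), hγG,
          ENNReal.ofReal_rpow_of_pos hα, ENNReal.ofReal_rpow_of_pos hγ,
          show (6 : ℝ≥0∞) = ENNReal.ofReal 6 by simp, ← ENNReal.ofReal_mul (by norm_num),
          ← ENNReal.ofReal_mul (by positivity)]
        congr 1; ring

/-- The truncated potential bound is used at level $a=f(x)$; the weight $f(x)$ raises $f(x)^{1/3}$
to the integrable power $4/3$. -/
theorem lintegral_lintegral_truncated_le {f g : ℝ → ℝ≥0∞} (hf : Measurable f) (hg : Measurable g)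
    (hF : ∫⁻ y, f y ^ (4 / 3 : ℝ) ≠ ∞) (hG : ∫⁻ y, g y ^ (4 / 3 : ℝ) ≠ ∞) :
    ∫⁻ x, ∫⁻ y in {y | g y ≤ f x}, f x * (g y * decay (x - y)) ≤
      6 * (∫⁻ y, f y ^ (4 / 3 : ℝ)) * (∫⁻ y, g y ^ (4 / 3 : ℝ)) ^ (1 / 2 : ℝ) := by
  set G := ∫⁻ y, g y ^ (4 / 3 : ℝ) with hGdef
  have hfin : ∀ᵐ x, f x ^ (4 / 3 : ℝ) < ∞ := ae_lt_top (by fun_prop) hF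
  calc ∫⁻ x, ∫⁻ y in {y | g y ≤ f x}, f x * (g y * decay (x - y))
      ≤ ∫⁻ x, 6 * G ^ (1 / 2 : ℝ) * f x ^ (4 / 3 : ℝ) := by
        refine lintegral_mono_ae ?_
        filter_upwards [hfin] with x hx
        rw [lintegral_const_mul _ (measurable_mul_decay hg x)]
        rcases eq_or_ne (f x) 0 with h0 | h0
        · simp [h0]
        have htop : f x ≠ ∞ := by
          rintro h
          rw [h] at hx
          simp at hx
        calc f x * ∫⁻ y in {y | g y ≤ f x}, g y * decay (x - y)
            ≤ f x * (6 * f x ^ (1 / 3 : ℝ) * G ^ (1 / 2 : ℝ)) := by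
              gcongr
              exact lintegral_truncated_mul_decay_le hg hG h0 htop x
          _ = 6 * G ^ (1 / 2 : ℝ) * (f x ^ (1 : ℝ) * f x ^ (1 / 3 : ℝ)) := by
              rw [ENNReal.rpow_one]; ring
          _ = _ := by rw [← ENNReal.rpow_add _ _ h0 htop]; norm_num
    _ = 6 * G ^ (1 / 2 : ℝ) * ∫⁻ x, f x ^ (4 / 3 : ℝ) := lintegral_const_mul _ (by fun_prop)
    _ = _ := by ring

/-- For each pair $(x,y)$ one of $f(x)$, $g(y)$ dominates the other. The kernel is even, so both
regions are instances of the truncated estimate with the roles exchanged. The bound is not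
homogeneous; scaling is restored later. -/
theorem lintegral_lintegral_mul_decay_le {f g : ℝ → ℝ≥0∞} (hf : Measurable f) (hg : Measurable g)
    (hF : ∫⁻ y, f y ^ (4 / 3 : ℝ) ≠ ∞) (hG : ∫⁻ y, g y ^ (4 / 3 : ℝ) ≠ ∞) :
    ∫⁻ x, ∫⁻ y, f x * (g y * decay (x - y)) ≤
      6 * (∫⁻ y, f y ^ (4 / 3 : ℝ)) * (∫⁻ y, g y ^ (4 / 3 : ℝ)) ^ (1 / 2 : ℝ) +
      6 * (∫⁻ y, g y ^ (4 / 3 : ℝ)) * (∫⁻ y, f y ^ (4 / 3 : ℝ)) ^ (1 / 2 : ℝ) := by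
  have hK : Measurable fun p : ℝ × ℝ => f p.1 * (g p.2 * decay (p.1 - p.2)) :=
    (hf.comp measurable_fst).mul ((hg.comp measurable_snd).mul
      (measurable_decay.comp (measurable_fst.sub measurable_snd)))
  have hS : MeasurableSet {p : ℝ × ℝ | g p.2 ≤ f p.1} :=
    measurableSet_le (hg.comp measurable_snd) (hf.comp measurable_fst)
  have hS' : MeasurableSet {p : ℝ × ℝ | f p.1 ≤ g p.2} :=
    measurableSet_le (hf.comp measurable_fst) (hg.comp measurable_snd)
  have split : ∀ p : ℝ × ℝ, f p.1 * (g p.2 * decay (p.1 - p.2)) ≤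
      {p : ℝ × ℝ | g p.2 ≤ f p.1}.indicator (fun p => f p.1 * (g p.2 * decay (p.1 - p.2))) p +
      {p : ℝ × ℝ | f p.1 ≤ g p.2}.indicator (fun p => f p.1 * (g p.2 * decay (p.1 - p.2))) p := by
    intro p
    rcases le_total (g p.2) (f p.1) with h | h
    · rw [indicator_of_mem (s := {p : ℝ × ℝ | g p.2 ≤ f p.1}) h]
      exact le_self_add
    · rw [indicator_of_mem (s := {p : ℝ × ℝ | f p.1 ≤ g p.2}) h]
      exact le_add_self
  have h1 : ∫⁻ p : ℝ × ℝ, {p : ℝ × ℝ | g p.2 ≤ f p.1}.indicator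
      (fun p => f p.1 * (g p.2 * decay (p.1 - p.2))) p ≤
      6 * (∫⁻ y, f y ^ (4 / 3 : ℝ)) * (∫⁻ y, g y ^ (4 / 3 : ℝ)) ^ (1 / 2 : ℝ) := by
    refine le_trans (le_of_eq ?_) (lintegral_lintegral_truncated_le hf hg hF hG)
    rw [Measure.volume_eq_prod, lintegral_prod _ (hK.indicator hS).aemeasurable]
    refine lintegral_congr fun x => ?_
    rw [← lintegral_indicator (measurableSet_le hg measurable_const)]
    rfl
  have h2 : ∫⁻ p : ℝ × ℝ, {p : ℝ × ℝ | f p.1 ≤ g p.2}.indicator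
      (fun p => f p.1 * (g p.2 * decay (p.1 - p.2))) p ≤
      6 * (∫⁻ y, g y ^ (4 / 3 : ℝ)) * (∫⁻ y, f y ^ (4 / 3 : ℝ)) ^ (1 / 2 : ℝ) := by
    refine le_trans (le_of_eq ?_) (lintegral_lintegral_truncated_le hg hf hG hF)
    rw [Measure.volume_eq_prod, lintegral_prod_symm _ (hK.indicator hS').aemeasurable]
    refine lintegral_congr fun y => ?_
    rw [← lintegral_indicator (measurableSet_le hf measurable_const)]
    refine lintegral_congr fun x => ?_
    simp only [indicator, mem_ofPred_eq, decay_sub_comm y x, mul_left_comm (f x) (g y)]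
  calc ∫⁻ x, ∫⁻ y, f x * (g y * decay (x - y))
      = ∫⁻ p : ℝ × ℝ, f p.1 * (g p.2 * decay (p.1 - p.2)) := by
        rw [Measure.volume_eq_prod, lintegral_prod _ hK.aemeasurable]
    _ ≤ _ := lintegral_mono split
    _ = _ := lintegral_add_left (hK.indicator hS) _
    _ ≤ _ := add_le_add h1 h2

/-- The diagonal Hardy–Littlewood–Sobolev inequality. -/
theorem lintegral_lintegral_self_mul_decay_le {g : ℝ → ℝ≥0∞} (hg : Measurable g) :
    ∫⁻ x, ∫⁻ y, g x * (g y * decay (x - y)) ≤ 12 * (∫⁻ y, g y ^ (4 / 3 : ℝ)) ^ (3 / 2 : ℝ) := by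
  rcases eq_or_ne (∫⁻ y, g y ^ (4 / 3 : ℝ)) ∞ with hG | hG
  · rw [hG]; simp
  refine (lintegral_lintegral_mul_decay_le hg hg hG hG).trans (le_of_eq ?_)
  set G := ∫⁻ y, g y ^ (4 / 3 : ℝ)
  rcases eq_or_ne G 0 with h0 | h0
  · simp [h0]
  have : G ^ (3 / 2 : ℝ) = G * G ^ (1 / 2 : ℝ) := by
    nth_rewrite 2 [← ENNReal.rpow_one G]
    rw [← ENNReal.rpow_add _ _ h0 hG]; norm_num
  rw [this]; ring

/-- The operator bound follows from the bilinear one by duality. The normalisation makes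
$6G^{1/2}=1/2$, so that the first term of the bilinear bound can be absorbed. -/
theorem lintegral_min_pow_le {g : ℝ → ℝ≥0∞} (hg : Measurable g)
    (hG : ∫⁻ y, g y ^ (4 / 3 : ℝ) = ENNReal.ofReal (1 / 144)) :
    ∫⁻ x, (∫⁻ y, g y * decay (x - y)) ^ (4 : ℝ) ≤ ENNReal.ofReal (1 / 144) := by
  set B : ℝ → ℝ≥0∞ := fun x => ∫⁻ y, g y * decay (x - y) with hB
  have hBm : Measurable B := by
    have : Measurable fun p : ℝ × ℝ => g p.2 * decay (p.1 - p.2) :=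
      (hg.comp measurable_snd).mul (measurable_decay.comp (measurable_fst.sub measurable_snd))
    exact this.lintegral_prod_right'
  -- Cutting off in height and in space makes the fourth-power integral finite, which the absorption
  -- requires.
  set b : ℕ → ℝ → ℝ≥0∞ := fun n => (Icc (-(n : ℝ)) n).indicator fun x => min (B x) n with hb
  have hbm : ∀ n, Measurable (b n) := fun n =>
    (hBm.min measurable_const).indicator measurableSet_Icc
  have hbB : ∀ n x, b n x ≤ B x := fun n x => by
    simp only [hb, indicator]; split_ifs
    · exact min_le_left _ _
    · exact zero_le
  have key : ∀ n, ∫⁻ x, b n x ^ (4 : ℝ) ≤ ENNReal.ofReal (1 / 144) := by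
    intro n
    set A := ∫⁻ x, b n x ^ (4 : ℝ) with hA
    have hAtop : A ≠ ∞ := by
      have : A ≤ ∫⁻ x in Icc (-(n : ℝ)) n, (n : ℝ≥0∞) ^ (4 : ℝ) := by
        rw [← lintegral_indicator measurableSet_Icc]
        refine lintegral_mono fun x => ?_
        simp only [hb, indicator]; split_ifs
        · gcongr; exact min_le_right _ _
        · simp
      refine ne_top_of_le_ne_top ?_ this
      rw [setLIntegral_const]
      exact ENNReal.mul_ne_top (ENNReal.rpow_ne_top_of_nonneg (by norm_num) (by simp)) (by simp)
    have e : ∫⁻ x, (b n x ^ (3 : ℝ)) ^ (4 / 3 : ℝ) = A := by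
      refine lintegral_congr fun x => ?_
      rw [← ENNReal.rpow_mul]; norm_num
    have h1 : A ≤ ∫⁻ x, ∫⁻ y, b n x ^ (3 : ℝ) * (g y * decay (x - y)) := by
      refine lintegral_mono fun x => ?_
      rw [lintegral_const_mul _ (measurable_mul_decay hg x)]
      calc b n x ^ (4 : ℝ) = b n x ^ (3 : ℝ) * b n x := by
            nth_rewrite 3 [← ENNReal.rpow_one (b n x)]
            rw [← ENNReal.rpow_add_of_nonneg _ _ (by norm_num) (by norm_num)]; norm_num
        _ ≤ _ := by gcongr; exact hbB n x
    -- Testing with $b_n^3$ reproduces $A$ on both sides: $A\le\frac12A+\frac1{24}A^{1/2}$, hence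
    -- $A\le 1/144$.
    have h2 := h1.trans (lintegral_lintegral_mul_decay_le (f := fun x => b n x ^ (3 : ℝ))
      ((hbm n).pow_const _) hg (by rw [e]; exact hAtop) (by rw [hG]; simp))
    rw [e, hG] at h2
    have hs : ENNReal.ofReal (1 / 144) ^ (1 / 2 : ℝ) = ENNReal.ofReal (1 / 12) := by
      rw [ENNReal.ofReal_rpow_of_pos (by norm_num), ← Real.sqrt_eq_rpow,
        show (1 / 144 : ℝ) = (1 / 12) ^ 2 by norm_num, Real.sqrt_sq (by norm_num)]
    obtain ⟨α, hα, hαA⟩ : ∃ α : ℝ, 0 ≤ α ∧ A = ENNReal.ofReal α :=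
      ⟨A.toReal, ENNReal.toReal_nonneg, (ENNReal.ofReal_toReal hAtop).symm⟩
    rw [hs, hαA, ENNReal.ofReal_rpow_of_nonneg hα (by norm_num),
      show (6 : ℝ≥0∞) = ENNReal.ofReal 6 by simp, ← ENNReal.ofReal_mul (by positivity),
      ← ENNReal.ofReal_mul (by positivity), ← ENNReal.ofReal_mul (by positivity),
      ← ENNReal.ofReal_mul (by positivity), ← ENNReal.ofReal_add (by positivity) (by positivity),
      ENNReal.ofReal_le_ofReal_iff (by positivity), ← Real.sqrt_eq_rpow] at h2
    rw [hαA]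
    apply ENNReal.ofReal_le_ofReal
    have hsq := Real.sq_sqrt hα
    have hs0 := Real.sqrt_nonneg α
    nlinarith [hsq, hs0]
  have hmono : ∀ x, Monotone fun n => b n x ^ (4 : ℝ) := by
    intro x m n hmn
    have hmn' : (m : ℝ) ≤ n := by exact_mod_cast hmn
    simp only [hb]
    gcongr
    refine indicator_le_indicator_of_subset (Icc_subset_Icc (neg_le_neg hmn') hmn')
      (fun _ => zero_le) x |>.trans ?_
    simp only [indicator]; split_ifs
    · gcongr
    · exact le_rfl
  have hsup : ∀ x, ⨆ n, b n x ^ (4 : ℝ) = B x ^ (4 : ℝ) := by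
    intro x
    refine iSup_eq_of_tendsto (hmono x) ?_
    have : Tendsto (fun n : ℕ => min (B x) (n : ℝ≥0∞)) atTop (𝓝 (min (B x) ∞)) :=
      tendsto_const_nhds.min ENNReal.tendsto_nat_nhds_top
    rw [min_top_right] at this
    have h2 := (ENNReal.continuous_rpow_const (y := 4)).continuousAt.tendsto.comp this
    refine h2.congr' ?_
    obtain ⟨N, hN⟩ := exists_nat_ge |x|
    filter_upwards [eventually_ge_atTop N] with n hn
    have hn' : (N : ℝ) ≤ n := by exact_mod_cast hn
    have : x ∈ Icc (-(n : ℝ)) n := abs_le.1 (hN.trans hn')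
    simp [hb, indicator_of_mem this]
  calc ∫⁻ x, B x ^ (4 : ℝ) = ∫⁻ x, ⨆ n, b n x ^ (4 : ℝ) := lintegral_congr fun x => (hsup x).symm
    _ = ⨆ n, ∫⁻ x, b n x ^ (4 : ℝ) :=
      lintegral_iSup (fun n => (hbm n).pow_const _) fun m n hmn x => hmono x hmn
    _ ≤ _ := iSup_le key

/-- The Hardy–Littlewood–Sobolev inequality `L^(4/3) → L^4` for `|t|^(-1/2)`. -/
theorem lintegral_potential_pow_le {g : ℝ → ℝ≥0∞} (hg : Measurable g) :
    ∫⁻ x, (∫⁻ y, g y * decay (x - y)) ^ (4 : ℝ) ≤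
      ENNReal.ofReal (144 ^ 2) * (∫⁻ y, g y ^ (4 / 3 : ℝ)) ^ (3 : ℝ) := by
  set G := ∫⁻ y, g y ^ (4 / 3 : ℝ) with hG
  rcases eq_or_ne G ∞ with h | hGt
  · rw [h]; simp
  rcases eq_or_ne G 0 with hG0 | hG0
  · have hg0 : g =ᵐ[volume] 0 := by
      rw [hG, lintegral_eq_zero_iff (by fun_prop)] at hG0
      filter_upwards [hG0] with y hy
      exact (ENNReal.rpow_eq_zero_iff_of_pos (by norm_num)).1 hy
    have : ∀ x, ∫⁻ y, g y * decay (x - y) = 0 := fun x => by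
      rw [lintegral_eq_zero_iff (measurable_mul_decay hg x)]
      filter_upwards [hg0] with y hy
      simp [hy]
    simp [this]
  obtain ⟨γ, hγ, hγG⟩ : ∃ γ : ℝ, 0 < γ ∧ G = ENNReal.ofReal γ :=
    ⟨G.toReal, ENNReal.toReal_pos hG0 hGt, (ENNReal.ofReal_toReal hGt).symm⟩
  -- The factor for which $c^{4/3}\gamma=1/144$, so that $cg$ is normalised.
  set c : ℝ := (144 * γ) ^ (-(3 / 4) : ℝ) with hc
  have hcpos : 0 < c := by positivity
  have h1 : ∫⁻ y, (ENNReal.ofReal c * g y) ^ (4 / 3 : ℝ) = ENNReal.ofReal (1 / 144) := by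
    simp_rw [ENNReal.mul_rpow_of_nonneg _ _ (show (0 : ℝ) ≤ 4 / 3 by norm_num)]
    rw [lintegral_const_mul _ (by fun_prop), ← hG, hγG, ENNReal.ofReal_rpow_of_pos hcpos,
      ← ENNReal.ofReal_mul (by positivity), hc, ← Real.rpow_mul (by positivity)]
    congr 1
    rw [show (-(3 / 4) * (4 / 3) : ℝ) = -1 by norm_num, Real.rpow_neg_one]
    field_simp
  have h2 := lintegral_min_pow_le (g := fun y => ENNReal.ofReal c * g y) (by fun_prop) h1
  simp_rw [mul_assoc, lintegral_const_mul (ENNReal.ofReal c) (measurable_mul_decay hg _),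
    ENNReal.mul_rpow_of_nonneg _ _ (show (0 : ℝ) ≤ 4 by norm_num)] at h2
  rw [lintegral_const_mul' _ _ (ENNReal.rpow_ne_top_of_nonneg (by norm_num) (by simp)),
    ENNReal.ofReal_rpow_of_pos hcpos] at h2
  have hc4 : 0 < c ^ (4 : ℝ) := by positivity
  have h3 : ENNReal.ofReal (c ^ (4 : ℝ))⁻¹ * ENNReal.ofReal (c ^ (4 : ℝ)) = 1 := by
    rw [← ENNReal.ofReal_mul (by positivity), inv_mul_cancel₀ hc4.ne', ENNReal.ofReal_one]
  calc ∫⁻ x, (∫⁻ y, g y * decay (x - y)) ^ (4 : ℝ)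
      = ENNReal.ofReal (c ^ (4 : ℝ))⁻¹ * (ENNReal.ofReal (c ^ (4 : ℝ)) *
          ∫⁻ x, (∫⁻ y, g y * decay (x - y)) ^ (4 : ℝ)) := by rw [← mul_assoc, h3, one_mul]
    _ ≤ ENNReal.ofReal (c ^ (4 : ℝ))⁻¹ * ENNReal.ofReal (1 / 144) := by gcongr
    _ = _ := by
        rw [hγG, ENNReal.ofReal_rpow_of_pos hγ, ← ENNReal.ofReal_mul (by positivity),
          ← ENNReal.ofReal_mul (by positivity), hc, ← Real.rpow_mul (by positivity),
          show (-(3 / 4) * 4 : ℝ) = -3 by norm_num, Real.rpow_neg (by positivity), inv_inv,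
          Real.mul_rpow (by norm_num) hγ.le]
        congr 1
        norm_num
        ring

/-! ### The free Schrödinger group on `L²` -/

theorem symbol_zero (ξ : ℝ) : symbol 0 ξ = 1 := by simp [symbol]

theorem symbol_add (s t ξ : ℝ) : symbol (s + t) ξ = symbol s ξ * symbol t ξ := by
  rw [symbol, symbol, symbol, ← Complex.exp_add]
  congr 1
  push_cast
  ring

theorem conj_symbol (t ξ : ℝ) : (starRingEnd ℂ) (symbol t ξ) = symbol (-t) ξ := by
  rw [symbol, symbol, ← Complex.exp_conj, map_mul, Complex.conj_ofReal, Complex.conj_I]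
  congr 1
  push_cast
  ring

theorem continuous_symbol_uncurry : Continuous fun p : ℝ × ℝ => symbol p.1 p.2 := by
  unfold symbol
  fun_prop

@[fun_prop]
theorem continuous_symbol_comp {X : Type*} [TopologicalSpace X] {f g : X → ℝ}
    (hf : Continuous f) (hg : Continuous g) : Continuous fun x => symbol (f x) (g x) :=
  continuous_symbol_uncurry.comp (hf.prodMk hg)

@[fun_prop]
theorem measurable_symbol_comp {X : Type*} [MeasurableSpace X] {f g : X → ℝ}
    (hf : Measurable f) (hg : Measurable g) : Measurable fun x => symbol (f x) (g x) :=
  continuous_symbol_uncurry.measurable.comp (hf.prodMk hg)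

/-- Multiplication by the symbol of `e^{it∂ₓ²}` as an isometry of `L²`. -/
def symbolMul (t : ℝ) : L2 →ₗᵢ[ℂ] L2 where
  toFun f := (memLp_symbol_mul t f).toLp _
  map_add' f g := by
    ext1
    filter_upwards [(memLp_symbol_mul t (f + g)).coeFn_toLp, (memLp_symbol_mul t f).coeFn_toLp,
      (memLp_symbol_mul t g).coeFn_toLp, Lp.coeFn_add f g, Lp.coeFn_add
        ((memLp_symbol_mul t f).toLp _) ((memLp_symbol_mul t g).toLp _)] with x h1 h2 h3 h4 h5
    rw [h1, h5, Pi.add_apply, h2, h3, h4, Pi.add_apply, mul_add]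
  map_smul' c f := by
    ext1
    filter_upwards [(memLp_symbol_mul t (c • f)).coeFn_toLp, (memLp_symbol_mul t f).coeFn_toLp,
      Lp.coeFn_smul c f, Lp.coeFn_smul c ((memLp_symbol_mul t f).toLp _)] with x h1 h2 h3 h4
    simp only [RingHom.id_apply]
    rw [h1, h4, Pi.smul_apply, h2, h3, Pi.smul_apply, smul_eq_mul, smul_eq_mul, mul_left_comm]
  norm_map' f := by
    change ‖(memLp_symbol_mul t f).toLp _‖ = ‖f‖
    rw [Lp.norm_toLp, Lp.norm_def]
    congr 1
    exact eLpNorm_congr_norm_ae (Eventually.of_forall fun x => by simp [norm_symbol])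

theorem coeFn_symbolMul (t : ℝ) (f : L2) :
    symbolMul t f =ᵐ[volume] fun ξ => symbol t ξ * f ξ :=
  (memLp_symbol_mul t f).coeFn_toLp

/-- The free propagator as a linear isometry of `L²`. -/
def propagator (t : ℝ) : L2 →ₗᵢ[ℂ] L2 :=
  (Lp.fourierTransformₗᵢ ℝ ℂ).symm.toLinearIsometry.comp
    ((symbolMul t).comp (Lp.fourierTransformₗᵢ ℝ ℂ).toLinearIsometry)

theorem propagator_apply (t : ℝ) (f : L2) : propagator t f = freeEvolution t f := rfl

theorem fourier_propagator_eq (t : ℝ) (f : L2) :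
    (𝓕 (propagator t f) : L2) = symbolMul t (𝓕 f) :=
  (Lp.fourierTransformₗᵢ ℝ ℂ).apply_symm_apply _

theorem fourier_propagator (t : ℝ) (f : L2) :
    (𝓕 (propagator t f) : L2) =ᵐ[volume] fun ξ => symbol t ξ * (𝓕 f : L2) ξ := by
  rw [fourier_propagator_eq]
  exact coeFn_symbolMul t _

theorem fourier_injective {f g : L2} (h : (𝓕 f : L2) = 𝓕 g) : f = g :=
  (Lp.fourierTransformₗᵢ ℝ ℂ).injective h

theorem propagator_zero (f : L2) : propagator 0 f = f := by
  apply fourier_injective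
  ext1
  filter_upwards [fourier_propagator 0 f] with ξ h
  rw [h, symbol_zero, one_mul]

theorem propagator_add (s t : ℝ) (f : L2) :
    propagator (s + t) f = propagator s (propagator t f) := by
  apply fourier_injective
  ext1
  filter_upwards [fourier_propagator (s + t) f, fourier_propagator t f,
    fourier_propagator s (propagator t f)] with ξ h1 h2 h3
  rw [h1, h3, h2, symbol_add, mul_assoc]

theorem propagator_neg_propagator (t : ℝ) (f : L2) : propagator (-t) (propagator t f) = f := by
  rw [← propagator_add, neg_add_cancel, propagator_zero]

theorem propagator_propagator_neg (t : ℝ) (f : L2) : propagator t (propagator (-t) f) = f := by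
  rw [← propagator_add, add_neg_cancel, propagator_zero]

theorem inner_propagator_left (t : ℝ) (f g : L2) :
    inner ℂ (propagator t f) g = inner ℂ f (propagator (-t) g) := by
  rw [← (propagator t).inner_map_map f (propagator (-t) g), propagator_propagator_neg]

/-- Dominated convergence on the Fourier side, with dominating function $4|g|^2$, because the symbol
is unimodular and continuous in time. -/
theorem continuous_symbolMul_apply (g : L2) : Continuous fun t => symbolMul t g := by
  have hint : Integrable (fun ξ => ‖g ξ‖ ^ 2) := (Lp.memLp g).integrable_norm_pow (by norm_num)
  have key : ∀ t s, ‖symbolMul t g - symbolMul s g‖ ^ 2 =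
      ∫ ξ, ‖symbol t ξ - symbol s ξ‖ ^ 2 * ‖g ξ‖ ^ 2 := by
    intro t s
    rw [← inner_self_eq_norm_sq (𝕜 := ℂ), L2.inner_def, ← integral_re]
    · refine integral_congr_ae ?_
      filter_upwards [Lp.coeFn_sub (symbolMul t g) (symbolMul s g), coeFn_symbolMul t g,
        coeFn_symbolMul s g] with ξ h1 h2 h3
      rw [h1, Pi.sub_apply, h2, h3, inner_self_eq_norm_sq (𝕜 := ℂ),
        ← sub_mul, norm_mul, mul_pow]
    · exact L2.integrable_inner _ _
  rw [continuous_iff_continuousAt]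
  intro s
  rw [ContinuousAt, tendsto_iff_norm_sub_tendsto_zero]
  have h2 : Tendsto (fun t => ‖symbolMul t g - symbolMul s g‖ ^ 2) (𝓝 s) (𝓝 0) := by
    simp_rw [key]
    have : (0 : ℝ) = ∫ ξ, ‖symbol s ξ - symbol s ξ‖ ^ 2 * ‖g ξ‖ ^ 2 := by simp
    rw [this]
    refine tendsto_integral_filter_of_dominated_convergence (fun ξ => 4 * ‖g ξ‖ ^ 2) ?_ ?_
      (hint.const_mul 4) ?_
    · refine Eventually.of_forall fun t => ?_
      exact (Continuous.aestronglyMeasurable (by fun_prop)).mul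
        ((Lp.aestronglyMeasurable g).norm.pow 2)
    · refine Eventually.of_forall fun t => Eventually.of_forall fun ξ => ?_
      rw [Real.norm_of_nonneg (by positivity)]
      gcongr
      have : ‖symbol t ξ - symbol s ξ‖ ≤ 2 := by
        refine (norm_sub_le _ _).trans ?_
        rw [norm_symbol, norm_symbol]; norm_num
      nlinarith [norm_nonneg (symbol t ξ - symbol s ξ)]
    · refine Eventually.of_forall fun ξ => Continuous.tendsto (by fun_prop) s
  have h3 := h2.sqrt
  simpa [Real.sqrt_sq (norm_nonneg _)] using h3

theorem continuous_propagator_apply (f : L2) : Continuous fun t => propagator t f :=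
  (Lp.fourierTransformₗᵢ ℝ ℂ).symm.continuous.comp (continuous_symbolMul_apply (𝓕 f))

theorem continuous_propagator : Continuous fun p : ℝ × L2 => propagator p.1 p.2 := by
  refine continuous_prod_of_continuous_lipschitzWith' (fun p : ℝ × L2 => propagator p.1 p.2) 1
    (fun t => (propagator t).lipschitz) continuous_propagator_apply

/-! ### Continuous representatives through Fourier inversion -/

/-- The plane wave `e^{2πixξ}`. -/
def wave (x ξ : ℝ) : ℂ := Complex.exp (((2 * Real.pi * (x * ξ) : ℝ) : ℂ) * Complex.I)

theorem norm_wave (x ξ : ℝ) : ‖wave x ξ‖ = 1 := Complex.norm_exp_ofReal_mul_I _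

theorem wave_add (x y ξ : ℝ) : wave (x + y) ξ = wave x ξ * wave y ξ := by
  rw [wave, wave, wave, ← Complex.exp_add]
  congr 1
  push_cast
  ring

theorem conj_wave (x ξ : ℝ) : (starRingEnd ℂ) (wave x ξ) = wave (-x) ξ := by
  rw [wave, wave, ← Complex.exp_conj, map_mul, Complex.conj_ofReal, Complex.conj_I]
  congr 1
  push_cast
  ring

theorem continuous_wave_uncurry : Continuous fun p : ℝ × ℝ => wave p.1 p.2 := by
  unfold wave
  fun_prop

@[fun_prop]
theorem continuous_wave_comp {X : Type*} [TopologicalSpace X] {f g : X → ℝ}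
    (hf : Continuous f) (hg : Continuous g) : Continuous fun x => wave (f x) (g x) :=
  continuous_wave_uncurry.comp (hf.prodMk hg)

@[fun_prop]
theorem measurable_wave_comp {X : Type*} [MeasurableSpace X] {f g : X → ℝ}
    (hf : Measurable f) (hg : Measurable g) : Measurable fun x => wave (f x) (g x) :=
  continuous_wave_uncurry.measurable.comp (hf.prodMk hg)

theorem fourierInv_eq_integral_wave (m : ℝ → ℂ) (x : ℝ) : 𝓕⁻ m x = ∫ ξ, wave x ξ * m ξ := by
  rw [Real.fourierInv_eq']
  refine integral_congr_ae (Eventually.of_forall fun ξ => ?_)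
  simp only [wave, smul_eq_mul]
  congr 3

/-- The inverse Fourier transform of an integrable function, as a bounded continuous function. -/
def invFourier (m : ℝ → ℂ) : ℝ →ᵇ ℂ :=
  open Classical in
  if h : Integrable m then Real.Lp.fourierTransformInv (memLp_one_iff_integrable.2 h).toLp else 0

theorem coe_invFourier {m : ℝ → ℂ} (h : Integrable m) : (invFourier m : ℝ → ℂ) = 𝓕⁻ m := by
  rw [invFourier, dif_pos h]
  exact Real.Lp.fourierTransformInv_toLp _

theorem invFourier_apply {m : ℝ → ℂ} (h : Integrable m) (x : ℝ) :
    invFourier m x = ∫ ξ, wave x ξ * m ξ := by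
  rw [coe_invFourier h, fourierInv_eq_integral_wave]

theorem integrable_wave_mul {m : ℝ → ℂ} (h : Integrable m) (x : ℝ) :
    Integrable fun ξ => wave x ξ * m ξ :=
  h.bdd_mul (c := 1) (Continuous.aestronglyMeasurable (by fun_prop))
    (Eventually.of_forall fun ξ => (norm_wave x ξ).le)

theorem dist_invFourier_le {m n : ℝ → ℂ} (hm : Integrable m) (hn : Integrable n) :
    dist (invFourier m) (invFourier n) ≤ ∫ ξ, ‖m ξ - n ξ‖ := by
  rw [BoundedContinuousFunction.dist_le (integral_nonneg fun _ => norm_nonneg _)]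
  intro x
  rw [invFourier_apply hm, invFourier_apply hn, dist_eq_norm,
    ← integral_sub (integrable_wave_mul hm x) (integrable_wave_mul hn x)]
  refine (norm_integral_le_integral_norm _).trans (le_of_eq ?_)
  refine integral_congr_ae (Eventually.of_forall fun ξ => ?_)
  simp only
  rw [← mul_sub, norm_mul, norm_wave, one_mul]

theorem tendsto_invFourier_cocompact (m : ℝ → ℂ) :
    Tendsto (invFourier m) (cocompact ℝ) (𝓝 0) := by
  by_cases h : Integrable m
  · rw [coe_invFourier h]
    have := (Real.zero_at_infty_fourier m).comp
      (Homeomorph.neg ℝ).isClosedEmbedding.tendsto_cocompact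
    refine this.congr fun x => ?_
    simp [Real.fourierInv_eq_fourier_neg]
  · rw [invFourier, dif_neg h]
    exact tendsto_const_nhds

/-- The sup norm of an inverse transform is at most the $L^1$ norm on the Fourier side, so dominated
convergence in frequency gives continuity in time with values in bounded continuous functions. -/
theorem continuous_invFourier {m : ℝ → ℝ → ℂ} {b : ℝ → ℝ} (hb : Integrable b)
    (hm : ∀ t, AEStronglyMeasurable (m t)) (hmb : ∀ t, ∀ᵐ ξ, ‖m t ξ‖ ≤ b ξ)
    (hc : ∀ᵐ ξ, Continuous fun t => m t ξ) : Continuous fun t => invFourier (m t) := by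
  have hi : ∀ t, Integrable (m t) := fun t => hb.mono' (hm t) (hmb t)
  rw [continuous_iff_continuousAt]
  intro s
  rw [ContinuousAt, tendsto_iff_dist_tendsto_zero]
  have h0 : Tendsto (fun t => ∫ ξ, ‖m t ξ - m s ξ‖) (𝓝 s) (𝓝 0) := by
    have : (0 : ℝ) = ∫ ξ, ‖m s ξ - m s ξ‖ := by simp
    rw [this]
    refine tendsto_integral_filter_of_dominated_convergence (fun ξ => 2 * b ξ) ?_ ?_
      (hb.const_mul 2) ?_
    · exact Eventually.of_forall fun t => ((hm t).sub (hm s)).norm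
    · refine Eventually.of_forall fun t => ?_
      filter_upwards [hmb t, hmb s] with ξ h1 h2
      rw [norm_norm]
      exact (norm_sub_le _ _).trans (by linarith)
    · filter_upwards [hc] with ξ h
      exact ((h.sub continuous_const).norm).tendsto s
  exact squeeze_zero (fun _ => dist_nonneg) (fun t => dist_invFourier_le (hi t) (hi s)) h0

/-- The $L^2$ inverse transform is an extension by density and the other one an integral. They agree
because they define the same distribution when tested on smooth compactly supported functions. -/
theorem coeFn_fourierInv_toLp {m : ℝ → ℂ} (h1 : Integrable m) (h2 : MemLp m 2) :
    (𝓕⁻ (h2.toLp m) : L2) =ᵐ[volume] invFourier m := by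
  refine ae_eq_of_integral_contDiff_smul_eq
    ((Lp.memLp _).locallyIntegrable (by norm_num))
    (invFourier m).continuous.locallyIntegrable fun g hg hgc => ?_
  have hg' : ContDiff ℝ (⊤ : ℕ∞) (fun x => (g x : ℂ)) := Complex.ofRealCLM.contDiff.comp hg
  set φ : 𝓢(ℝ, ℂ) := (hgc.comp_left (g := fun x : ℝ => (x : ℂ)) rfl).toSchwartzMap hg' with hφ
  have hφg : ∀ x, φ x = (g x : ℂ) := fun x => rfl
  have e1 : ∫ x, φ x • (𝓕⁻ (h2.toLp m) : L2) x = ∫ ξ, (𝓕⁻ φ) ξ • m ξ := by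
    rw [← Lp.toTemperedDistribution_apply, ← Lp.fourierInv_toTemperedDistribution_eq,
      TemperedDistribution.fourierInv_apply, Lp.toTemperedDistribution_apply]
    refine integral_congr_ae ?_
    filter_upwards [h2.coeFn_toLp] with ξ h
    rw [h]
  have e2 : ∫ ξ, (𝓕⁻ φ) ξ • m ξ = ∫ x, φ x • (𝓕⁻ m) x := by
    -- The inverse transform is the Fourier integral for the symmetric form
    -- $-\langle\cdot,\cdot\rangle$, so it can be moved from one factor to the other.
    have h := VectorFourier.integral_fourierIntegral_smul_eq_flip (e := Real.fourierChar)
      (μ := (volume : Measure ℝ)) (ν := (volume : Measure ℝ)) (L := -innerₗ ℝ)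
      Real.continuous_fourierChar (by
        simp only [LinearMap.neg_apply, innerₗ_apply_apply]
        fun_prop) φ.integrable h1
    have hflip : (-innerₗ ℝ : ℝ →ₗ[ℝ] ℝ →ₗ[ℝ] ℝ).flip = -innerₗ ℝ := by
      ext; simp
    rw [hflip] at h
    rw [SchwartzMap.fourierInv_coe]
    exact h
  have e3 : ∀ w : ℝ → ℂ, ∫ x, g x • w x = ∫ x, φ x • w x := fun w => by
    refine integral_congr_ae (Eventually.of_forall fun x => ?_)
    simp [hφg]
  rw [e3, e3, e1, e2, coe_invFourier h1]

theorem coeFn_eq_invFourier {w : L2} (h : Integrable (𝓕 w : L2)) :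
    w =ᵐ[volume] invFourier (𝓕 w : L2) := by
  have := coeFn_fourierInv_toLp h (Lp.memLp (𝓕 w : L2))
  rw [Lp.toLp_coeFn] at this
  rwa [show (𝓕⁻ (𝓕 w : L2) : L2) = w from (Lp.fourierTransformₗᵢ ℝ ℂ).symm_apply_apply w] at this

theorem integrable_symbol_mul {m : ℝ → ℂ} (h : Integrable m) (t : ℝ) :
    Integrable fun ξ => symbol t ξ * m ξ :=
  h.bdd_mul (c := 1) (continuous_symbol t).aestronglyMeasurable
    (Eventually.of_forall fun ξ => (norm_symbol t ξ).le)

theorem invFourier_congr_ae {m n : ℝ → ℂ} (h : m =ᵐ[volume] n) : invFourier m = invFourier n := by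
  by_cases hm : Integrable m
  · have hn : Integrable n := (integrable_congr h).1 hm
    ext x
    rw [coe_invFourier hm, coe_invFourier hn]
    exact Real.fourierInv_congr_ae h x
  · have hn : ¬ Integrable n := fun hn => hm ((integrable_congr h).2 hn)
    rw [invFourier, invFourier, dif_neg hm, dif_neg hn]

theorem propagator_ae_eq_invFourier {f : L2} (h : Integrable (𝓕 f : L2)) (t : ℝ) :
    propagator t f =ᵐ[volume] invFourier fun ξ => symbol t ξ * (𝓕 f : L2) ξ := by
  have h1 := fourier_propagator t f
  have h2 := coeFn_eq_invFourier ((integrable_congr h1).2 (integrable_symbol_mul h t))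
  rwa [invFourier_congr_ae h1] at h2

theorem contRep_propagator {f : L2} (h : Integrable (𝓕 f : L2)) (t : ℝ) :
    contRep (propagator t f) = invFourier fun ξ => symbol t ξ * (𝓕 f : L2) ξ :=
  contRep_eq (propagator_ae_eq_invFourier h t)

theorem continuous_contRep_propagator {f : L2} (h : Integrable (𝓕 f : L2)) :
    Continuous fun t => contRep (propagator t f) := by
  simp_rw [contRep_propagator h]
  refine continuous_invFourier h.norm (fun t => (integrable_symbol_mul h t).aestronglyMeasurable)
    (fun t => Eventually.of_forall fun ξ => ?_) (Eventually.of_forall fun ξ => by fun_prop)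
  rw [norm_mul, norm_symbol, one_mul]

/-- Schwartz functions have an integrable Fourier transform. -/
theorem integrable_fourier_schwartz (φ : 𝓢(ℝ, ℂ)) : Integrable (𝓕 (φ.toLp 2 : L2) : L2) := by
  rw [SchwartzMap.toLp_fourier_eq]
  exact (integrable_congr (SchwartzMap.coeFn_toLp _ 2 _)).2 (𝓕 φ : 𝓢(ℝ, ℂ)).integrable

theorem denseRange_schwartz : DenseRange fun φ : 𝓢(ℝ, ℂ) => (φ.toLp 2 : L2) :=
  SchwartzMap.denseRange_toLpCLM (p := 2) ENNReal.ofNat_ne_top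

/-! ### The regularised Schrödinger kernel -/

/-- The Gaussian cut-off `e^{-εξ²}`. -/
def gauss (ε ξ : ℝ) : ℂ := ((Real.exp (-ε * ξ ^ 2) : ℝ) : ℂ)

theorem integrable_gauss {ε : ℝ} (hε : 0 < ε) : Integrable (gauss ε) :=
  (integrable_exp_neg_mul_sq hε).ofReal

theorem norm_gauss_le_one {ε : ℝ} (hε : 0 ≤ ε) (ξ : ℝ) : ‖gauss ε ξ‖ ≤ 1 := by
  rw [gauss, Complex.norm_real, Real.norm_of_nonneg (Real.exp_nonneg _), Real.exp_le_one_iff]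
  nlinarith [sq_nonneg ξ]

theorem continuous_gauss (ε : ℝ) : Continuous (gauss ε) := by
  unfold gauss; fun_prop

/-- The dispersive estimate for the regularised kernel. -/
theorem enorm_integral_gauss_le {ε : ℝ} (hε : 0 < ε) (τ x : ℝ) :
    ‖∫ ξ, gauss ε ξ * (symbol τ ξ * wave x ξ)‖ₑ ≤ decay τ := by
  -- At $\tau=0$ the right side is $\infty$.
  rcases eq_or_ne τ 0 with rfl | hτ
  · simp [decay]
  set b : ℂ := (ε : ℂ) + ((4 * Real.pi ^ 2 * τ : ℝ) : ℂ) * Complex.I with hb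
  have hbre : b.re = ε := by
    rw [hb, Complex.add_re, Complex.re_ofReal_mul, Complex.I_re, mul_zero, add_zero,
      Complex.ofReal_re]
  have hbim : b.im = 4 * Real.pi ^ 2 * τ := by
    rw [hb, Complex.add_im, Complex.im_ofReal_mul, Complex.I_im, mul_one, Complex.ofReal_im,
      zero_add]
  have hb0 : 0 < b.re := by rw [hbre]; exact hε
  have hbne : b ≠ 0 := fun h => by rw [h] at hb0; simp at hb0
  have e : ∀ ξ : ℝ, gauss ε ξ * (symbol τ ξ * wave x ξ) =
      Complex.exp (Complex.I * ((2 * Real.pi * x : ℝ) : ℂ) * ξ) * Complex.exp (-b * ξ ^ 2) := by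
    intro ξ
    rw [gauss, symbol, wave, Complex.ofReal_exp, ← Complex.exp_add, ← Complex.exp_add,
      ← Complex.exp_add]
    congr 1
    rw [hb]
    push_cast
    ring
  simp_rw [e]
  rw [fourierIntegral_gaussian hb0]
  have hpb : (Real.pi : ℂ) / b ≠ 0 := div_ne_zero (by exact_mod_cast Real.pi_ne_zero) hbne
  -- The imaginary part $4\pi^2\tau$ of $b$ alone gives $|\pi/b|\le|\tau|^{-1}$, uniformly in
  -- $\varepsilon$ and with constant one.
  have hbnorm : |τ| * Real.pi ≤ ‖b‖ := by
    have h1 := Complex.abs_im_le_norm b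
    rw [hbim, abs_mul, abs_of_pos (by positivity)] at h1
    have := Real.pi_gt_three
    nlinarith [abs_nonneg τ, mul_nonneg (abs_nonneg τ) Real.pi_pos.le]
  have h1 : ‖((Real.pi : ℂ) / b) ^ (1 / 2 : ℂ)‖ ≤ |τ| ^ (-(1 / 2) : ℝ) := by
    rw [Complex.norm_cpow_of_ne_zero hpb]
    have hre : (1 / 2 : ℂ).re = 1 / 2 := by norm_num
    have him : (1 / 2 : ℂ).im = 0 := by norm_num
    rw [hre, him, mul_zero, Real.exp_zero, div_one, norm_div, Complex.norm_real,
      Real.norm_of_nonneg Real.pi_pos.le, Real.rpow_neg (abs_nonneg _),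
      ← Real.inv_rpow (abs_nonneg _)]
    apply Real.rpow_le_rpow (by positivity) _ (by norm_num)
    have hτ' : 0 < |τ| := abs_pos.2 hτ
    rw [inv_eq_one_div, div_le_div_iff₀ (by positivity) hτ']
    linarith
  have h2 : ‖Complex.exp (-((2 * Real.pi * x : ℝ) : ℂ) ^ 2 / (4 * b))‖ ≤ 1 := by
    rw [Complex.norm_exp, Real.exp_le_one_iff]
    have : -((2 * Real.pi * x : ℝ) : ℂ) ^ 2 / (4 * b) =
        ((-(Real.pi * x) ^ 2 : ℝ) : ℂ) * b⁻¹ := by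
      push_cast
      field_simp
      ring
    rw [this, Complex.re_ofReal_mul, Complex.inv_re]
    have : 0 ≤ b.re / Complex.normSq b := div_nonneg hb0.le (Complex.normSq_nonneg _)
    nlinarith [sq_nonneg (Real.pi * x)]
  have hτ' : 0 < |τ| := abs_pos.2 hτ
  have h3 : decay τ = ENNReal.ofReal (|τ| ^ (-(1 / 2) : ℝ)) := by
    rw [← decay_of_pos hτ', decay, decay]
    simp
  rw [h3, ← ofReal_norm, norm_mul]
  apply ENNReal.ofReal_le_ofReal
  calc _ ≤ |τ| ^ (-(1 / 2) : ℝ) * 1 := by gcongr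
    _ = _ := mul_one _

theorem tendsto_integral_gauss_mul {m : ℝ → ℂ} (hm : Integrable m) :
    Tendsto (fun n : ℕ => ∫ ξ, gauss (1 / ((n : ℝ) + 1)) ξ * m ξ) atTop (𝓝 (∫ ξ, m ξ)) := by
  refine tendsto_integral_of_dominated_convergence (fun ξ => ‖m ξ‖) ?_ hm.norm ?_ ?_
  · intro n
    exact (continuous_gauss _).aestronglyMeasurable.mul hm.aestronglyMeasurable
  · intro n
    refine Eventually.of_forall fun ξ => ?_
    rw [norm_mul]
    exact mul_le_of_le_one_left (norm_nonneg _) (norm_gauss_le_one (by positivity) ξ)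
  · refine Eventually.of_forall fun ξ => ?_
    have h1 : Tendsto (fun n : ℕ => gauss (1 / ((n : ℝ) + 1)) ξ) atTop (𝓝 (gauss 0 ξ)) := by
      have : Continuous fun ε => gauss ε ξ := by unfold gauss; fun_prop
      exact (this.tendsto 0).comp tendsto_one_div_add_atTop_nhds_zero_nat
    have h2 : gauss 0 ξ = 1 := by simp [gauss]
    rw [h2] at h1
    simpa using h1.mul_const (m ξ)

/-! ### The homogeneous Strichartz estimate -/

/-- The Fourier-side superposition of free waves with amplitude `g` along the curve `X`. -/
def waveIntegral (g : ℝ → ℂ) (X : ℝ → ℝ) (ξ : ℝ) : ℂ :=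
  ∫ t, g t * (symbol t ξ * wave (X t) ξ)

section WaveIntegral

variable {g : ℝ → ℂ} {X : ℝ → ℝ}

theorem norm_symbol_mul_wave (t x ξ : ℝ) : ‖symbol t ξ * wave x ξ‖ = 1 := by
  rw [norm_mul, norm_symbol, norm_wave, one_mul]

theorem measurable_waveIntegral (hg : Measurable g) (hX : Measurable X) :
    Measurable (waveIntegral g X) := by
  have : StronglyMeasurable (fun p : ℝ × ℝ => g p.2 * (symbol p.2 p.1 * wave (X p.2) p.1)) :=
    Measurable.stronglyMeasurable (by fun_prop)
  exact this.integral_prod_right.measurable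

theorem norm_waveIntegral_le (ξ : ℝ) : ‖waveIntegral g X ξ‖ ≤ ∫ t, ‖g t‖ := by
  refine (norm_integral_le_integral_norm _).trans (le_of_eq ?_)
  refine integral_congr_ae (Eventually.of_forall fun t => ?_)
  simp only
  rw [norm_mul, norm_symbol_mul_wave, mul_one]

/-- Writing $|H|^2$ as a double time integral and integrating in frequency first leaves the
regularised kernel at $(t-s,X(t)-X(s))$. The Gaussian makes this use of Fubini legitimate. -/
theorem integral_gauss_waveIntegral_sq (hg : Measurable g) (hgi : Integrable g)
    (hX : Measurable X) {ε : ℝ} (hε : 0 < ε) :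
    ∫ ξ, gauss ε ξ * (waveIntegral g X ξ * (starRingEnd ℂ) (waveIntegral g X ξ)) =
      ∫ p : ℝ × ℝ, (g p.1 * (starRingEnd ℂ) (g p.2)) *
        ∫ ξ, gauss ε ξ * (symbol (p.1 - p.2) ξ * wave (X p.1 - X p.2) ξ) := by
  have h1 : ∀ ξ, gauss ε ξ * (waveIntegral g X ξ * (starRingEnd ℂ) (waveIntegral g X ξ)) =
      ∫ p : ℝ × ℝ, (g p.1 * (starRingEnd ℂ) (g p.2)) *
        (gauss ε ξ * (symbol (p.1 - p.2) ξ * wave (X p.1 - X p.2) ξ)) := by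
    intro ξ
    have hc : (starRingEnd ℂ) (waveIntegral g X ξ) =
        ∫ s, (starRingEnd ℂ) (g s * (symbol s ξ * wave (X s) ξ)) := integral_conj.symm
    rw [hc, waveIntegral, ← integral_prod_mul, ← integral_const_mul]
    refine integral_congr_ae (Eventually.of_forall fun p => ?_)
    simp only [map_mul, conj_symbol, conj_wave]
    rw [sub_eq_add_neg, symbol_add, sub_eq_add_neg, wave_add]
    ring
  simp_rw [h1]
  rw [integral_integral_swap]
  · refine integral_congr_ae (Eventually.of_forall fun p => ?_)
    simp only
    rw [← integral_const_mul]
  · have h2 : Integrable (fun q : ℝ × (ℝ × ℝ) =>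
        gauss ε q.1 * (g q.2.1 * (starRingEnd ℂ) (g q.2.2)))
        ((volume : Measure ℝ).prod ((volume : Measure ℝ).prod (volume : Measure ℝ))) :=
      (integrable_gauss hε).mul_prod (hgi.mul_prod ((LinearIsometryEquiv.integrable_comp_iff
        Complex.conjLIE).2 hgi))
    refine (h2.bdd_mul (c := 1) (f := fun q : ℝ × (ℝ × ℝ) =>
      symbol (q.2.1 - q.2.2) q.1 * wave (X q.2.1 - X q.2.2) q.1)
      (Measurable.aestronglyMeasurable (by fun_prop))
      (Eventually.of_forall fun q => (norm_symbol_mul_wave _ _ _).le)).congr ?_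
    refine Eventually.of_forall fun q => ?_
    simp only [Function.uncurry]
    ring

/-- The `TT*` identity for the Schrödinger group along a measurable curve. -/
theorem lintegral_waveIntegral_sq_le (hg : Measurable g) (hgi : Integrable g)
    (hX : Measurable X) :
    ∫⁻ ξ, ‖waveIntegral g X ξ‖ₑ ^ 2 ≤ ∫⁻ t, ∫⁻ s, ‖g t‖ₑ * (‖g s‖ₑ * decay (t - s)) := by
  set H := waveIntegral g X with hH
  have hHm : Measurable H := measurable_waveIntegral hg hX
  have hreg : ∀ ε : ℝ, 0 < ε → ∫⁻ ξ, ‖gauss ε ξ‖ₑ * ‖H ξ‖ₑ ^ 2 ≤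
      ∫⁻ t, ∫⁻ s, ‖g t‖ₑ * (‖g s‖ₑ * decay (t - s)) := by
    intro ε hε
    have hreal : ∀ ξ, gauss ε ξ * (H ξ * (starRingEnd ℂ) (H ξ)) =
        ((Real.exp (-ε * ξ ^ 2) * ‖H ξ‖ ^ 2 : ℝ) : ℂ) := by
      intro ξ
      rw [gauss, Complex.mul_conj, Complex.normSq_eq_norm_sq]
      push_cast
      rfl
    have hnn : ∀ ξ, 0 ≤ Real.exp (-ε * ξ ^ 2) * ‖H ξ‖ ^ 2 := fun ξ => by positivity
    have hint : Integrable fun ξ => Real.exp (-ε * ξ ^ 2) * ‖H ξ‖ ^ 2 := by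
      refine (integrable_exp_neg_mul_sq hε).mul_bdd (c := (∫ t, ‖g t‖) ^ 2)
        (hHm.norm.pow_const 2).aestronglyMeasurable (Eventually.of_forall fun ξ => ?_)
      rw [norm_pow, norm_norm]
      gcongr
      exact norm_waveIntegral_le ξ
    have e1 : ∫⁻ ξ, ‖gauss ε ξ‖ₑ * ‖H ξ‖ₑ ^ 2 =
        ‖∫ ξ, gauss ε ξ * (H ξ * (starRingEnd ℂ) (H ξ))‖ₑ := by
      simp_rw [hreal]
      rw [integral_complex_ofReal, ← ofReal_norm, Complex.norm_real,
        Real.norm_of_nonneg (integral_nonneg hnn),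
        ofReal_integral_eq_lintegral_ofReal hint (Eventually.of_forall hnn)]
      refine lintegral_congr fun ξ => ?_
      rw [ENNReal.ofReal_mul (Real.exp_nonneg _), gauss, ← ofReal_norm, Complex.norm_real,
        Real.norm_of_nonneg (Real.exp_nonneg _), ENNReal.ofReal_pow (norm_nonneg _), ofReal_norm]
    rw [e1, hH, integral_gauss_waveIntegral_sq hg hgi hX hε]
    calc _ ≤ ∫⁻ p : ℝ × ℝ, ‖(g p.1 * (starRingEnd ℂ) (g p.2)) *
          ∫ ξ, gauss ε ξ * (symbol (p.1 - p.2) ξ * wave (X p.1 - X p.2) ξ)‖ₑ :=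
          enorm_integral_le_lintegral_enorm _
      _ ≤ ∫⁻ p : ℝ × ℝ, ‖g p.1‖ₑ * (‖g p.2‖ₑ * decay (p.1 - p.2)) := by
          refine lintegral_mono fun p => ?_
          rw [enorm_mul, enorm_mul, mul_assoc]
          gcongr
          · simp [← ofReal_norm]
          · exact enorm_integral_gauss_le hε _ _
      _ = _ := by
          rw [Measure.volume_eq_prod, lintegral_prod]
          exact ((hg.comp measurable_fst).enorm.mul ((hg.comp measurable_snd).enorm.mul
            (measurable_decay.comp (measurable_fst.sub measurable_snd)))).aemeasurable
  have hlim : ∀ ξ, ‖H ξ‖ₑ ^ 2 =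
      liminf (fun n : ℕ => ‖gauss (1 / ((n : ℝ) + 1)) ξ‖ₑ * ‖H ξ‖ₑ ^ 2) atTop := by
    intro ξ
    have h1 : Tendsto (fun n : ℕ => ‖gauss (1 / ((n : ℝ) + 1)) ξ‖ₑ) atTop (𝓝 1) := by
      have hc : Continuous fun ε => ‖gauss ε ξ‖ₑ := by unfold gauss; fun_prop
      have := (hc.tendsto 0).comp tendsto_one_div_add_atTop_nhds_zero_nat
      simpa [gauss, Function.comp_def] using this
    have h2 := ENNReal.Tendsto.mul_const (b := ‖H ξ‖ₑ ^ 2) h1 (Or.inr (by finiteness))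
    rw [one_mul] at h2
    exact h2.liminf_eq.symm
  -- The bound is uniform in the cut-off, so Fatou's lemma removes it.
  calc ∫⁻ ξ, ‖H ξ‖ₑ ^ 2 = ∫⁻ ξ, liminf (fun n : ℕ =>
        ‖gauss (1 / ((n : ℝ) + 1)) ξ‖ₑ * ‖H ξ‖ₑ ^ 2) atTop := lintegral_congr hlim
    _ ≤ liminf (fun n : ℕ => ∫⁻ ξ, ‖gauss (1 / ((n : ℝ) + 1)) ξ‖ₑ * ‖H ξ‖ₑ ^ 2) atTop :=
        lintegral_liminf_le fun n =>
          (continuous_gauss _).measurable.enorm.mul (hHm.enorm.pow_const 2)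
    _ ≤ _ := by
        refine liminf_le_of_le (by isBoundedDefault) fun b hb => ?_
        obtain ⟨n, hn⟩ := hb.exists
        exact hn.trans (hreg _ (by positivity))

theorem integral_mul_evolution_eq (hg : Measurable g) (hgi : Integrable g) (hX : Measurable X)
    {p : ℝ → ℂ} (hp : Integrable p) :
    ∫ t, g t * ∫ ξ, wave (X t) ξ * (symbol t ξ * p ξ) = ∫ ξ, p ξ * waveIntegral g X ξ := by
  simp_rw [waveIntegral, ← integral_const_mul]
  rw [integral_integral_swap]
  · refine integral_congr_ae (Eventually.of_forall fun ξ => ?_)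
    refine integral_congr_ae (Eventually.of_forall fun t => ?_)
    simp only
    ring
  · refine ((hgi.mul_prod hp).bdd_mul (c := 1) (f := fun q : ℝ × ℝ =>
      symbol q.1 q.2 * wave (X q.1) q.2) (Measurable.aestronglyMeasurable (by fun_prop))
      (Eventually.of_forall fun q => (norm_symbol_mul_wave _ _ _).le)).congr ?_
    refine Eventually.of_forall fun q => ?_
    simp only [Function.uncurry]
    ring

/-- Cauchy–Schwarz in frequency separates the data from the wave superposition, whose $L^2$ norm is
controlled by $TT^*$ and the diagonal Hardy–Littlewood–Sobolev inequality. The constant is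
$\sqrt{12}\le4$. -/
theorem enorm_integral_mul_evolution_le (hg : Measurable g) (hgi : Integrable g)
    (hX : Measurable X) {p : ℝ → ℂ} (hp : Integrable p) :
    ‖∫ t, g t * ∫ ξ, wave (X t) ξ * (symbol t ξ * p ξ)‖ₑ ≤
      eLpNorm p 2 volume * (4 * (∫⁻ t, ‖g t‖ₑ ^ (4 / 3 : ℝ)) ^ (3 / 4 : ℝ)) := by
  rw [integral_mul_evolution_eq hg hgi hX hp]
  have hHm := measurable_waveIntegral hg hX
  calc _ ≤ ∫⁻ ξ, ‖p ξ * waveIntegral g X ξ‖ₑ := enorm_integral_le_lintegral_enorm _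
    _ = ∫⁻ ξ, (fun ξ => ‖p ξ‖ₑ) ξ * (fun ξ => ‖waveIntegral g X ξ‖ₑ) ξ := by
        simp_rw [enorm_mul]
    _ ≤ (∫⁻ ξ, ‖p ξ‖ₑ ^ (2 : ℝ)) ^ (1 / 2 : ℝ) *
        (∫⁻ ξ, ‖waveIntegral g X ξ‖ₑ ^ (2 : ℝ)) ^ (1 / 2 : ℝ) := by
        exact ENNReal.lintegral_mul_le_Lp_mul_Lq _ Real.HolderConjugate.two_two
          hp.aestronglyMeasurable.enorm hHm.enorm.aemeasurable
    _ ≤ _ := by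
        gcongr
        · rw [eLpNorm_eq_lintegral_rpow_enorm_toReal (by norm_num) (by norm_num)]
          simp
        · have h1 : ∫⁻ ξ, ‖waveIntegral g X ξ‖ₑ ^ (2 : ℝ) ≤
              12 * (∫⁻ t, ‖g t‖ₑ ^ (4 / 3 : ℝ)) ^ (3 / 2 : ℝ) := by
            simp_rw [ENNReal.rpow_two]
            exact (lintegral_waveIntegral_sq_le hg hgi hX).trans
              (lintegral_lintegral_self_mul_decay_le hg.enorm)
          calc _ ≤ (12 * (∫⁻ t, ‖g t‖ₑ ^ (4 / 3 : ℝ)) ^ (3 / 2 : ℝ)) ^ (1 / 2 : ℝ) := by gcongr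
            _ = 12 ^ (1 / 2 : ℝ) * (∫⁻ t, ‖g t‖ₑ ^ (4 / 3 : ℝ)) ^ (3 / 4 : ℝ) := by
                rw [ENNReal.mul_rpow_of_nonneg _ _ (by norm_num), ← ENNReal.rpow_mul]
                norm_num
            _ ≤ _ := by
                gcongr
                calc (12 : ℝ≥0∞) ^ (1 / 2 : ℝ) ≤ (4 ^ (2 : ℝ)) ^ (1 / 2 : ℝ) := by
                      gcongr; norm_num
                  _ = 4 := by rw [← ENNReal.rpow_mul]; norm_num

end WaveIntegral

/-- A measurable near-maximiser of a continuous family of bounded continuous functions. -/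
theorem exists_measurable_near_max {u : ℝ → ℝ →ᵇ ℂ} (hu : Continuous u) :
    ∃ X : ℝ → ℝ, Measurable X ∧ ∀ t, ‖u t‖ ≤ 2 * ‖u t (X t)‖ := by
  classical
  set q : ℕ → ℝ := TopologicalSpace.denseSeq ℝ with hq
  have hex : ∀ t, ∃ k, ‖u t‖ ≤ 2 * ‖u t (q k)‖ := by
    intro t
    by_contra! h
    rcases eq_or_ne (u t) 0 with h0 | h0
    · have := h 0; simp [h0] at this
    have hpos : 0 < ‖u t‖ := norm_pos_iff.2 h0
    have hall : ∀ x, ‖u t x‖ ≤ ‖u t‖ / 2 := by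
      have hcl : IsClosed {x | ‖u t x‖ ≤ ‖u t‖ / 2} :=
        isClosed_le (u t).continuous.norm continuous_const
      have hd : closure (range q) ⊆ {x | ‖u t x‖ ≤ ‖u t‖ / 2} := by
        refine closure_minimal ?_ hcl
        rintro _ ⟨k, rfl⟩
        have := h k
        simp only [mem_ofPred_eq]; linarith
      intro x
      exact hd ((TopologicalSpace.denseRange_denseSeq ℝ) x)
    have := (BoundedContinuousFunction.norm_le (by positivity)).2 hall
    linarith
  -- Choosing the first admissible point of a dense sequence keeps the curve measurable, since each
  -- admissibility condition is closed in $t$.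
  refine ⟨fun t => q (Nat.find (hex t)), ?_, fun t => Nat.find_spec (hex t)⟩
  refine (measurable_from_nat (f := q)).comp (measurable_find hex fun k => ?_)
  refine (isClosed_le hu.norm ?_).measurableSet
  have : Continuous fun t => u t (q k) :=
    (continuous_eval_const (F := ℝ →ᵇ ℂ) (q k)).comp hu
  fun_prop

theorem measurable_eval_curve {u : ℝ → ℝ →ᵇ ℂ} (hu : Continuous u) {X : ℝ → ℝ}
    (hX : Measurable X) : Measurable fun t => u t (X t) := by
  have h : Continuous fun p : ℝ × ℝ => u p.1 p.2 := by
    rw [continuous_iff_continuousAt]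
    intro p
    exact (hu.comp continuous_fst).continuousAt.eval continuous_snd.continuousAt
  exact h.measurable.comp (measurable_id.prodMk hX)

/-- The evaluation $u(t,X(t))$ at a near-maximising curve linearises the sup norm. Testing it
against $\|u\|^2\overline{u(t,X(t))}$ gives $A\le16\|f\|A^{3/4}$. The bounded time window and the
continuity of $u$ make $A$ finite, so that one may divide. -/
theorem lintegral_contRep_propagator_le {f : L2} (hf : Integrable (𝓕 f : L2)) (n : ℕ) :
    ∫⁻ t in Icc (-(n : ℝ)) n, ‖contRep (propagator t f)‖ₑ ^ (4 : ℝ) ≤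
      (16 * ‖f‖ₑ) ^ (4 : ℝ) := by
  set u : ℝ → ℝ →ᵇ ℂ := fun t => contRep (propagator t f) with hu
  have huc : Continuous u := continuous_contRep_propagator hf
  obtain ⟨X, hX, hmax⟩ := exists_measurable_near_max huc
  have hux : Measurable fun t => u t (X t) := measurable_eval_curve huc hX
  have heval : ∀ t, u t (X t) = ∫ ξ, wave (X t) ξ * (symbol t ξ * (𝓕 f : L2) ξ) := fun t => by
    rw [hu]
    simp only
    rw [contRep_propagator hf, invFourier_apply (integrable_symbol_mul hf t)]
  set I : Set ℝ := Icc (-(n : ℝ)) n with hI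
  set g : ℝ → ℂ := I.indicator fun t => ((‖u t‖ ^ 2 : ℝ) : ℂ) * (starRingEnd ℂ) (u t (X t))
    with hgdef
  have hgm : Measurable g := by
    refine Measurable.indicator ?_ measurableSet_Icc
    exact (Complex.measurable_ofReal.comp (huc.norm.pow 2).measurable).mul
      (Complex.continuous_conj.measurable.comp hux)
  have hgn : ∀ t, ‖g t‖ ≤ I.indicator (fun t => ‖u t‖ ^ 3) t := by
    intro t
    by_cases ht : t ∈ I
    · rw [hgdef, indicator_of_mem ht, indicator_of_mem ht, norm_mul, Complex.norm_real,
        RCLike.norm_conj, Real.norm_of_nonneg (by positivity)]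
      calc ‖u t‖ ^ 2 * ‖u t (X t)‖ ≤ ‖u t‖ ^ 2 * ‖u t‖ := by
            gcongr; exact (u t).norm_coe_le_norm _
        _ = _ := by ring
    · rw [hgdef, indicator_of_notMem ht, indicator_of_notMem ht, norm_zero]
  have hgi : Integrable g := by
    have h1 : IntegrableOn (fun t => ‖u t‖ ^ 3) I :=
      (huc.norm.pow 3).continuousOn.integrableOn_compact isCompact_Icc
    exact (h1.integrable_indicator measurableSet_Icc).mono' hgm.aestronglyMeasurable
      (Eventually.of_forall hgn)
  have hmain := enorm_integral_mul_evolution_le hgm hgi hX hf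
  simp_rw [← heval] at hmain
  set A := ∫⁻ t in I, ‖u t‖ₑ ^ (4 : ℝ) with hA
  have hAtop : A ≠ ∞ := by
    have h1 : IntegrableOn (fun t => ‖u t‖ ^ (4 : ℝ)) I :=
      (huc.norm.rpow_const fun _ => Or.inr (by norm_num)).continuousOn.integrableOn_compact
        isCompact_Icc
    have h2 := h1.2.ne
    convert h2 using 2
    funext t
    rw [← ofReal_norm, ← ofReal_norm, ENNReal.ofReal_rpow_of_nonneg (norm_nonneg _) (by norm_num),
      Real.norm_of_nonneg (by positivity)]
  -- The factor $4$ is the square of the loss $2$ in the near-maximiser.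
  have hlow : A ≤ 4 * ‖∫ t, g t * u t (X t)‖ₑ := by
    have e : ∀ t, g t * u t (X t) =
        ((I.indicator (fun t => ‖u t‖ ^ 2 * ‖u t (X t)‖ ^ 2) t : ℝ) : ℂ) := by
      intro t
      by_cases ht : t ∈ I
      · rw [hgdef, indicator_of_mem ht, indicator_of_mem ht, mul_assoc, Complex.conj_mul']
        push_cast; rfl
      · rw [hgdef, indicator_of_notMem ht, indicator_of_notMem ht]; simp
    have hi : Integrable (I.indicator fun t => ‖u t‖ ^ 2 * ‖u t (X t)‖ ^ 2) := by
      have h1 : IntegrableOn (fun t => ‖u t‖ ^ 2 * ‖u t‖ ^ 2) I :=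
        ((huc.norm.pow 2).mul (huc.norm.pow 2)).continuousOn.integrableOn_compact isCompact_Icc
      refine (integrable_indicator_iff measurableSet_Icc).2
        (Integrable.mono' h1 ?_ (Eventually.of_forall fun t => ?_))
      · exact ((huc.norm.pow 2).measurable.mul (hux.norm.pow_const 2)).aestronglyMeasurable
      · rw [Real.norm_of_nonneg (by positivity)]
        gcongr
        exact (u t).norm_coe_le_norm _
    have hnn : ∀ t, 0 ≤ I.indicator (fun t => ‖u t‖ ^ 2 * ‖u t (X t)‖ ^ 2) t := fun t =>
      indicator_nonneg (fun _ _ => by positivity) t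
    simp_rw [e]
    rw [integral_complex_ofReal, ← ofReal_norm, Complex.norm_real,
      Real.norm_of_nonneg (integral_nonneg hnn),
      ofReal_integral_eq_lintegral_ofReal hi (Eventually.of_forall hnn),
      ← lintegral_const_mul' _ _ (by norm_num), hA, ← lintegral_indicator measurableSet_Icc]
    refine lintegral_mono fun t => ?_
    by_cases ht : t ∈ I
    · rw [indicator_of_mem ht, indicator_of_mem ht, ← ofReal_norm,
        ENNReal.ofReal_rpow_of_nonneg (norm_nonneg _) (by norm_num),
        show (4 : ℝ≥0∞) = ENNReal.ofReal 4 by simp, ← ENNReal.ofReal_mul (by norm_num)]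
      apply ENNReal.ofReal_le_ofReal
      have h1 := hmax t
      have h2 : ‖u t‖ ^ 2 ≤ 4 * ‖u t (X t)‖ ^ 2 := by
        calc ‖u t‖ ^ 2 ≤ (2 * ‖u t (X t)‖) ^ 2 := by gcongr
          _ = _ := by ring
      calc ‖u t‖ ^ (4 : ℝ) = ‖u t‖ ^ 2 * ‖u t‖ ^ 2 := by
            rw [show (4 : ℝ) = ((4 : ℕ) : ℝ) by norm_num, Real.rpow_natCast]; ring
        _ ≤ ‖u t‖ ^ 2 * (4 * ‖u t (X t)‖ ^ 2) := by gcongr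
        _ = _ := by ring
    · rw [indicator_of_notMem ht]; exact zero_le
  have hG : ∫⁻ t, ‖g t‖ₑ ^ (4 / 3 : ℝ) ≤ A := by
    rw [hA, ← lintegral_indicator measurableSet_Icc]
    refine lintegral_mono fun t => ?_
    have h1 := hgn t
    by_cases ht : t ∈ I
    · rw [indicator_of_mem ht] at h1 ⊢
      rw [← ofReal_norm, ← ofReal_norm]
      calc ENNReal.ofReal ‖g t‖ ^ (4 / 3 : ℝ) ≤ ENNReal.ofReal (‖u t‖ ^ 3) ^ (4 / 3 : ℝ) := by
            gcongr
        _ = _ := by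
            rw [ENNReal.ofReal_pow (norm_nonneg _), ← ENNReal.rpow_natCast, ← ENNReal.rpow_mul]
            norm_num
    · rw [indicator_of_notMem ht] at h1 ⊢
      rw [norm_le_zero_iff.1 h1]
      simp
  have hp2 : eLpNorm (𝓕 f : L2) 2 volume = ‖f‖ₑ := by
    rw [← Lp.enorm_def, ← ofReal_norm, Lp.norm_fourier_eq, ofReal_norm]
  rw [hp2] at hmain
  have hfin : A ≤ 16 * ‖f‖ₑ * A ^ (3 / 4 : ℝ) := by
    calc A ≤ 4 * (‖f‖ₑ * (4 * (∫⁻ t, ‖g t‖ₑ ^ (4 / 3 : ℝ)) ^ (3 / 4 : ℝ))) :=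
          hlow.trans (by gcongr)
      _ ≤ 4 * (‖f‖ₑ * (4 * A ^ (3 / 4 : ℝ))) := by gcongr
      _ = _ := by ring
  rcases eq_or_ne A 0 with h0 | h0
  · rw [h0]; exact zero_le
  have hAr : A ^ (3 / 4 : ℝ) ≠ 0 := by simp [h0, hAtop]
  have hAr' : A ^ (3 / 4 : ℝ) ≠ ∞ := ENNReal.rpow_ne_top_of_nonneg (by norm_num) hAtop
  have h4 : A ^ (1 / 4 : ℝ) ≤ 16 * ‖f‖ₑ := by
    have hsplit : A = A ^ (1 / 4 : ℝ) * A ^ (3 / 4 : ℝ) := by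
      rw [← ENNReal.rpow_add _ _ h0 hAtop]; norm_num
    rw [hsplit, ← hsplit] at hfin
    nth_rewrite 1 [hsplit] at hfin
    exact (ENNReal.mul_le_mul_iff_left hAr hAr').1 hfin
  calc A = (A ^ (1 / 4 : ℝ)) ^ (4 : ℝ) := by rw [← ENNReal.rpow_mul]; norm_num
    _ ≤ _ := by gcongr

theorem eLpNorm_contRep_propagator_le_of_integrable {f : L2} (hf : Integrable (𝓕 f : L2)) :
    eLpNorm (fun t => contRep (propagator t f)) 4 volume ≤ 16 * ‖f‖ₑ := by
  have h : ∫⁻ t, ‖contRep (propagator t f)‖ₑ ^ (4 : ℝ) ≤ (16 * ‖f‖ₑ) ^ (4 : ℝ) := by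
    have hU : (⋃ n : ℕ, Icc (-(n : ℝ)) n) = univ := by
      refine eq_univ_of_forall fun x => ?_
      obtain ⟨N, hN⟩ := exists_nat_ge |x|
      exact mem_iUnion.2 ⟨N, abs_le.1 hN⟩
    rw [← setLIntegral_univ, ← hU, setLIntegral_iUnion_of_directed]
    · exact iSup_le (lintegral_contRep_propagator_le hf)
    · refine Monotone.directed_le fun m n hmn => ?_
      have : (m : ℝ) ≤ n := by exact_mod_cast hmn
      exact Icc_subset_Icc (neg_le_neg this) this
  rw [eLpNorm_eq_lintegral_rpow_enorm_toReal (by norm_num) (by norm_num)]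
  calc _ ≤ ((16 * ‖f‖ₑ) ^ (4 : ℝ)) ^ (1 / (4 : ℝ≥0∞).toReal) := by
        gcongr
        simpa using h
    _ = _ := by rw [← ENNReal.rpow_mul]; norm_num

/-! ### Limits of continuous representatives -/

theorem contRep_ae_eq_of {f : L2} {g : ℝ →ᵇ ℂ} (h : f =ᵐ[volume] g) : f =ᵐ[volume] contRep f := by
  rwa [contRep_eq h]

theorem sub_ae_eq_contRep_sub {f g : L2} (hf : f =ᵐ[volume] contRep f)
    (hg : g =ᵐ[volume] contRep g) : ((f - g : L2) : ℝ → ℂ) =ᵐ[volume] (contRep f - contRep g) := by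
  filter_upwards [Lp.coeFn_sub f g, hf, hg] with x h1 h2 h3
  rw [h1, Pi.sub_apply, h2, h3]
  rfl

theorem contRep_sub {f g : L2} (hf : f =ᵐ[volume] contRep f) (hg : g =ᵐ[volume] contRep g) :
    contRep (f - g) = contRep f - contRep g :=
  contRep_eq (sub_ae_eq_contRep_sub hf hg)

theorem add_ae_eq_contRep_add {f g : L2} (hf : f =ᵐ[volume] contRep f)
    (hg : g =ᵐ[volume] contRep g) : ((f + g : L2) : ℝ → ℂ) =ᵐ[volume] (contRep f + contRep g) := by
  filter_upwards [Lp.coeFn_add f g, hf, hg] with x h1 h2 h3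
  rw [h1, Pi.add_apply, h2, h3]
  rfl

theorem contRep_add {f g : L2} (hf : f =ᵐ[volume] contRep f) (hg : g =ᵐ[volume] contRep g) :
    contRep (f + g) = contRep f + contRep g :=
  contRep_eq (add_ae_eq_contRep_add hf hg)

theorem smul_ae_eq_contRep_smul (c : ℂ) {f : L2} (hf : f =ᵐ[volume] contRep f) :
    ((c • f : L2) : ℝ → ℂ) =ᵐ[volume] (c • contRep f) := by
  filter_upwards [Lp.coeFn_smul c f, hf] with x h1 h2
  rw [h1, Pi.smul_apply, h2]
  rfl

theorem contRep_smul (c : ℂ) {f : L2} (hf : f =ᵐ[volume] contRep f) :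
    contRep (c • f) = c • contRep f :=
  contRep_eq (smul_ae_eq_contRep_smul c hf)

/-- Along a subsequence the $L^2$ limit is also an almost-everywhere limit, and it must coincide
with the uniform one. -/
theorem ae_eq_of_tendsto_of_tendsto {w : ℕ → L2} {v : L2} {g : ℕ → ℝ →ᵇ ℂ} {l : ℝ →ᵇ ℂ}
    (hw : Tendsto w atTop (𝓝 v)) (hg : Tendsto g atTop (𝓝 l)) (h : ∀ n, w n =ᵐ[volume] g n) :
    v =ᵐ[volume] l := by
  have h1 : TendstoInMeasure volume (fun n => (w n : ℝ → ℂ)) atTop v := by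
    refine tendstoInMeasure_of_tendsto_eLpNorm (p := 2) (by norm_num)
      (fun n => Lp.aestronglyMeasurable _) (Lp.aestronglyMeasurable _) ?_
    exact (Lp.tendsto_Lp_iff_tendsto_eLpNorm' _ _).1 hw
  obtain ⟨ns, hns, hae⟩ := h1.exists_seq_tendsto_ae
  filter_upwards [hae, ae_all_iff.2 h] with x hx hx2
  refine tendsto_nhds_unique hx ?_
  have h3 : Tendsto (fun n => g (ns n) x) atTop (𝓝 (l x)) :=
    ((continuous_eval_const (F := ℝ →ᵇ ℂ) x).tendsto l).comp (hg.comp hns.tendsto_atTop)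
  exact h3.congr fun n => (hx2 (ns n)).symm

theorem isClosed_vanishing : IsClosed {f : ℝ →ᵇ ℂ | Tendsto f (cocompact ℝ) (𝓝 0)} := by
  refine isClosed_of_closure_subset fun f hf => ?_
  rw [mem_ofPred_eq, Metric.tendsto_nhds]
  intro ε hε
  obtain ⟨g, hg, hfg⟩ := Metric.mem_closure_iff.1 hf (ε / 2) (by positivity)
  filter_upwards [Metric.tendsto_nhds.1 hg (ε / 2) (by positivity)] with x hx
  calc dist (f x) 0 ≤ dist (f x) (g x) + dist (g x) 0 := dist_triangle _ _ _
    _ < ε / 2 + ε / 2 := add_lt_add_of_le_of_lt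
        ((BoundedContinuousFunction.dist_coe_le_dist x).trans hfg.le) hx
    _ = ε := add_halves ε

/-- `contRep` is not continuous on $L^2$, so $L^2$ convergence alone does not suffice. Summable
Cauchy bounds make the representatives converge uniformly in $x$ for almost every time, and the
$L^2$ limit identifies what they converge to. The norm bound is Fatou's lemma. -/
theorem memL4C0_of_tendsto {J : Set ℝ} {u : ℕ → ℝ → L2} {v : ℝ → L2}
    (hu : ∀ n, MemL4C0 J (u n)) (hv : ∀ t, Tendsto (fun n => u n t) atTop (𝓝 (v t)))
    {B : ℕ → ℝ≥0∞} (hB : ∑' n, B n ≠ ∞)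
    (hC : ∀ N n m, N ≤ n → N ≤ m → normL4C J (fun t => u n t - u m t) < B N)
    {K : ℕ → ℝ≥0∞} {K' : ℝ≥0∞} (hK : ∀ n, normL4C J (u n) ≤ K n)
    (hKK' : Tendsto K atTop (𝓝 K')) (hK' : K' ≠ ∞) :
    MemL4C0 J v ∧ normL4C J v ≤ K' := by
  have hmeas : ∀ n, AEStronglyMeasurable (fun t => contRep (u n t)) (volume.restrict J) :=
    fun n => (hu n).memLp.1
  have hrep : ∀ᵐ t ∂(volume.restrict J), ∀ n, u n t =ᵐ[volume] contRep (u n t) :=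
    ae_all_iff.2 fun n => (hu n).ae_eq
  have hvan : ∀ᵐ t ∂(volume.restrict J), ∀ n, Tendsto (contRep (u n t)) (cocompact ℝ) (𝓝 0) :=
    ae_all_iff.2 fun n => (hu n).vanishing
  have hlim : ∀ᵐ t ∂(volume.restrict J), ∃ l, Tendsto (fun n => contRep (u n t)) atTop (𝓝 l) := by
    refine Lp.ae_tendsto_of_cauchy_eLpNorm hmeas (p := 4) (by norm_num) hB fun N n m hn hm => ?_
    refine lt_of_le_of_lt (le_of_eq ?_) (hC N n m hn hm)
    refine eLpNorm_congr_ae ?_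
    filter_upwards [hrep] with t ht
    rw [Pi.sub_apply, contRep_sub (ht n) (ht m)]
  have hid : ∀ᵐ t ∂(volume.restrict J), v t =ᵐ[volume] contRep (v t) ∧
      Tendsto (fun n => contRep (u n t)) atTop (𝓝 (contRep (v t))) := by
    filter_upwards [hrep, hlim] with t h1 ⟨l, hl⟩
    have h2 := ae_eq_of_tendsto_of_tendsto (hv t) hl h1
    exact ⟨contRep_ae_eq_of h2, by rwa [contRep_eq h2]⟩
  have hnorm : normL4C J v ≤ K' := by
    refine (Lp.eLpNorm_lim_le_liminf_eLpNorm hmeas _ (hid.mono fun t ht => ht.2)).trans ?_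
    calc _ ≤ liminf K atTop := liminf_le_liminf (Eventually.of_forall hK)
      _ = K' := hKK'.liminf_eq
  refine ⟨⟨⟨hid.mono fun t ht => ht.1, ?_, hnorm.trans_lt hK'.lt_top⟩, ?_⟩, hnorm⟩
  · exact aestronglyMeasurable_of_tendsto_ae _ hmeas (hid.mono fun t ht => ht.2)
  · filter_upwards [hid, hvan] with t h1 h2
    exact isClosed_vanishing.mem_of_tendsto h1.2 (Eventually.of_forall h2)

theorem memL4C0_propagator_of_integrable {f : L2} (hf : Integrable (𝓕 f : L2)) :
    MemL4C0 univ fun t => propagator t f where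
  ae_eq := Eventually.of_forall fun t => contRep_ae_eq_of (propagator_ae_eq_invFourier hf t)
  memLp := by
    rw [Measure.restrict_univ]
    exact ⟨(continuous_contRep_propagator hf).aestronglyMeasurable,
      (eLpNorm_contRep_propagator_le_of_integrable hf).trans_lt (by finiteness)⟩
  vanishing := Eventually.of_forall fun t => by
    rw [contRep_propagator hf]
    exact tendsto_invFourier_cocompact _


theorem tsum_geometric_const_ne_top (c : ℝ≥0∞) (hc : c ≠ ∞) :
    ∑' n : ℕ, c * (2⁻¹ : ℝ≥0∞) ^ n ≠ ∞ := by
  rw [ENNReal.tsum_mul_left, ENNReal.tsum_geometric]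
  refine ENNReal.mul_ne_top hc ?_
  simp

/-- The homogeneous Strichartz estimate. -/
theorem strichartz (f : L2) : MemL4C0 univ (fun t => propagator t f) ∧
    normL4C univ (fun t => propagator t f) ≤ 16 * ‖f‖ₑ := by
  have hex : ∀ n : ℕ, ∃ φ : 𝓢(ℝ, ℂ), dist f (φ.toLp 2 : L2) < (2⁻¹ : ℝ) ^ n := fun n =>
    denseRange_schwartz.exists_dist_lt f (by positivity)
  choose φ hφ using hex
  set w : ℕ → L2 := fun n => (φ n).toLp 2 with hw
  have hwi : ∀ n, Integrable (𝓕 (w n) : L2) := fun n => integrable_fourier_schwartz (φ n)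
  have hwe : ∀ n, ‖w n - f‖ₑ ≤ (2⁻¹ : ℝ≥0∞) ^ n := by
    intro n
    have h := (hφ n).le
    rw [dist_comm, dist_eq_norm] at h
    rw [← ofReal_norm]
    refine (ENNReal.ofReal_le_ofReal h).trans (le_of_eq ?_)
    rw [ENNReal.ofReal_pow (by norm_num), ENNReal.ofReal_inv_of_pos (by norm_num)]
    simp
  have hwt : Tendsto w atTop (𝓝 f) := by
    rw [tendsto_iff_edist_tendsto_0]
    refine tendsto_of_tendsto_of_tendsto_of_le_of_le tendsto_const_nhds
      (ENNReal.tendsto_pow_atTop_nhds_zero_of_lt_one (r := 2⁻¹) (by simp)) (fun _ => zero_le) ?_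
    intro n
    simp only
    rw [edist_eq_enorm_sub]
    exact hwe n
  refine memL4C0_of_tendsto (u := fun n t => propagator t (w n))
    (fun n => memL4C0_propagator_of_integrable (hwi n))
    (fun t => ((propagator t).continuous.tendsto f).comp hwt)
    -- The differences are bounded by $16\cdot2\cdot2^{-N}$; $33$ instead of $32$ makes the
    -- inequality strict.
    (B := fun n => 33 * (2⁻¹ : ℝ≥0∞) ^ n) (tsum_geometric_const_ne_top 33 (by simp)) ?_
    (K := fun n => 16 * ‖w n‖ₑ) ?_ ?_ (by finiteness)
  · intro N n m hn hm
    simp_rw [← map_sub]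
    have hi : Integrable (𝓕 (w n - w m) : L2) := by
      have : (𝓕 (w n - w m) : L2) = 𝓕 (w n) - 𝓕 (w m) :=
        (Lp.fourierTransformₗᵢ ℝ ℂ).map_sub (w n) (w m)
      rw [this]
      exact (integrable_congr (Lp.coeFn_sub _ _)).2 ((hwi n).sub (hwi m))
    have hpow : ∀ k, N ≤ k → (2⁻¹ : ℝ≥0∞) ^ k ≤ 2⁻¹ ^ N := fun k hk =>
      pow_le_pow_right_of_le_one' (by simp) hk
    have h1 : ‖w n - w m‖ₑ ≤ 2 * (2⁻¹ : ℝ≥0∞) ^ N := by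
      have h3 : w n - w m = (w n - f) - (w m - f) := by abel
      rw [h3]
      refine enorm_sub_le.trans ?_
      rw [two_mul]
      exact add_le_add ((hwe n).trans (hpow n hn)) ((hwe m).trans (hpow m hm))
    have h2 := eLpNorm_contRep_propagator_le_of_integrable hi
    rw [normL4C, Measure.restrict_univ]
    calc _ ≤ 16 * ‖w n - w m‖ₑ := h2
      _ ≤ 16 * (2 * (2⁻¹ : ℝ≥0∞) ^ N) := by gcongr
      _ = 32 * (2⁻¹ : ℝ≥0∞) ^ N := by rw [← mul_assoc]; norm_num
      _ < _ := by
          refine ENNReal.mul_lt_mul_left ?_ ?_ (by norm_num)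
          · simp
          · exact ENNReal.pow_ne_top (by simp)
  · intro n
    rw [normL4C, Measure.restrict_univ]
    exact eLpNorm_contRep_propagator_le_of_integrable (hwi n)
  · exact ENNReal.Tendsto.const_mul hwt.enorm (Or.inr (by simp))

/-! ### The dual Strichartz operator -/

section Dual

variable {lam : Measure ℝ}

theorem integrable_conj_L1_mul_bcf (g : Lp ℂ 1 lam) (φ : ℝ →ᵇ ℂ) :
    Integrable (fun y => (starRingEnd ℂ) (g y) * φ y) lam :=
  ((LinearIsometryEquiv.integrable_comp_iff Complex.conjLIE).2 (L1.integrable_coeFn g)).mul_bdd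
    (c := ‖φ‖) φ.continuous.aestronglyMeasurable
    (Eventually.of_forall fun y => φ.norm_coe_le_norm y)

/-- The sesquilinear pairing `∫ conj g · φ dλ` of densities and bounded continuous functions. -/
def pairing (lam : Measure ℝ) :
    Lp ℂ 1 lam →L⋆[ℂ] (ℝ →ᵇ ℂ) →L[ℂ] ℂ :=
  LinearMap.mkContinuous₂
    (LinearMap.mk₂'ₛₗ (starRingEnd ℂ) (RingHom.id ℂ)
      (fun (g : Lp ℂ 1 lam) (φ : ℝ →ᵇ ℂ) => ∫ y, (starRingEnd ℂ) (g y) * φ y ∂lam)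
      (fun g g' φ => by
        rw [← integral_add (integrable_conj_L1_mul_bcf g φ) (integrable_conj_L1_mul_bcf g' φ)]
        refine integral_congr_ae ?_
        filter_upwards [Lp.coeFn_add g g'] with y h
        rw [h, Pi.add_apply, map_add, add_mul])
      (fun c g φ => by
        rw [smul_eq_mul, ← integral_const_mul]
        refine integral_congr_ae ?_
        filter_upwards [Lp.coeFn_smul c g] with y h
        rw [h, Pi.smul_apply, smul_eq_mul, map_mul, mul_assoc])
      (fun g φ φ' => by
        rw [← integral_add (integrable_conj_L1_mul_bcf g φ) (integrable_conj_L1_mul_bcf g φ')]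
        refine integral_congr_ae (Eventually.of_forall fun y => ?_)
        simp [mul_add])
      (fun c g φ => by
        rw [RingHom.id_apply, smul_eq_mul, ← integral_const_mul]
        refine integral_congr_ae (Eventually.of_forall fun y => ?_)
        simp [mul_left_comm]))
    1 fun g φ => by
      rw [one_mul, LinearMap.mk₂'ₛₗ_apply, L1.norm_eq_integral_norm, ← integral_mul_const]
      refine norm_integral_le_of_norm_le ((L1.integrable_coeFn g).norm.mul_const _)
        (Eventually.of_forall fun y => ?_)
      rw [norm_mul, RCLike.norm_conj]
      gcongr
      exact φ.norm_coe_le_norm y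

theorem pairing_apply (g : Lp ℂ 1 lam) (φ : ℝ →ᵇ ℂ) :
    pairing lam g φ = ∫ y, (starRingEnd ℂ) (g y) * φ y ∂lam := rfl

theorem norm_pairing_le (g : Lp ℂ 1 lam) (φ : ℝ →ᵇ ℂ) : ‖pairing lam g φ‖ ≤ ‖g‖ * ‖φ‖ := by
  have h := (pairing lam).le_opNorm₂ g φ
  have h1 : ‖pairing lam‖ ≤ 1 := LinearMap.mkContinuous₂_norm_le _ zero_le_one _
  calc _ ≤ ‖pairing lam‖ * ‖g‖ * ‖φ‖ := h
    _ ≤ 1 * ‖g‖ * ‖φ‖ := by gcongr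
    _ = _ := by rw [one_mul]

theorem continuous_pairing :
    Continuous fun p : Lp ℂ 1 lam × (ℝ →ᵇ ℂ) => pairing lam p.1 p.2 :=
  ((pairing lam).continuous.comp continuous_fst).clm_apply continuous_snd

theorem holderTriple_four : ENNReal.HolderTriple (4 / 3) 4 1 := by
  refine ⟨?_⟩
  rw [ENNReal.inv_div (by norm_num) (by norm_num), inv_one, ← one_div 4,
    ENNReal.div_add_div_same]
  norm_num
  exact ENNReal.div_self (by norm_num) (by norm_num)

theorem aestronglyMeasurable_pairing {J : Measure ℝ} {F : ℝ → Lp ℂ 1 lam} {u : ℝ → ℝ →ᵇ ℂ}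
    (hF : AEStronglyMeasurable F J) (hu : AEStronglyMeasurable u J) :
    AEStronglyMeasurable (fun r => pairing lam (F r) (u r)) J :=
  Continuous.comp_aestronglyMeasurable (f := fun r => (F r, u r))
    (g := fun p : Lp ℂ 1 lam × (ℝ →ᵇ ℂ) => pairing lam p.1 p.2) continuous_pairing (hF.prodMk hu)

theorem lintegral_enorm_pairing_le {J : Measure ℝ} {F : ℝ → Lp ℂ 1 lam} {u : ℝ → ℝ →ᵇ ℂ}
    (hF : AEStronglyMeasurable F J) (hu : AEStronglyMeasurable u J) :
    ∫⁻ r, ‖pairing lam (F r) (u r)‖ₑ ∂J ≤ eLpNorm F (4 / 3) J * eLpNorm u 4 J := by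
  have := holderTriple_four
  rw [← eLpNorm_one_eq_lintegral_enorm]
  have h := eLpNorm_le_eLpNorm_mul_eLpNorm_of_nnnorm (p := 4 / 3) (q := 4) (r := 1) hF hu
    (fun g φ => pairing lam g φ) 1 (Eventually.of_forall fun r => by
      rw [one_mul]; exact norm_pairing_le _ _)
  simpa using h

theorem integrable_pairing {J : Measure ℝ} {F : ℝ → Lp ℂ 1 lam} {u : ℝ → ℝ →ᵇ ℂ}
    (hF : MemLp F (4 / 3) J) (hu : MemLp u 4 J) :
    Integrable (fun r => pairing lam (F r) (u r)) J :=
  ⟨aestronglyMeasurable_pairing hF.1 hu.1,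
    (lintegral_enorm_pairing_le hF.1 hu.1).trans_lt (ENNReal.mul_lt_top hF.2 hu.2)⟩

theorem memLp_contRep_propagator (f : L2) :
    MemLp (fun t => contRep (propagator t f)) 4 volume := by
  have := (strichartz f).1.memLp
  rwa [Measure.restrict_univ] at this

theorem eLpNorm_contRep_propagator_le (f : L2) :
    eLpNorm (fun t => contRep (propagator t f)) 4 volume ≤ 16 * ‖f‖ₑ := by
  have := (strichartz f).2
  rwa [normL4C, Measure.restrict_univ] at this

theorem ae_contRep_propagator (f : L2) :
    ∀ᵐ t, propagator t f =ᵐ[volume] contRep (propagator t f) := by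
  have := (strichartz f).1.ae_eq
  rwa [Measure.restrict_univ] at this

theorem norm_integral_pairing_le {F : ℝ → Lp ℂ 1 lam} (hF : MemLp F (4 / 3) volume) (f : L2) :
    ‖∫ r, pairing lam (F r) (contRep (propagator r f))‖ ≤
      16 * (eLpNorm F (4 / 3) volume).toReal * ‖f‖ := by
  have h1 := (enorm_integral_le_lintegral_enorm _).trans
    (lintegral_enorm_pairing_le hF.1 (memLp_contRep_propagator f).1)
  have h2 : ‖∫ r, pairing lam (F r) (contRep (propagator r f))‖ₑ ≤
      16 * eLpNorm F (4 / 3) volume * ‖f‖ₑ := by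
    calc _ ≤ eLpNorm F (4 / 3) volume * (16 * ‖f‖ₑ) :=
          h1.trans (by gcongr; exact eLpNorm_contRep_propagator_le f)
      _ = _ := by ring
  have h3 := ENNReal.toReal_mono
    (ENNReal.mul_ne_top (ENNReal.mul_ne_top (by simp) hF.2.ne) (by simp)) h2
  simpa [ENNReal.toReal_mul] using h3

/-- The functional `f ↦ ∫ ⟨F(r), e^{ir∂ₓ²} f⟩ dr` on `L²`. -/
def dualFunctional (F : ℝ → Lp ℂ 1 lam) (hF : MemLp F (4 / 3) volume) : StrongDual ℂ L2 :=
  LinearMap.mkContinuous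
    { toFun := fun f => ∫ r, pairing lam (F r) (contRep (propagator r f))
      map_add' := fun f g => by
        rw [← integral_add (integrable_pairing hF (memLp_contRep_propagator f))
          (integrable_pairing hF (memLp_contRep_propagator g))]
        refine integral_congr_ae ?_
        filter_upwards [ae_contRep_propagator f, ae_contRep_propagator g] with r h1 h2
        rw [map_add, contRep_add h1 h2, map_add]
      map_smul' := fun c f => by
        rw [RingHom.id_apply, smul_eq_mul, ← integral_const_mul]
        refine integral_congr_ae ?_
        filter_upwards [ae_contRep_propagator f] with r h1
        rw [map_smul, contRep_smul c h1, map_smul, smul_eq_mul] }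
    (16 * (eLpNorm F (4 / 3) volume).toReal) (norm_integral_pairing_le hF)

/-- The dual Strichartz operator `F ↦ ∫ e^{-ir∂ₓ²} F(r) dλ dr`. -/
def dualStrichartz (F : ℝ → Lp ℂ 1 lam) : L2 :=
  open Classical in
  if hF : MemLp F (4 / 3) volume then (InnerProductSpace.toDual ℂ L2).symm (dualFunctional F hF)
  else 0

theorem inner_dualStrichartz {F : ℝ → Lp ℂ 1 lam} (hF : MemLp F (4 / 3) volume) (f : L2) :
    inner ℂ (dualStrichartz F) f = ∫ r, pairing lam (F r) (contRep (propagator r f)) := by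
  rw [dualStrichartz, dif_pos hF, InnerProductSpace.toDual_symm_apply]
  rfl

/-- No integrability is assumed: for a forcing outside $L^{4/3}$ the value is $0$ by convention. -/
theorem norm_dualStrichartz_le (F : ℝ → Lp ℂ 1 lam) :
    ‖dualStrichartz F‖ₑ ≤ 16 * eLpNorm F (4 / 3) volume := by
  by_cases hF : MemLp F (4 / 3) volume
  · have h : ‖dualStrichartz F‖ ≤ 16 * (eLpNorm F (4 / 3) volume).toReal := by
      rw [dualStrichartz, dif_pos hF, LinearIsometryEquiv.norm_map]
      exact LinearMap.mkContinuous_norm_le _ (by positivity) _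
    rw [← ofReal_norm]
    refine (ENNReal.ofReal_le_ofReal h).trans (le_of_eq ?_)
    rw [ENNReal.ofReal_mul (by norm_num), ENNReal.ofReal_toReal hF.2.ne]
    simp
  · rw [dualStrichartz, dif_neg hF]
    simp

theorem dualStrichartz_sub {F G : ℝ → Lp ℂ 1 lam} (hF : MemLp F (4 / 3) volume)
    (hG : MemLp G (4 / 3) volume) :
    dualStrichartz (fun r => F r - G r) = dualStrichartz F - dualStrichartz G := by
  refine ext_inner_right ℂ fun f => ?_
  rw [inner_sub_left, inner_dualStrichartz hF, inner_dualStrichartz hG,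
    inner_dualStrichartz (F := fun r => F r - G r) (hF.sub hG), ← integral_sub
      (integrable_pairing hF (memLp_contRep_propagator f))
      (integrable_pairing hG (memLp_contRep_propagator f))]
  refine integral_congr_ae (Eventually.of_forall fun r => ?_)
  simp

theorem dualStrichartz_add {F G : ℝ → Lp ℂ 1 lam} (hF : MemLp F (4 / 3) volume)
    (hG : MemLp G (4 / 3) volume) :
    dualStrichartz (fun r => F r + G r) = dualStrichartz F + dualStrichartz G := by
  refine ext_inner_right ℂ fun f => ?_
  rw [inner_add_left, inner_dualStrichartz hF, inner_dualStrichartz hG,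
    inner_dualStrichartz (F := fun r => F r + G r) (hF.add hG), ← integral_add
      (integrable_pairing hF (memLp_contRep_propagator f))
      (integrable_pairing hG (memLp_contRep_propagator f))]
  refine integral_congr_ae (Eventually.of_forall fun r => ?_)
  simp

theorem dualStrichartz_congr_ae {F G : ℝ → Lp ℂ 1 lam} (h : F =ᵐ[volume] G) :
    dualStrichartz F = dualStrichartz G := by
  by_cases hF : MemLp F (4 / 3) volume
  · have hG := hF.ae_eq h
    refine ext_inner_right ℂ fun f => ?_
    rw [inner_dualStrichartz hF, inner_dualStrichartz hG]
    refine integral_congr_ae ?_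
    filter_upwards [h] with r hr
    rw [hr]
  · have hG : ¬ MemLp G (4 / 3) volume := fun hG => hF (hG.ae_eq h.symm)
    rw [dualStrichartz, dualStrichartz, dif_neg hF, dif_neg hG]

/-- The Duhamel term in the interaction picture, `∫_{r ≤ t} e^{-ir∂ₓ²} F(r) dλ dr`. -/
def duhamelTerm (F : ℝ → Lp ℂ 1 lam) (t : ℝ) : L2 := dualStrichartz ((Iic t).indicator F)

theorem norm_duhamelTerm_le (F : ℝ → Lp ℂ 1 lam) (t : ℝ) :
    ‖duhamelTerm F t‖ₑ ≤ 16 * eLpNorm F (4 / 3) volume :=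
  (norm_dualStrichartz_le _).trans (by gcongr; exact eLpNorm_indicator_le _)

theorem duhamelTerm_sub {F G : ℝ → Lp ℂ 1 lam} (hF : MemLp F (4 / 3) volume)
    (hG : MemLp G (4 / 3) volume) (t : ℝ) :
    duhamelTerm (fun r => F r - G r) t = duhamelTerm F t - duhamelTerm G t := by
  rw [duhamelTerm, duhamelTerm, duhamelTerm,
    ← dualStrichartz_sub (hF.indicator measurableSet_Iic) (hG.indicator measurableSet_Iic)]
  congr 1
  ext1 r
  by_cases hr : r ∈ Iic t
  · simp [indicator_of_mem hr]
  · simp [indicator_of_notMem hr]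

end Dual

/-! ### The Duhamel term of a smooth forcing -/

section Smooth

variable {lam : Measure ℝ}

theorem integrable_wave_mul_L1 (g : Lp ℂ 1 lam) (ξ : ℝ) :
    Integrable (fun y => wave (-y) ξ * g y) lam :=
  (L1.integrable_coeFn g).bdd_mul (c := 1) (Measurable.aestronglyMeasurable (by fun_prop))
    (Eventually.of_forall fun y => (norm_wave _ _).le)

/-- The Fourier transform at frequency `ξ` of the measure `g dλ`. -/
def densityFourier (lam : Measure ℝ) (ξ : ℝ) : Lp ℂ 1 lam →L[ℂ] ℂ :=
  LinearMap.mkContinuous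
    { toFun := fun g => ∫ y, wave (-y) ξ * g y ∂lam
      map_add' := fun g g' => by
        rw [← integral_add (integrable_wave_mul_L1 g ξ) (integrable_wave_mul_L1 g' ξ)]
        refine integral_congr_ae ?_
        filter_upwards [Lp.coeFn_add g g'] with y h
        rw [h, Pi.add_apply, mul_add]
      map_smul' := fun c g => by
        rw [RingHom.id_apply, smul_eq_mul, ← integral_const_mul]
        refine integral_congr_ae ?_
        filter_upwards [Lp.coeFn_smul c g] with y h
        rw [h, Pi.smul_apply, smul_eq_mul, mul_left_comm] }
    1 fun g => by
      rw [one_mul, L1.norm_eq_integral_norm]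
      refine norm_integral_le_of_norm_le (L1.integrable_coeFn g).norm
        (Eventually.of_forall fun y => ?_)
      rw [norm_mul, norm_wave, one_mul]

theorem densityFourier_apply (ξ : ℝ) (g : Lp ℂ 1 lam) :
    densityFourier lam ξ g = ∫ y, wave (-y) ξ * g y ∂lam := rfl

theorem norm_densityFourier_le (ξ : ℝ) (g : Lp ℂ 1 lam) : ‖densityFourier lam ξ g‖ ≤ ‖g‖ := by
  have h := (densityFourier lam ξ).le_of_opNorm_le
    (LinearMap.mkContinuous_norm_le _ zero_le_one _) g
  rwa [one_mul] at h

theorem continuous_densityFourier :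
    Continuous fun p : ℝ × Lp ℂ 1 lam => densityFourier lam p.1 p.2 := by
  refine continuous_prod_of_continuous_lipschitzWith'
    (fun p : ℝ × Lp ℂ 1 lam => densityFourier lam p.1 p.2) 1 (fun ξ => ?_) (fun g => ?_)
  · refine LipschitzWith.of_dist_le_mul fun g g' => ?_
    rw [dist_eq_norm, dist_eq_norm, ← map_sub, NNReal.coe_one, one_mul]
    exact norm_densityFourier_le ξ _
  · simp_rw [densityFourier_apply]
    refine continuous_of_dominated (bound := fun y => ‖g y‖)
      (fun ξ => (integrable_wave_mul_L1 g ξ).aestronglyMeasurable)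
      (fun ξ => Eventually.of_forall fun y => ?_) (L1.integrable_coeFn g).norm
      (Eventually.of_forall fun y => by fun_prop)
    rw [norm_mul, norm_wave, one_mul]

theorem continuous_densityFourier_comp {F : ℝ → Lp ℂ 1 lam} (hF : Continuous F) :
    Continuous fun q : ℝ × ℝ => densityFourier lam q.2 (F q.1) :=
  continuous_densityFourier.comp (continuous_snd.prodMk (hF.comp continuous_fst))

/-- The Fourier transform of `∫_{r ≤ t} e^{-ir∂ₓ²} F(r) dλ dr`. -/
def duhamelFourier (F : ℝ → Lp ℂ 1 lam) (t ξ : ℝ) : ℂ :=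
  ∫ r in Iic t, symbol (-r) ξ * densityFourier lam ξ (F r)

section Continuous

variable {F : ℝ → Lp ℂ 1 lam} (hF : Continuous F) (hFc : HasCompactSupport F)

include hF in
theorem continuous_duhamel_integrand (ξ : ℝ) :
    Continuous fun r => symbol (-r) ξ * densityFourier lam ξ (F r) := by
  have h : Continuous fun r => densityFourier lam ξ (F r) :=
    (densityFourier lam ξ).continuous.comp hF
  fun_prop

theorem norm_duhamel_integrand_le (r ξ : ℝ) :
    ‖symbol (-r) ξ * densityFourier lam ξ (F r)‖ ≤ ‖F r‖ := by
  rw [norm_mul, norm_symbol, one_mul]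
  exact norm_densityFourier_le ξ _

include hF hFc in
theorem integrable_norm_of_hasCompactSupport : Integrable fun r => ‖F r‖ :=
  (hF.integrable_of_hasCompactSupport hFc).norm

include hF hFc in
theorem integrable_duhamel_integrand (ξ : ℝ) :
    Integrable fun r => symbol (-r) ξ * densityFourier lam ξ (F r) :=
  (integrable_norm_of_hasCompactSupport hF hFc).mono'
    (continuous_duhamel_integrand hF ξ).aestronglyMeasurable
    (Eventually.of_forall fun r => norm_duhamel_integrand_le r ξ)

include hF hFc in
theorem continuous_duhamelFourier (ξ : ℝ) : Continuous fun t => duhamelFourier F t ξ := by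
  have hi := integrable_duhamel_integrand hF hFc ξ
  have h : ∀ t, duhamelFourier F t ξ = duhamelFourier F 0 ξ +
      ∫ r in (0 : ℝ)..t, symbol (-r) ξ * densityFourier lam ξ (F r) := by
    intro t
    rw [← intervalIntegral.integral_Iic_sub_Iic hi.integrableOn hi.integrableOn]
    exact (add_sub_cancel _ _).symm
  refine Continuous.congr ?_ fun t => (h t).symm
  exact continuous_const.add (intervalIntegral.continuous_primitive
    (fun a b => hi.intervalIntegrable) 0)

include hF in
theorem measurable_duhamelFourier (t : ℝ) : Measurable (duhamelFourier F t) := by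
  have h : Continuous fun q : ℝ × ℝ => symbol (-q.2) q.1 * densityFourier lam q.1 (F q.2) := by
    have := (continuous_densityFourier_comp hF).comp continuous_swap
    exact (by fun_prop : Continuous fun q : ℝ × ℝ => symbol (-q.2) q.1).mul this
  exact h.stronglyMeasurable.integral_prod_right.measurable

include hF hFc in
theorem norm_duhamelFourier_le_integral (t ξ : ℝ) : ‖duhamelFourier F t ξ‖ ≤ ∫ r, ‖F r‖ := by
  have hi := integrable_norm_of_hasCompactSupport hF hFc
  calc _ ≤ ∫ r in Iic t, ‖F r‖ := norm_integral_le_of_norm_le hi.integrableOn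
        (Eventually.of_forall fun r => norm_duhamel_integrand_le r ξ)
    _ ≤ _ := setIntegral_le_integral hi (Eventually.of_forall fun r => norm_nonneg _)

end Continuous

theorem hasDerivAt_symbol_neg (r ξ : ℝ) :
    HasDerivAt (fun r => symbol (-r) ξ)
      (((4 * Real.pi ^ 2 * ξ ^ 2 : ℝ) : ℂ) * Complex.I * symbol (-r) ξ) r := by
  unfold symbol
  have h1 : HasDerivAt (fun r : ℝ => -(4 * Real.pi ^ 2 * -r * ξ ^ 2)) (4 * Real.pi ^ 2 * ξ ^ 2) r := by
    have := (hasDerivAt_id r).const_mul (4 * Real.pi ^ 2 * ξ ^ 2)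
    rw [mul_one] at this
    refine this.congr_of_eventuallyEq (Eventually.of_forall fun s => ?_)
    simp only [id]; ring
  have h2 := (h1.ofReal_comp.mul_const Complex.I).cexp
  convert h2 using 1
  ring

section Differentiable

variable {F : ℝ → Lp ℂ 1 lam} (hF : ContDiff ℝ 1 F) (hFc : HasCompactSupport F)

-- Integrating by parts in time against the oscillation $e^{4\pi^2i\xi^2r}$ trades one time
-- derivative of the forcing for a factor $\xi^{-2}$. Smoothness in time thus replaces smoothness in
-- space, which a measure does not have.
include hF hFc in
theorem mul_norm_duhamelFourier_le (t ξ : ℝ) :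
    4 * Real.pi ^ 2 * ξ ^ 2 * ‖duhamelFourier F t ξ‖ ≤ ‖F t‖ + ∫ r, ‖deriv F r‖ := by
  have hFcont : Continuous F := hF.continuous
  have hF' : Continuous (deriv F) := hF.continuous_deriv le_rfl
  have hF'c : HasCompactSupport (deriv F) := hFc.deriv
  obtain ⟨R, hR⟩ := hFc.isCompact.isBounded.subset_closedBall 0
  -- This point is to the left of both $t$ and the support of $F$, so the lower boundary term
  -- vanishes.
  set a : ℝ := min (-R) t - 1 with ha
  have hat : a ≤ t := by have := min_le_right (-R) t; linarith
  have haR : a < -R := by have := min_le_left (-R) t; linarith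
  have hzero : ∀ r ≤ a, F r = 0 := by
    intro r hr
    by_contra hne
    have := hR (subset_tsupport _ (Function.mem_support.2 hne))
    rw [Metric.mem_closedBall, dist_zero_right, Real.norm_eq_abs] at this
    have := (abs_le.1 this).1
    linarith
  set θ : ℝ := 4 * Real.pi ^ 2 * ξ ^ 2 with hθ
  have hθ0 : 0 ≤ θ := by positivity
  have hi := integrable_duhamel_integrand hFcont hFc ξ
  have e1 : duhamelFourier F t ξ = ∫ r in a..t, symbol (-r) ξ * densityFourier lam ξ (F r) := by
    rw [← intervalIntegral.integral_Iic_sub_Iic hi.integrableOn hi.integrableOn]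
    have : ∫ r in Iic a, symbol (-r) ξ * densityFourier lam ξ (F r) = 0 := by
      refine setIntegral_eq_zero_of_forall_eq_zero fun r hr => ?_
      rw [hzero r hr]; simp
    rw [this, sub_zero]
    rfl
  have hd : ∀ r, HasDerivAt (fun r => densityFourier lam ξ (F r))
      (densityFourier lam ξ (deriv F r)) r := fun r =>
    ((densityFourier lam ξ).restrictScalars ℝ).hasFDerivAt.comp_hasDerivAt r
      ((hF.differentiable one_ne_zero).differentiableAt.hasDerivAt)
  have e2 := intervalIntegral.integral_mul_deriv_eq_deriv_mul (a := a) (b := t)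
    (u := fun r => densityFourier lam ξ (F r)) (v := fun r => symbol (-r) ξ)
    (u' := fun r => densityFourier lam ξ (deriv F r))
    (v' := fun r => ((θ : ℝ) : ℂ) * Complex.I * symbol (-r) ξ)
    (fun r _ => hd r) (fun r _ => hasDerivAt_symbol_neg r ξ)
    (((densityFourier lam ξ).continuous.comp hF').intervalIntegrable _ _)
    ((by fun_prop : Continuous fun r : ℝ => ((θ : ℝ) : ℂ) * Complex.I * symbol (-r) ξ
      ).intervalIntegrable _ _)
  have e3 : ∫ r in a..t, densityFourier lam ξ (F r) * (((θ : ℝ) : ℂ) * Complex.I * symbol (-r) ξ) =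
      ((θ : ℝ) : ℂ) * Complex.I * duhamelFourier F t ξ := by
    rw [e1, ← intervalIntegral.integral_const_mul]
    refine intervalIntegral.integral_congr fun r _ => ?_
    ring
  have e4 : ‖((θ : ℝ) : ℂ) * Complex.I * duhamelFourier F t ξ‖ = θ * ‖duhamelFourier F t ξ‖ := by
    rw [norm_mul, norm_mul, Complex.norm_real, Complex.norm_I, Real.norm_of_nonneg hθ0, mul_one]
  rw [← e4, ← e3, e2, hzero a le_rfl, map_zero, zero_mul, sub_zero]
  refine (norm_sub_le _ _).trans (add_le_add ?_ ?_)
  · rw [norm_mul, norm_symbol, mul_one]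
    exact norm_densityFourier_le ξ _
  · have hi' := integrable_norm_of_hasCompactSupport hF' hF'c
    rw [intervalIntegral.integral_of_le hat]
    calc _ ≤ ∫ r in Ioc a t, ‖deriv F r‖ := by
          refine norm_integral_le_of_norm_le hi'.integrableOn (Eventually.of_forall fun r => ?_)
          rw [norm_mul, norm_symbol, mul_one]
          exact norm_densityFourier_le ξ _
      _ ≤ _ := setIntegral_le_integral hi' (Eventually.of_forall fun r => norm_nonneg _)

-- The bound is uniform in time, so it serves both for integrability in frequency and as the
-- dominating function for continuity in time.
include hF hFc in
theorem exists_norm_duhamelFourier_le :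
    ∃ C : ℝ, 0 ≤ C ∧ ∀ t ξ, ‖duhamelFourier F t ξ‖ ≤ C * (1 + ξ ^ 2)⁻¹ := by
  obtain ⟨K, hK⟩ := hFc.exists_bound_of_continuous hF.continuous
  have hK0 : 0 ≤ K := (norm_nonneg _).trans (hK 0)
  refine ⟨(∫ r, ‖F r‖) + (K + ∫ r, ‖deriv F r‖), by positivity, fun t ξ => ?_⟩
  have h1 := norm_duhamelFourier_le_integral hF.continuous hFc t ξ
  have h2 := (mul_norm_duhamelFourier_le hF hFc t ξ).trans (add_le_add_left (hK t) _)
  rw [← div_eq_mul_inv, le_div_iff₀ (by positivity)]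
  have h3 : ξ ^ 2 ≤ 4 * Real.pi ^ 2 * ξ ^ 2 := by
    have := Real.pi_gt_three
    have h4 : (1 : ℝ) ≤ 4 * Real.pi ^ 2 := by nlinarith
    nlinarith [sq_nonneg ξ]
  have h5 := mul_le_mul_of_nonneg_right h3 (norm_nonneg (duhamelFourier F t ξ))
  linarith

include hF hFc in
theorem integrable_duhamelFourier (t : ℝ) : Integrable (duhamelFourier F t) := by
  obtain ⟨C, hC0, hC⟩ := exists_norm_duhamelFourier_le hF hFc
  exact (integrable_inv_one_add_sq.const_mul C).mono'
    (measurable_duhamelFourier hF.continuous t).aestronglyMeasurable (Eventually.of_forall (hC t))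

include hF hFc in
theorem memLp_two_duhamelFourier (t : ℝ) : MemLp (duhamelFourier F t) 2 := by
  have h1 := integrable_duhamelFourier hF hFc t
  refine (memLp_two_iff_integrable_sq_norm h1.aestronglyMeasurable).2 ?_
  refine (h1.norm.const_mul (∫ r, ‖F r‖)).mono' (h1.aestronglyMeasurable.norm.pow 2)
    (Eventually.of_forall fun ξ => ?_)
  rw [Real.norm_of_nonneg (by positivity), pow_two]
  gcongr
  exact norm_duhamelFourier_le_integral hF.continuous hFc t ξ

end Differentiable

end Smooth

/-! ### The inhomogeneous Strichartz estimate -/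

section Smooth

variable {lam : Measure ℝ} [IsFiniteMeasure lam]

theorem pairing_invFourier (g : Lp ℂ 1 lam) {p : ℝ → ℂ} (hp : Integrable p) (r : ℝ) :
    pairing lam g (invFourier fun ξ => symbol r ξ * p ξ) =
      ∫ ξ, (starRingEnd ℂ) (symbol (-r) ξ * densityFourier lam ξ g) * p ξ := by
  have hg := (LinearIsometryEquiv.integrable_comp_iff Complex.conjLIE).2 (L1.integrable_coeFn g)
  rw [pairing_apply]
  calc ∫ y, (starRingEnd ℂ) (g y) * invFourier (fun ξ => symbol r ξ * p ξ) y ∂lam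
      = ∫ y, (∫ ξ, (starRingEnd ℂ) (g y) * (wave y ξ * (symbol r ξ * p ξ))) ∂lam := by
        refine integral_congr_ae (Eventually.of_forall fun y => ?_)
        simp only
        rw [invFourier_apply (integrable_symbol_mul hp r), integral_const_mul]
    _ = ∫ ξ, ∫ y, (starRingEnd ℂ) (g y) * (wave y ξ * (symbol r ξ * p ξ)) ∂lam := by
        refine integral_integral_swap ?_
        refine ((Integrable.mul_prod hg hp).bdd_mul (c := 1) (f := fun q : ℝ × ℝ =>
          symbol r q.2 * wave q.1 q.2) (Measurable.aestronglyMeasurable (by fun_prop))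
          (Eventually.of_forall fun q => (norm_symbol_mul_wave _ _ _).le)).congr ?_
        refine Eventually.of_forall fun q => ?_
        simp only [Function.uncurry]
        change _ * ((starRingEnd ℂ) (g q.1) * _) = _
        ring
    _ = _ := by
        refine integral_congr_ae (Eventually.of_forall fun ξ => ?_)
        simp only
        rw [densityFourier_apply, map_mul, conj_symbol, neg_neg, ← integral_conj,
          mul_assoc, ← integral_mul_const, ← integral_const_mul]
        refine integral_congr_ae (Eventually.of_forall fun y => ?_)
        simp only
        rw [map_mul, conj_wave, neg_neg]
        ring

omit [IsFiniteMeasure lam] in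
theorem memLp_of_hasCompactSupport {F : ℝ → Lp ℂ 1 lam} (hF : Continuous F)
    (hFc : HasCompactSupport F) (p : ℝ≥0∞) : MemLp F p volume :=
  hF.memLp_of_hasCompactSupport hFc

variable {F : ℝ → Lp ℂ 1 lam} (hF : ContDiff ℝ 1 F) (hFc : HasCompactSupport F)

include hF hFc in
theorem inner_duhamelTerm (t : ℝ) {f : L2} (hf : Integrable (𝓕 f : L2)) :
    inner ℂ (duhamelTerm F t) f =
      ∫ ξ, (starRingEnd ℂ) (duhamelFourier F t ξ) * (𝓕 f : L2) ξ := by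
  have hFcont := hF.continuous
  have hmem : MemLp ((Iic t).indicator F) (4 / 3) volume :=
    (memLp_of_hasCompactSupport hFcont hFc _).indicator measurableSet_Iic
  rw [duhamelTerm, inner_dualStrichartz hmem]
  have e1 : ∫ r, pairing lam ((Iic t).indicator F r) (contRep (propagator r f)) =
      ∫ r in Iic t, ∫ ξ, (starRingEnd ℂ) (symbol (-r) ξ * densityFourier lam ξ (F r)) *
        (𝓕 f : L2) ξ := by
    rw [← integral_indicator measurableSet_Iic]
    refine integral_congr_ae (Eventually.of_forall fun r => ?_)
    by_cases hr : r ∈ Iic t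
    · simp only [indicator_of_mem hr]
      rw [contRep_propagator hf, pairing_invFourier _ hf]
    · simp [indicator_of_notMem hr]
  rw [e1, integral_integral_swap]
  · refine integral_congr_ae (Eventually.of_forall fun ξ => ?_)
    simp only
    rw [duhamelFourier, ← integral_conj, ← integral_mul_const]
  · have h1 : Integrable (fun q : ℝ × ℝ => ‖F q.1‖ * ‖(𝓕 f : L2) q.2‖)
        ((volume.restrict (Iic t)).prod volume) :=
      (integrable_norm_of_hasCompactSupport hFcont hFc).integrableOn.mul_prod hf.norm
    refine h1.mono' ?_ (Eventually.of_forall fun q => ?_)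
    · have hc : Continuous fun q : ℝ × ℝ =>
          (starRingEnd ℂ) (symbol (-q.1) q.2 * densityFourier lam q.2 (F q.1)) :=
        Complex.continuous_conj.comp ((by fun_prop : Continuous fun q : ℝ × ℝ =>
          symbol (-q.1) q.2).mul (continuous_densityFourier_comp hFcont))
      exact hc.aestronglyMeasurable.mul hf.aestronglyMeasurable.comp_snd
    · simp only [Function.uncurry]
      rw [norm_mul, RCLike.norm_conj]
      gcongr
      exact norm_duhamel_integrand_le _ _

-- The Duhamel term was produced abstractly by Riesz representation. Testing against the dense
-- Schwartz functions identifies its transform with the explicit integral, which is integrable and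
-- therefore provides a continuous representative.
include hF hFc in
theorem fourier_duhamelTerm (t : ℝ) :
    (𝓕 (duhamelTerm F t) : L2) =ᵐ[volume] duhamelFourier F t := by
  set m : L2 := (memLp_two_duhamelFourier hF hFc t).toLp _ with hm
  have hmae : m =ᵐ[volume] duhamelFourier F t := MemLp.coeFn_toLp _
  have hinv : (𝓕 (𝓕⁻ m : L2) : L2) = m := (Lp.fourierTransformₗᵢ ℝ ℂ).apply_symm_apply m
  have key : duhamelTerm F t = (𝓕⁻ m : L2) := by
    refine ext_inner_right ℂ fun f => ?_
    refine DenseRange.induction_on (p := fun f : L2 =>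
      inner ℂ (duhamelTerm F t) f = inner ℂ (𝓕⁻ m : L2) f) denseRange_schwartz f
      (isClosed_eq (by fun_prop) (by fun_prop)) fun φ => ?_
    rw [inner_duhamelTerm hF hFc t (integrable_fourier_schwartz φ),
      ← Lp.inner_fourier_eq, hinv, L2.inner_def]
    refine integral_congr_ae ?_
    filter_upwards [hmae] with ξ h
    rw [h, RCLike.inner_apply']
  rw [key, hinv]
  exact hmae

include hF hFc in
theorem integrable_fourier_duhamelTerm (t : ℝ) : Integrable (𝓕 (duhamelTerm F t) : L2) :=
  (integrable_congr (fourier_duhamelTerm hF hFc t)).2 (integrable_duhamelFourier hF hFc t)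

include hF hFc in
theorem propagator_duhamelTerm_ae_eq (t : ℝ) :
    propagator t (duhamelTerm F t) =ᵐ[volume]
      invFourier fun ξ => symbol t ξ * duhamelFourier F t ξ := by
  have h := propagator_ae_eq_invFourier (integrable_fourier_duhamelTerm hF hFc t) t
  rwa [invFourier_congr_ae (n := fun ξ => symbol t ξ * duhamelFourier F t ξ)] at h
  filter_upwards [fourier_duhamelTerm hF hFc t] with ξ h
  rw [h]

include hF hFc in
theorem continuous_contRep_duhamelTerm :
    Continuous fun t => contRep (propagator t (duhamelTerm F t)) := by
  simp_rw [fun t => contRep_eq (propagator_duhamelTerm_ae_eq hF hFc t)]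
  obtain ⟨C, hC0, hC⟩ := exists_norm_duhamelFourier_le hF hFc
  refine continuous_invFourier (integrable_inv_one_add_sq.const_mul C)
    (fun t => (integrable_symbol_mul (integrable_duhamelFourier hF hFc t) t).aestronglyMeasurable)
    (fun t => Eventually.of_forall fun ξ => ?_) (Eventually.of_forall fun ξ => ?_)
  · rw [norm_mul, norm_symbol, one_mul]
    exact hC t ξ
  · have := continuous_duhamelFourier hF.continuous hFc ξ
    fun_prop

/-- After Fubini the kernel is evaluated at $x-y$, but its bound does not depend on $x-y$. Only the
total mass $\|g\|_{L^1(\lambda)}$ of the source enters, however singular $\lambda$ is. -/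
theorem enorm_integral_gauss_density_le {ε : ℝ} (hε : 0 < ε) (g : Lp ℂ 1 lam) (t r x : ℝ) :
    ‖∫ ξ, gauss ε ξ * (wave x ξ * (symbol t ξ * (symbol (-r) ξ * densityFourier lam ξ g)))‖ₑ ≤
      ‖g‖ₑ * decay (t - r) := by
  have hgi := L1.integrable_coeFn g
  have e : ∫ ξ, gauss ε ξ * (wave x ξ * (symbol t ξ * (symbol (-r) ξ * densityFourier lam ξ g))) =
      ∫ y, g y * (∫ ξ, gauss ε ξ * (symbol (t - r) ξ * wave (x - y) ξ)) ∂lam := by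
    calc _ = ∫ ξ, (∫ y, g y * (gauss ε ξ * (symbol (t - r) ξ * wave (x - y) ξ)) ∂lam) := by
          refine integral_congr_ae (Eventually.of_forall fun ξ => ?_)
          simp only
          rw [densityFourier_apply, ← integral_const_mul, ← integral_const_mul,
            ← integral_const_mul, ← integral_const_mul]
          refine integral_congr_ae (Eventually.of_forall fun y => ?_)
          simp only
          rw [sub_eq_add_neg t r, symbol_add, sub_eq_add_neg x y, wave_add]
          ring
      _ = ∫ y, (∫ ξ, g y * (gauss ε ξ * (symbol (t - r) ξ * wave (x - y) ξ))) ∂lam := by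
          refine integral_integral_swap ?_
          refine (((integrable_gauss hε).mul_prod hgi).bdd_mul (c := 1) (f := fun q : ℝ × ℝ =>
            symbol (t - r) q.1 * wave (x - q.2) q.1) (Measurable.aestronglyMeasurable
            (by fun_prop)) (Eventually.of_forall fun q => (norm_symbol_mul_wave _ _ _).le)).congr ?_
          refine Eventually.of_forall fun q => ?_
          simp only [Function.uncurry]
          ring
      _ = _ := by simp_rw [integral_const_mul]
  rw [e]
  calc _ ≤ ∫⁻ y, ‖g y * ∫ ξ, gauss ε ξ * (symbol (t - r) ξ * wave (x - y) ξ)‖ₑ ∂lam :=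
        enorm_integral_le_lintegral_enorm _
    _ ≤ ∫⁻ y, ‖g y‖ₑ * decay (t - r) ∂lam := by
        refine lintegral_mono fun y => ?_
        rw [enorm_mul]
        gcongr
        exact enorm_integral_gauss_le hε _ _
    _ = (∫⁻ y, ‖g y‖ₑ ∂lam) * decay (t - r) :=
        lintegral_mul_const'' _ (Lp.aestronglyMeasurable g).enorm
    _ = _ := by rw [Lp.enorm_def, eLpNorm_one_eq_lintegral_enorm]

include hF hFc in
/-- The dispersive estimate for the Duhamel term. -/
theorem enorm_invFourier_duhamel_le (t x : ℝ) :
    ‖invFourier (fun ξ => symbol t ξ * duhamelFourier F t ξ) x‖ₑ ≤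
      ∫⁻ r, ‖F r‖ₑ * decay (t - r) := by
  have hFcont := hF.continuous
  have hm := integrable_symbol_mul (integrable_duhamelFourier hF hFc t) t
  rw [invFourier_apply hm]
  have hlim := (tendsto_integral_gauss_mul (integrable_wave_mul hm x)).enorm
  refine le_of_tendsto hlim (Eventually.of_forall fun n => ?_)
  set ε : ℝ := 1 / ((n : ℝ) + 1) with hε'
  have hε : 0 < ε := by positivity
  have e : ∫ ξ, gauss ε ξ * (wave x ξ * (symbol t ξ * duhamelFourier F t ξ)) =
      ∫ r in Iic t, ∫ ξ, gauss ε ξ * (wave x ξ * (symbol t ξ *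
        (symbol (-r) ξ * densityFourier lam ξ (F r)))) := by
    rw [integral_integral_swap]
    · refine integral_congr_ae (Eventually.of_forall fun ξ => ?_)
      simp only
      rw [duhamelFourier, ← integral_const_mul, ← integral_const_mul, ← integral_const_mul]
    · have h1 : Integrable (fun q : ℝ × ℝ => ‖F q.1‖ * ‖gauss ε q.2‖)
          ((volume.restrict (Iic t)).prod volume) :=
        (integrable_norm_of_hasCompactSupport hFcont hFc).integrableOn.mul_prod
          (integrable_gauss hε).norm
      refine h1.mono' ?_ (Eventually.of_forall fun q => ?_)
      · refine Continuous.aestronglyMeasurable ?_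
        have h2 := continuous_densityFourier_comp (lam := lam) hFcont
        have h3 := (continuous_gauss ε).comp (continuous_snd : Continuous fun q : ℝ × ℝ => q.2)
        exact h3.mul ((by fun_prop : Continuous fun q : ℝ × ℝ => wave x q.2).mul
          ((by fun_prop : Continuous fun q : ℝ × ℝ => symbol t q.2).mul
            ((by fun_prop : Continuous fun q : ℝ × ℝ => symbol (-q.1) q.2).mul h2)))
      · simp only [Function.uncurry]
        rw [norm_mul, norm_mul, norm_wave, one_mul, norm_mul, norm_symbol, one_mul, mul_comm]
        gcongr
        exact norm_duhamel_integrand_le _ _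
  rw [e]
  calc _ ≤ ∫⁻ r in Iic t, ‖∫ ξ, gauss ε ξ * (wave x ξ * (symbol t ξ *
        (symbol (-r) ξ * densityFourier lam ξ (F r))))‖ₑ := enorm_integral_le_lintegral_enorm _
    _ ≤ ∫⁻ r in Iic t, ‖F r‖ₑ * decay (t - r) :=
        lintegral_mono fun r => enorm_integral_gauss_density_le hε _ _ _ _
    _ ≤ _ := setLIntegral_le_lintegral _ _

-- The dispersive bound is independent of $x$, so the sup norm is dominated by the potential of
-- $\|F(r)\|$ and Hardy–Littlewood–Sobolev applies in time alone. The constant is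
-- $12=(144^2)^{1/4}$.
include hF hFc in
theorem memL4C0_duhamelTerm_of_contDiff :
    MemL4C0 univ (fun t => propagator t (duhamelTerm F t)) ∧
    normL4C univ (fun t => propagator t (duhamelTerm F t)) ≤ 12 * eLpNorm F (4 / 3) volume := by
  have hbound : ∀ t, ‖contRep (propagator t (duhamelTerm F t))‖ₑ ≤
      ∫⁻ r, ‖F r‖ₑ * decay (t - r) := by
    intro t
    rw [contRep_eq (propagator_duhamelTerm_ae_eq hF hFc t)]
    by_cases htop : ∫⁻ r, ‖F r‖ₑ * decay (t - r) = ∞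
    · rw [htop]; exact le_top
    rw [← ofReal_norm, ← ENNReal.ofReal_toReal htop]
    apply ENNReal.ofReal_le_ofReal
    refine (BoundedContinuousFunction.norm_le ENNReal.toReal_nonneg).2 fun x => ?_
    have h := enorm_invFourier_duhamel_le hF hFc t x
    rw [← ofReal_norm] at h
    exact (ENNReal.ofReal_le_iff_le_toReal htop).1 h
  have hnorm : eLpNorm (fun t => contRep (propagator t (duhamelTerm F t))) 4 volume ≤
      12 * eLpNorm F (4 / 3) volume := by
    have hFm : Measurable fun r => ‖F r‖ₑ := hF.continuous.enorm.measurable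
    rw [eLpNorm_eq_lintegral_rpow_enorm_toReal (p := 4) (by norm_num) (by norm_num),
      eLpNorm_eq_lintegral_rpow_enorm_toReal (p := 4 / 3) (by simp)
        (ENNReal.div_ne_top (by norm_num) (by norm_num))]
    have e43 : ((4 : ℝ≥0∞) / 3).toReal = 4 / 3 := by rw [ENNReal.toReal_div]; norm_num
    rw [e43, show (4 : ℝ≥0∞).toReal = 4 by norm_num]
    calc _ ≤ (∫⁻ t, (∫⁻ r, ‖F r‖ₑ * decay (t - r)) ^ (4 : ℝ)) ^ (1 / 4 : ℝ) := by
          gcongr with t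
          exact hbound t
      _ ≤ (ENNReal.ofReal (144 ^ 2) * (∫⁻ r, ‖F r‖ₑ ^ (4 / 3 : ℝ)) ^ (3 : ℝ)) ^ (1 / 4 : ℝ) := by
          gcongr
          exact lintegral_potential_pow_le hFm
      _ = _ := by
          rw [ENNReal.mul_rpow_of_nonneg _ _ (by norm_num), ← ENNReal.rpow_mul]
          congr 1
          · rw [ENNReal.ofReal_rpow_of_pos (by norm_num),
              show (144 ^ 2 : ℝ) = 12 ^ (4 : ℝ) by norm_num, ← Real.rpow_mul (by norm_num)]
            norm_num
          · norm_num
  refine ⟨⟨⟨Eventually.of_forall fun t =>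
    contRep_ae_eq_of (propagator_duhamelTerm_ae_eq hF hFc t), ?_⟩, ?_⟩, ?_⟩
  · rw [Measure.restrict_univ]
    exact ⟨(continuous_contRep_duhamelTerm hF hFc).aestronglyMeasurable, hnorm.trans_lt
      (ENNReal.mul_lt_top (by simp) (memLp_of_hasCompactSupport hF.continuous hFc _).2)⟩
  · refine Eventually.of_forall fun t => ?_
    rw [contRep_eq (propagator_duhamelTerm_ae_eq hF hFc t)]
    exact tendsto_invFourier_cocompact _
  · rw [normL4C, Measure.restrict_univ]
    exact hnorm

omit hF hFc in
/-- The inhomogeneous Strichartz estimate. -/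
theorem memL4C0_duhamelTerm (hF : MemLp F (4 / 3) volume) :
    MemL4C0 univ (fun t => propagator t (duhamelTerm F t)) ∧
    normL4C univ (fun t => propagator t (duhamelTerm F t)) ≤ 12 * eLpNorm F (4 / 3) volume := by
  have h43 : (4 / 3 : ℝ≥0∞) ≠ ∞ := ENNReal.div_ne_top (by norm_num) (by norm_num)
  have h143 : (1 : ℝ≥0∞) ≤ 4 / 3 := by
    rw [ENNReal.le_div_iff_mul_le (by simp) (by simp)]; norm_num
  have hex : ∀ n : ℕ, ∃ g : ℝ → Lp ℂ 1 lam, HasCompactSupport g ∧ ContDiff ℝ 1 g ∧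
      eLpNorm (F - g) (4 / 3) volume ≤ (2⁻¹ : ℝ≥0∞) ^ n := by
    intro n
    obtain ⟨g, h1, h2, h3⟩ := hF.exist_eLpNorm_sub_le h43 h143 (ε := (2⁻¹ : ℝ) ^ n) (by positivity)
    refine ⟨g, h1, h2.of_le (by exact_mod_cast le_top), h3.trans (le_of_eq ?_)⟩
    rw [ENNReal.ofReal_pow (by norm_num), ENNReal.ofReal_inv_of_pos (by norm_num)]
    simp
  choose G hGc hGd hGe using hex
  have hGm : ∀ n, MemLp (G n) (4 / 3) volume := fun n =>
    memLp_of_hasCompactSupport (hGd n).continuous (hGc n) _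
  have hpow0 : Tendsto (fun n : ℕ => (2⁻¹ : ℝ≥0∞) ^ n) atTop (𝓝 0) :=
    ENNReal.tendsto_pow_atTop_nhds_zero_of_lt_one (r := 2⁻¹) (by simp)
  refine memL4C0_of_tendsto (u := fun n t => propagator t (duhamelTerm (G n) t))
    (fun n => (memL4C0_duhamelTerm_of_contDiff (hGd n) (hGc n)).1) (fun t => ?_)
    -- The differences are at most $12\cdot2\cdot2^{-N}$, and $25>24$ gives strictness.
    (B := fun n => 25 * (2⁻¹ : ℝ≥0∞) ^ n) (tsum_geometric_const_ne_top 25 (by simp)) ?_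
    (K := fun n => 12 * (eLpNorm F (4 / 3) volume + (2⁻¹ : ℝ≥0∞) ^ n)) ?_ ?_
    (ENNReal.mul_ne_top (by simp) hF.2.ne)
  · refine ((propagator t).continuous.tendsto _).comp ?_
    rw [tendsto_iff_edist_tendsto_0]
    refine tendsto_of_tendsto_of_tendsto_of_le_of_le tendsto_const_nhds
      (h := fun n => 16 * (2⁻¹ : ℝ≥0∞) ^ n) ?_ (fun _ => zero_le) fun n => ?_
    · simpa using ENNReal.Tendsto.const_mul hpow0 (Or.inr (by simp : (16 : ℝ≥0∞) ≠ ∞))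
    · simp only
      rw [edist_eq_enorm_sub, ← enorm_neg, neg_sub, ← duhamelTerm_sub hF (hGm n)]
      refine (norm_duhamelTerm_le _ t).trans ?_
      gcongr
      exact hGe n
  · intro N n m hn hm
    have hpow : ∀ k, N ≤ k → (2⁻¹ : ℝ≥0∞) ^ k ≤ 2⁻¹ ^ N := fun k hk =>
      pow_le_pow_right_of_le_one' (by simp) hk
    have e : (fun t => propagator t (duhamelTerm (G n) t) - propagator t (duhamelTerm (G m) t)) =
        fun t => propagator t (duhamelTerm (fun r => G n r - G m r) t) := by
      ext1 t
      rw [duhamelTerm_sub (hGm n) (hGm m), map_sub]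
    rw [e]
    have hc : HasCompactSupport fun r => G n r - G m r := (hGc n).sub (hGc m)
    have h1 : eLpNorm (fun r => G n r - G m r) (4 / 3) volume ≤ 2 * (2⁻¹ : ℝ≥0∞) ^ N := by
      have h3 : (fun r => G n r - G m r) = (F - G m) - (F - G n) := by
        ext1 r
        simp only [Pi.sub_apply]
        abel
      rw [h3, two_mul]
      refine (eLpNorm_sub_le (hF.sub (hGm m)).1 (hF.sub (hGm n)).1 h143).trans ?_
      exact add_le_add ((hGe m).trans (hpow m hm)) ((hGe n).trans (hpow n hn))
    calc _ ≤ 12 * eLpNorm (fun r => G n r - G m r) (4 / 3) volume :=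
          (memL4C0_duhamelTerm_of_contDiff ((hGd n).sub (hGd m)) hc).2
      _ ≤ 12 * (2 * (2⁻¹ : ℝ≥0∞) ^ N) := by gcongr
      _ = 24 * (2⁻¹ : ℝ≥0∞) ^ N := by rw [← mul_assoc]; norm_num
      _ < _ := by
          refine ENNReal.mul_lt_mul_left ?_ ?_ (by norm_num)
          · simp
          · exact ENNReal.pow_ne_top (by simp)
  · intro n
    refine (memL4C0_duhamelTerm_of_contDiff (hGd n) (hGc n)).2.trans ?_
    gcongr
    have h3 : G n = F - (F - G n) := by simp
    calc eLpNorm (G n) (4 / 3) volume = eLpNorm (F - (F - G n)) (4 / 3) volume := by rw [← h3]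
      _ ≤ _ := (eLpNorm_sub_le hF.1 (hF.sub (hGm n)).1 h143).trans (by gcongr; exact hGe n)
  · have := ENNReal.Tendsto.const_mul (tendsto_const_nhds.add hpow0)
      (Or.inr (by simp : (12 : ℝ≥0∞) ≠ ∞)) (a := 12) (b := eLpNorm F (4 / 3) volume + 0)
    simpa using this

end Smooth

/-! ### The mixed norms -/

theorem one_le_four_thirds : (1 : ℝ≥0∞) ≤ 4 / 3 := by
  rw [ENNReal.le_div_iff_mul_le (by simp) (by simp)]; norm_num

theorem four_thirds_ne_top : (4 / 3 : ℝ≥0∞) ≠ ∞ := ENNReal.div_ne_top (by norm_num) (by norm_num)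

theorem four_thirds_toReal : ((4 : ℝ≥0∞) / 3).toReal = 4 / 3 := by
  rw [ENNReal.toReal_div]; norm_num

section MixedNorms

variable {J J' : Set ℝ} {u v : ℝ → L2}

theorem MemL4C.mono (hu : MemL4C J' u) (h : J ⊆ J') : MemL4C J u :=
  ⟨ae_restrict_of_ae_restrict_of_subset h hu.ae_eq, hu.memLp.mono_measure (Measure.restrict_mono h le_rfl)⟩

theorem MemL4C0.mono (hu : MemL4C0 J' u) (h : J ⊆ J') : MemL4C0 J u :=
  ⟨hu.toMemL4C.mono h, ae_restrict_of_ae_restrict_of_subset h hu.vanishing⟩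

theorem normL4C_mono (h : J ⊆ J') : normL4C J u ≤ normL4C J' u :=
  eLpNorm_mono_measure _ (Measure.restrict_mono h le_rfl)

theorem ae_eq_restrict_of_eqOn (hJ : MeasurableSet J) (h : EqOn u v J) :
    (fun t => contRep (u t)) =ᵐ[volume.restrict J] fun t => contRep (v t) := by
  filter_upwards [ae_restrict_mem hJ] with t ht
  rw [h ht]

theorem MemL4C.congr (hu : MemL4C J u) (hJ : MeasurableSet J) (h : EqOn u v J) : MemL4C J v := by
  refine ⟨?_, hu.memLp.ae_eq (ae_eq_restrict_of_eqOn hJ h)⟩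
  filter_upwards [hu.ae_eq, ae_restrict_mem hJ] with t h1 ht
  rwa [← h ht]

theorem MemL4C0.congr (hu : MemL4C0 J u) (hJ : MeasurableSet J) (h : EqOn u v J) :
    MemL4C0 J v := by
  refine ⟨hu.toMemL4C.congr hJ h, ?_⟩
  filter_upwards [hu.vanishing, ae_restrict_mem hJ] with t h1 ht
  rwa [← h ht]

theorem normL4C_congr (hJ : MeasurableSet J) (h : EqOn u v J) : normL4C J u = normL4C J v :=
  eLpNorm_congr_ae (ae_eq_restrict_of_eqOn hJ h)

theorem MemL4C.contRep_sub_ae (hu : MemL4C J u) (hv : MemL4C J v) :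
    (fun t => contRep (u t - v t)) =ᵐ[volume.restrict J]
      fun t => contRep (u t) - contRep (v t) := by
  filter_upwards [hu.ae_eq, hv.ae_eq] with t h1 h2 using contRep_sub h1 h2

theorem MemL4C.contRep_add_ae (hu : MemL4C J u) (hv : MemL4C J v) :
    (fun t => contRep (u t + v t)) =ᵐ[volume.restrict J]
      fun t => contRep (u t) + contRep (v t) := by
  filter_upwards [hu.ae_eq, hv.ae_eq] with t h1 h2 using contRep_add h1 h2

theorem MemL4C.normL4C_add_le (hu : MemL4C J u) (hv : MemL4C J v) :
    normL4C J (fun t => u t + v t) ≤ normL4C J u + normL4C J v := by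
  rw [normL4C, eLpNorm_congr_ae (hu.contRep_add_ae hv)]
  exact eLpNorm_add_le hu.memLp.1 hv.memLp.1 (by norm_num)

theorem MemL4C.normL4C_sub_le (hu : MemL4C J u) (hv : MemL4C J v) :
    normL4C J (fun t => u t - v t) ≤ normL4C J u + normL4C J v := by
  rw [normL4C, eLpNorm_congr_ae (hu.contRep_sub_ae hv)]
  exact eLpNorm_sub_le hu.memLp.1 hv.memLp.1 (by norm_num)

theorem MemL4C0.add (hu : MemL4C0 J u) (hv : MemL4C0 J v) : MemL4C0 J fun t => u t + v t := by
  refine ⟨⟨?_, (hu.memLp.add hv.memLp).ae_eq (hu.contRep_add_ae hv.toMemL4C).symm⟩, ?_⟩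
  · filter_upwards [hu.ae_eq, hv.ae_eq] with t h1 h2
    exact contRep_ae_eq_of (g := contRep (u t) + contRep (v t)) (add_ae_eq_contRep_add h1 h2)
  · filter_upwards [hu.ae_eq, hv.ae_eq, hu.vanishing, hv.vanishing] with t h1 h2 h3 h4
    rw [contRep_add h1 h2, BoundedContinuousFunction.coe_add]
    have h5 := h3.add h4
    rw [add_zero] at h5
    exact h5

theorem MemL4C.union {J J' : Set ℝ} (h : MemL4C J u) (h' : MemL4C J' u) : MemL4C (J ∪ J') u := by
  refine ⟨(ae_restrict_union_iff _ _ _).2 ⟨h.ae_eq, h'.ae_eq⟩, ?_, ?_⟩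
  · exact (aestronglyMeasurable_union_iff).2 ⟨h.memLp.1, h'.memLp.1⟩
  · refine (eLpNorm_mono_measure _ (Measure.restrict_union_le J J')).trans_lt ?_
    have h1 := lintegral_rpow_enorm_lt_top_of_eLpNorm_lt_top (by norm_num) (by norm_num) h.memLp.2
    have h2 := lintegral_rpow_enorm_lt_top_of_eLpNorm_lt_top (by norm_num) (by norm_num) h'.memLp.2
    rw [eLpNorm_lt_top_iff_lintegral_rpow_enorm_lt_top (by norm_num) (by norm_num),
      lintegral_add_measure]
    exact ENNReal.add_lt_top.2 ⟨h1, h2⟩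

/-- Absolute continuity of the $L^4$ norm, with one $\delta$ for all subintervals. This is the
source of smallness for large data. -/
theorem exists_pos_normL4C_le {a b : ℝ} (hu : MemL4C (Icc a b) u) {ε : ℝ} (hε : 0 < ε) :
    ∃ δ > 0, ∀ s t, a ≤ s → t ≤ b → t - s ≤ δ → normL4C (Icc s t) u ≤ ENNReal.ofReal ε := by
  obtain ⟨δ, hδ, h⟩ := hu.memLp.eLpNorm_indicator_le (by norm_num) (by norm_num) hε
  refine ⟨δ, hδ, fun s t hs ht hst => ?_⟩
  have h1 := h (Icc s t) measurableSet_Icc (by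
    refine (Measure.restrict_apply_le _ _).trans ?_
    rw [Real.volume_Icc]
    exact ENNReal.ofReal_le_ofReal hst)
  rwa [eLpNorm_indicator_eq_eLpNorm_restrict measurableSet_Icc,
    Measure.restrict_restrict_of_subset (Icc_subset_Icc hs ht)] at h1

end MixedNorms

/-! ### The linear problem -/

section Linear

variable {lam : Measure ℝ} {F : ℝ → Lp ℂ 1 lam}

theorem duhamelTerm_sub_duhamelTerm (hF : MemLp F (4 / 3) volume) {s t : ℝ} (hst : s ≤ t) :
    duhamelTerm F t - duhamelTerm F s = dualStrichartz ((Ioc s t).indicator F) := by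
  rw [duhamelTerm, duhamelTerm,
    ← dualStrichartz_sub (hF.indicator measurableSet_Iic) (hF.indicator measurableSet_Iic)]
  congr 1
  ext1 r
  by_cases h1 : r ≤ s
  · simp [indicator, h1, h1.trans hst]
  · by_cases h2 : r ≤ t <;> simp [indicator, h1, h2, not_le.1 h1]

/-- An increment is the dual Strichartz operator applied to the forcing on $(s,t]$, whose $L^{4/3}$
norm is small on short intervals. -/
theorem continuous_duhamelTerm (hF : MemLp F (4 / 3) volume) : Continuous (duhamelTerm F) := by
  refine Metric.continuous_iff.2 fun t ε hε => ?_
  -- The dual estimate costs a factor $16$, and $16\cdot\varepsilon/17<\varepsilon$.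
  obtain ⟨δ, hδ, h⟩ := hF.eLpNorm_indicator_le one_le_four_thirds four_thirds_ne_top
    (ε := ε / 17) (by positivity)
  have key : ∀ s t : ℝ, s ≤ t → t - s ≤ δ → ‖duhamelTerm F t - duhamelTerm F s‖ < ε := by
    intro s t hst hd
    have h1 := h (Ioc s t) measurableSet_Ioc (by
      rw [Real.volume_Ioc]; exact ENNReal.ofReal_le_ofReal hd)
    have h2 : ‖duhamelTerm F t - duhamelTerm F s‖ₑ ≤ ENNReal.ofReal (16 * (ε / 17)) := by
      rw [duhamelTerm_sub_duhamelTerm hF hst, ENNReal.ofReal_mul (by norm_num)]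
      refine (norm_dualStrichartz_le _).trans ?_
      simpa using mul_le_mul_right h1 16
    rw [← ofReal_norm, ENNReal.ofReal_le_ofReal_iff (by positivity)] at h2
    linarith
  refine ⟨δ, hδ, fun s hs => ?_⟩
  rw [Real.dist_eq, abs_lt] at hs
  rw [dist_eq_norm]
  rcases le_total s t with hst | hst
  · rw [norm_sub_rev]; exact key s t hst (by linarith)
  · exact key t s hst (by linarith)

/-- The tail of an $L^{4/3}$ forcing tends to zero. The limit is the nonlinear contribution to the
scattering state. -/
theorem tendsto_duhamelTerm_atTop (hF : MemLp F (4 / 3) volume) :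
    Tendsto (duhamelTerm F) atTop (𝓝 (dualStrichartz F)) := by
  have h0 : Tendsto (fun t : ℝ => eLpNorm ((Ioi t).indicator F) (4 / 3) volume) atTop (𝓝 0) := by
    have h1 : Tendsto (fun t : ℝ => ∫⁻ r, ‖(Ioi t).indicator F r‖ₑ ^ (4 / 3 : ℝ)) atTop
        (𝓝 (∫⁻ _ : ℝ, 0)) := by
      have hfin := lintegral_rpow_enorm_lt_top_of_eLpNorm_lt_top
        (p := 4 / 3) (by simp) four_thirds_ne_top hF.2
      rw [four_thirds_toReal] at hfin
      refine tendsto_lintegral_filter_of_dominated_convergence' (fun r => ‖F r‖ₑ ^ (4 / 3 : ℝ))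
        (Eventually.of_forall fun t => ((hF.1.indicator measurableSet_Ioi).enorm.pow_const _))
        (Eventually.of_forall fun t => Eventually.of_forall fun r => ?_) hfin.ne
        (Eventually.of_forall fun r => ?_)
      · gcongr
        exact enorm_indicator_le_enorm_self _ _
      · refine tendsto_const_nhds.congr' ?_
        filter_upwards [eventually_ge_atTop r] with t ht
        rw [indicator_of_notMem (by simpa using ht)]
        simp
    rw [lintegral_zero] at h1
    have h2 := h1.ennrpow_const (3 / 4 : ℝ)
    rw [ENNReal.zero_rpow_of_pos (by norm_num)] at h2
    refine h2.congr fun t => ?_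
    rw [eLpNorm_eq_lintegral_rpow_enorm_toReal (p := 4 / 3) (by simp) four_thirds_ne_top,
      four_thirds_toReal]
    norm_num
  rw [tendsto_iff_edist_tendsto_0]
  have h16 := ENNReal.Tendsto.const_mul h0 (Or.inr (by simp : (16 : ℝ≥0∞) ≠ ∞))
  rw [mul_zero] at h16
  refine tendsto_of_tendsto_of_tendsto_of_le_of_le tendsto_const_nhds h16 (fun _ => zero_le)
    fun t => ?_
  rw [edist_comm, edist_eq_enorm_sub, duhamelTerm,
    ← dualStrichartz_sub hF (hF.indicator measurableSet_Iic)]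
  refine (norm_dualStrichartz_le _).trans (le_of_eq ?_)
  congr 2
  ext1 r
  by_cases h1 : r ≤ t
  · simp [indicator, h1, not_lt.2 h1]
  · simp [indicator, h1, not_le.1 h1]

variable [IsFiniteMeasure lam]

/-- The solution of the linear problem with profile `w` and forcing `F`. -/
def linearFlow (w : L2) (F : ℝ → Lp ℂ 1 lam) (t : ℝ) : L2 := propagator t (w + duhamelTerm F t)

theorem memL4C0_propagator (w : L2) (J : Set ℝ) : MemL4C0 J fun t => propagator t w :=
  (strichartz w).1.mono (subset_univ J)

theorem normL4C_propagator_le (w : L2) (J : Set ℝ) :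
    normL4C J (fun t => propagator t w) ≤ 16 * ‖w‖ₑ :=
  (normL4C_mono (subset_univ J)).trans (strichartz w).2

omit [IsFiniteMeasure lam] in
theorem linearFlow_eq (w : L2) (F : ℝ → Lp ℂ 1 lam) :
    linearFlow w F = fun t => propagator t w + propagator t (duhamelTerm F t) := by
  ext1 t
  rw [linearFlow, map_add]

theorem memL4C0_linearFlow (w : L2) (hF : MemLp F (4 / 3) volume) (J : Set ℝ) :
    MemL4C0 J (linearFlow w F) := by
  rw [linearFlow_eq]
  exact (memL4C0_propagator w J).add ((memL4C0_duhamelTerm hF).1.mono (subset_univ J))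

theorem normL4C_linearFlow_le (w : L2) (hF : MemLp F (4 / 3) volume) (J : Set ℝ) :
    normL4C J (linearFlow w F) ≤
      normL4C J (fun t => propagator t w) + 12 * eLpNorm F (4 / 3) volume := by
  rw [linearFlow_eq]
  refine ((memL4C0_propagator w J).normL4C_add_le
    ((memL4C0_duhamelTerm hF).1.mono (subset_univ J)).toMemL4C).trans ?_
  gcongr
  exact (normL4C_mono (subset_univ J)).trans (memL4C0_duhamelTerm hF).2

/-- The converse direction: smallness of a solution is passed back to the free evolution of its
profile, which is what allows a nearby solution to be started. -/
theorem normL4C_propagator_le_linearFlow (w : L2) (hF : MemLp F (4 / 3) volume) (J : Set ℝ) :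
    normL4C J (fun t => propagator t w) ≤
      normL4C J (linearFlow w F) + 12 * eLpNorm F (4 / 3) volume := by
  have e : (fun t => propagator t w) =
      fun t => linearFlow w F t - propagator t (duhamelTerm F t) := by
    ext1 t
    rw [linearFlow_eq]
    exact (add_sub_cancel_right _ _).symm
  rw [e]
  refine ((memL4C0_linearFlow w hF J).normL4C_sub_le
    ((memL4C0_duhamelTerm hF).1.mono (subset_univ J)).toMemL4C).trans ?_
  gcongr
  exact (normL4C_mono (subset_univ J)).trans (memL4C0_duhamelTerm hF).2

omit [IsFiniteMeasure lam] in
theorem enorm_linearFlow_le (w : L2) (F : ℝ → Lp ℂ 1 lam) (t : ℝ) :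
    ‖linearFlow w F t‖ₑ ≤ ‖w‖ₑ + 16 * eLpNorm F (4 / 3) volume := by
  rw [linearFlow, ← ofReal_norm (propagator t _), LinearIsometry.norm_map, ofReal_norm]
  refine (enorm_add_le _ _).trans ?_
  gcongr
  exact norm_duhamelTerm_le F t

omit [IsFiniteMeasure lam] in
theorem linearFlow_sub {G : ℝ → Lp ℂ 1 lam} (w w' : L2) (hF : MemLp F (4 / 3) volume)
    (hG : MemLp G (4 / 3) volume) (t : ℝ) :
    linearFlow w F t - linearFlow w' G t = linearFlow (w - w') (fun r => F r - G r) t := by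
  rw [linearFlow, linearFlow, linearFlow, duhamelTerm_sub hF hG, ← map_sub]
  congr 1
  abel

omit [IsFiniteMeasure lam] in
theorem continuous_linearFlow (w : L2) (hF : MemLp F (4 / 3) volume) :
    Continuous (linearFlow w F) := by
  have h1 : Continuous fun t => (t, w + duhamelTerm F t) :=
    continuous_id.prodMk (continuous_const.add (continuous_duhamelTerm hF))
  have h2 := continuous_propagator.comp h1
  simp only [Function.comp_def] at h2
  unfold linearFlow
  exact h2

omit [IsFiniteMeasure lam] in
theorem propagator_neg_linearFlow (w : L2) (F : ℝ → Lp ℂ 1 lam) (t : ℝ) :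
    propagator (-t) (linearFlow w F t) = w + duhamelTerm F t :=
  propagator_neg_propagator _ _

end Linear

/-! ### Cubic nonlinearities -/

section Cubic

variable {lam : Measure ℝ}

/-- Cubic Lipschitz growth of a nonlinear map from bounded continuous functions to densities. -/
structure IsCubic (G : (ℝ →ᵇ ℂ) → Lp ℂ 1 lam) (K : NNReal) : Prop where
  zero : G 0 = 0
  lipschitz : ∀ f g, ‖G f - G g‖ₑ ≤ (K * (‖f‖ₑ ^ 2 + ‖g‖ₑ ^ 2)) * ‖f - g‖ₑ

variable {G : (ℝ →ᵇ ℂ) → Lp ℂ 1 lam} {K : NNReal}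

theorem IsCubic.continuous (hG : IsCubic G K) : Continuous G := by
  refine continuous_iff_continuousAt.2 fun g => ?_
  rw [ContinuousAt, tendsto_iff_edist_tendsto_0]
  have h1 : Tendsto (fun f : ℝ →ᵇ ℂ => (K * (‖f‖ₑ ^ 2 + ‖g‖ₑ ^ 2)) * ‖f - g‖ₑ) (𝓝 g)
      (𝓝 ((K * (‖g‖ₑ ^ 2 + ‖g‖ₑ ^ 2)) * 0)) := by
    refine ENNReal.Tendsto.mul ?_ (Or.inr (by simp)) ?_ (Or.inr (by finiteness))
    · refine ENNReal.Tendsto.const_mul (Tendsto.add ?_ tendsto_const_nhds) (Or.inr (by simp))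
      exact (ENNReal.continuous_pow 2).continuousAt.tendsto.comp (continuous_enorm.tendsto g)
    · have := (tendsto_iff_edist_tendsto_0 (f := id) (l := 𝓝 g) (y := g)).1 tendsto_id
      simpa [edist_eq_enorm_sub] using this
  rw [mul_zero] at h1
  refine tendsto_of_tendsto_of_tendsto_of_le_of_le tendsto_const_nhds h1 (fun _ => zero_le)
    fun f => ?_
  rw [edist_eq_enorm_sub]
  exact hG.lipschitz f g

theorem eLpNorm_norm_sq {E : Type*} [NormedAddCommGroup E] {J : Measure ℝ} (u : ℝ → E) :
    eLpNorm (fun r => ‖u r‖ ^ 2) 2 J = eLpNorm u 4 J ^ 2 := by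
  have h := eLpNorm_norm_rpow (p := 2) (μ := J) u (q := 2) (by norm_num)
  have e : (2 : ℝ≥0∞) * ENNReal.ofReal 2 = 4 := by
    rw [show ENNReal.ofReal 2 = 2 by simp]; norm_num
  rw [e] at h
  simpa using h

/-- Hölder with $3/4=1/2+1/4$: the quadratic factor is placed in $L^2$ and the difference in $L^4$.
-/
theorem eLpNorm_le_of_cubic {E X : Type*} [NormedAddCommGroup E] [NormedAddCommGroup X]
    [NormedSpace ℝ X] {J : Measure ℝ} {f : ℝ → E} {u v : ℝ → X}
    (hu : AEStronglyMeasurable u J) (hv : AEStronglyMeasurable v J)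
    (h : ∀ r, ‖f r‖ₑ ≤ (K * (‖u r‖ₑ ^ 2 + ‖v r‖ₑ ^ 2)) * ‖u r - v r‖ₑ) :
    eLpNorm f (4 / 3) J ≤
      (K * (eLpNorm u 4 J ^ 2 + eLpNorm v 4 J ^ 2)) * eLpNorm (fun r => u r - v r) 4 J := by
  have hH : ENNReal.HolderTriple 2 4 (4 / 3) := by
    refine ⟨?_⟩
    rw [ENNReal.inv_div (by norm_num) (by norm_num), ← one_div 2, ← one_div 4,
      show (1 : ℝ≥0∞) / 2 = 2 / 4 by
        rw [ENNReal.div_eq_div_iff] <;> norm_num, ENNReal.div_add_div_same]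
    norm_num
  set A : ℝ → ℝ := fun r => ‖u r‖ ^ 2 + ‖v r‖ ^ 2 with hAdef
  have hA : AEStronglyMeasurable A J := (hu.norm.pow 2).add (hv.norm.pow 2)
  have h1 : eLpNorm f (4 / 3) J ≤ K * eLpNorm (fun r => A r • (u r - v r)) (4 / 3) J := by
    have h' : ∀ r, ‖f r‖₊ ≤ K * ‖A r • (u r - v r)‖₊ := by
      intro r
      have h := h r
      simp only [enorm_eq_nnnorm] at h
      norm_cast at h
      rw [nnnorm_smul, ← mul_assoc]
      refine h.trans (le_of_eq ?_)
      congr 2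
      ext
      simp only [hAdef, NNReal.coe_add, NNReal.coe_pow, coe_nnnorm, Real.norm_eq_abs]
      rw [abs_of_nonneg (by positivity)]
    have h := eLpNorm_le_nnreal_smul_eLpNorm_of_ae_le_mul (μ := J) (Eventually.of_forall h') (4 / 3)
    simpa [ENNReal.smul_def] using h
  have h2 : eLpNorm (fun r => A r • (u r - v r)) (4 / 3) J ≤
      eLpNorm A 2 J * eLpNorm (fun r => u r - v r) 4 J :=
    eLpNorm_smul_le_mul_eLpNorm (hu.sub hv) hA
  have h3 : eLpNorm A 2 J ≤ eLpNorm u 4 J ^ 2 + eLpNorm v 4 J ^ 2 := by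
    rw [← eLpNorm_norm_sq u, ← eLpNorm_norm_sq v]
    exact eLpNorm_add_le (hu.norm.pow 2) (hv.norm.pow 2) (by norm_num)
  calc _ ≤ K * (eLpNorm A 2 J * eLpNorm (fun r => u r - v r) 4 J) := h1.trans (by gcongr)
    _ ≤ K * ((eLpNorm u 4 J ^ 2 + eLpNorm v 4 J ^ 2) * eLpNorm (fun r => u r - v r) 4 J) := by
        gcongr
    _ = _ := by rw [mul_assoc]

theorem IsCubic.eLpNorm_sub_le (hG : IsCubic G K) {J : Measure ℝ} {u v : ℝ → ℝ →ᵇ ℂ}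
    (hu : AEStronglyMeasurable u J) (hv : AEStronglyMeasurable v J) :
    eLpNorm (fun r => G (u r) - G (v r)) (4 / 3) J ≤
      (K * (eLpNorm u 4 J ^ 2 + eLpNorm v 4 J ^ 2)) * eLpNorm (fun r => u r - v r) 4 J :=
  eLpNorm_le_of_cubic hu hv fun r => hG.lipschitz (u r) (v r)

theorem IsCubic.eLpNorm_le (hG : IsCubic G K) {J : Measure ℝ} {u : ℝ → ℝ →ᵇ ℂ}
    (hu : AEStronglyMeasurable u J) :
    eLpNorm (fun r => G (u r)) (4 / 3) J ≤ K * eLpNorm u 4 J ^ 2 * eLpNorm u 4 J := by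
  have h := hG.eLpNorm_sub_le hu (v := fun _ => 0) aestronglyMeasurable_const
  simpa [hG.zero] using h

theorem IsCubic.memLp (hG : IsCubic G K) {J : Measure ℝ} {u : ℝ → ℝ →ᵇ ℂ} (hu : MemLp u 4 J) :
    MemLp (fun r => G (u r)) (4 / 3) J := by
  refine ⟨hG.continuous.comp_aestronglyMeasurable hu.1, (hG.eLpNorm_le hu.1).trans_lt ?_⟩
  have := hu.2
  finiteness

/-! ### Mild solutions -/

/-- The nonlinear forcing, restricted to the time set `J`. -/
def forcing (G : (ℝ →ᵇ ℂ) → Lp ℂ 1 lam) (J : Set ℝ) (ψ : ℝ → L2) : ℝ → Lp ℂ 1 lam :=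
  J.indicator fun r => G (contRep (ψ r))

variable {J : Set ℝ} {ψ φ : ℝ → L2}

theorem memLp_forcing (hG : IsCubic G K) (hJ : MeasurableSet J) (h : MemL4C J ψ) :
    MemLp (forcing G J ψ) (4 / 3) volume :=
  (memLp_indicator_iff_restrict hJ).2 (hG.memLp h.memLp)

theorem eLpNorm_forcing_le (hG : IsCubic G K) (hJ : MeasurableSet J) (h : MemL4C J ψ) :
    eLpNorm (forcing G J ψ) (4 / 3) volume ≤ K * normL4C J ψ ^ 2 * normL4C J ψ := by
  rw [forcing, eLpNorm_indicator_eq_eLpNorm_restrict hJ]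
  exact hG.eLpNorm_le h.memLp.1

theorem eLpNorm_forcing_sub_le (hG : IsCubic G K) (hJ : MeasurableSet J) (h : MemL4C J ψ)
    (h' : MemL4C J φ) :
    eLpNorm (fun r => forcing G J ψ r - forcing G J φ r) (4 / 3) volume ≤
      (K * (normL4C J ψ ^ 2 + normL4C J φ ^ 2)) * normL4C J (fun t => ψ t - φ t) := by
  have e : (fun r => forcing G J ψ r - forcing G J φ r) =
      J.indicator fun r => G (contRep (ψ r)) - G (contRep (φ r)) := by
    ext1 r
    by_cases hr : r ∈ J <;> simp [forcing, hr]
  have e' : normL4C J (fun t => ψ t - φ t) = _ := eLpNorm_congr_ae (h.contRep_sub_ae h')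
  rw [e, eLpNorm_indicator_eq_eLpNorm_restrict hJ, e']
  exact hG.eLpNorm_sub_le h.memLp.1 h'.memLp.1

theorem forcing_congr (h : EqOn ψ φ J) : forcing G J ψ = forcing G J φ := by
  ext1 r
  by_cases hr : r ∈ J
  · simp [forcing, hr, h hr]
  · simp [forcing, hr]

theorem indicator_forcing (A : Set ℝ) : A.indicator (forcing G J ψ) = forcing G (A ∩ J) ψ :=
  indicator_indicator _ _ _

/-! ### Stability and contraction in the small regime -/

/-- Smallness of the radius `r` relative to the Lipschitz constant of the nonlinearity. -/
def IsSmallRadius (K : NNReal) (r : ℝ≥0∞) : Prop := K * (r ^ 2 + r ^ 2) ≤ 2000⁻¹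

/-- The factor $13$ is the size a small solution reaches: $e$ from the free evolution and $12e$ from
a forcing of norm at most $e$. -/
theorem exists_isSmallRadius (K : NNReal) : ∃ e : NNReal, 0 < e ∧ IsSmallRadius K (13 * e) := by
  refine ⟨1 / (1000 * (K + 1)), by positivity, ?_⟩
  unfold IsSmallRadius
  have h : (K : NNReal) * ((13 * (1 / (1000 * (K + 1)))) ^ 2 + (13 * (1 / (1000 * (K + 1)))) ^ 2) ≤
      (2000⁻¹ : NNReal) := by
    rw [← NNReal.coe_le_coe]
    push_cast
    have hk0 : 0 ≤ (K : ℝ) := K.coe_nonneg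
    generalize (K : ℝ) = k at hk0 ⊢
    have h1 : k * ((13 * (1 / (1000 * (k + 1)))) ^ 2 + (13 * (1 / (1000 * (k + 1)))) ^ 2) =
        338 * k / (1000000 * (k + 1) ^ 2) := by
      field_simp
      ring
    rw [h1, div_le_iff₀ (by positivity)]
    nlinarith
  have h2 := ENNReal.coe_le_coe.2 h
  rw [ENNReal.coe_inv (by norm_num)] at h2
  push_cast at h2
  exact h2

theorem IsSmallRadius.mul_le {r x y z: ℝ≥0∞} (h : IsSmallRadius K r) (hx : x ≤ r) (hy : y ≤ r) :
    (K * (x ^ 2 + y ^ 2)) * z ≤ 2000⁻¹ * z := by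
  unfold IsSmallRadius at h
  refine mul_le_mul' (le_trans ?_ h) le_rfl
  gcongr

theorem le_two_mul_of_le_add_half {N A : ℝ≥0∞} (hN : N ≠ ∞) (h : N ≤ A + 2⁻¹ * N) : N ≤ 2 * A := by
  have h2 : N = 2⁻¹ * N + 2⁻¹ * N := by
    rw [← add_mul, ENNReal.inv_two_add_inv_two, one_mul]
  have h3 : 2⁻¹ * N ≤ A := by
    have : 2⁻¹ * N + 2⁻¹ * N ≤ A + 2⁻¹ * N := by rwa [← h2]
    exact (ENNReal.add_le_add_iff_right (by finiteness)).1 this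
  calc N = 2 * (2⁻¹ * N) := by rw [← mul_assoc, ENNReal.mul_inv_cancel (by simp) (by simp), one_mul]
    _ ≤ 2 * A := by gcongr

theorem numeral_mul_inv_le (n m : ℕ) (h : n * m ≤ 2000) (hm : 0 < m) (x : ℝ≥0∞) :
    (n : ℝ≥0∞) * (2000⁻¹ * x) ≤ (m : ℝ≥0∞)⁻¹ * x := by
  rw [← mul_assoc]
  refine mul_le_mul' ?_ le_rfl
  rw [← div_eq_mul_inv, ENNReal.div_le_iff (by norm_num) (by norm_num), mul_comm,
    ← div_eq_mul_inv, ENNReal.le_div_iff_mul_le (by left; positivity) (by simp)]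
  exact_mod_cast h

section Small

variable [IsFiniteMeasure lam]

/-- Stability of small solutions under perturbation of the profile. -/
theorem stability_of_isSmallRadius (hG : IsCubic G K) (hJ : MeasurableSet J) {r : ℝ≥0∞}
    (hr : IsSmallRadius K r) (h : MemL4C J ψ) (h' : MemL4C J φ) (hs : normL4C J ψ ≤ r)
    (hs' : normL4C J φ ≤ r) {w w' : L2} (hψ : ∀ t ∈ J, ψ t = linearFlow w (forcing G J ψ) t)
    (hφ : ∀ t ∈ J, φ t = linearFlow w' (forcing G J φ) t) :
    normL4C J (fun t => ψ t - φ t) ≤ 32 * ‖w - w'‖ₑ ∧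
    16 * eLpNorm (fun r => forcing G J ψ r - forcing G J φ r) (4 / 3) volume ≤ 2⁻¹ * ‖w - w'‖ₑ ∧
    ∀ t ∈ J, ‖ψ t - φ t‖ₑ ≤ 2 * ‖w - w'‖ₑ := by
  have hF := memLp_forcing hG hJ h
  have hF' := memLp_forcing hG hJ h'
  have hdiff : EqOn (fun t => ψ t - φ t)
      (linearFlow (w - w') fun r => forcing G J ψ r - forcing G J φ r) J := by
    intro t ht
    simp only
    rw [hψ t ht, hφ t ht, linearFlow_sub w w' hF hF']
  have hFF : MemLp (fun r => forcing G J ψ r - forcing G J φ r) (4 / 3) volume := hF.sub hF'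
  set D := eLpNorm (fun r => forcing G J ψ r - forcing G J φ r) (4 / 3) volume
  set N := normL4C J (fun t => ψ t - φ t) with hN
  have hD : D ≤ 2000⁻¹ * N := (eLpNorm_forcing_sub_le hG hJ h h').trans (hr.mul_le hs hs')
  -- Finiteness, needed to absorb the nonlinear term, comes from the linear estimate for the
  -- difference.
  have hNfin : N ≠ ∞ := by
    have h1 : MemL4C J fun t => ψ t - φ t :=
      (memL4C0_linearFlow (w - w') hFF J).toMemL4C.congr hJ hdiff.symm
    exact h1.memLp.2.ne
  have hN1 : N ≤ 32 * ‖w - w'‖ₑ := by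
    have h1 : N ≤ 16 * ‖w - w'‖ₑ + 2⁻¹ * N := by
      calc N = _ := normL4C_congr hJ hdiff
        _ ≤ _ := normL4C_linearFlow_le _ hFF J
        _ ≤ 16 * ‖w - w'‖ₑ + 12 * (2000⁻¹ * N) := by
            gcongr
            exact normL4C_propagator_le _ _
        _ ≤ _ := add_le_add_right (by
            exact_mod_cast numeral_mul_inv_le 12 2 (by norm_num) (by norm_num) N) _
    refine (le_two_mul_of_le_add_half hNfin h1).trans (le_of_eq ?_)
    rw [← mul_assoc]; norm_num
  -- Since $16\cdot32/2000\le1/2$, the Duhamel terms differ by at most half of the difference of the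
  -- profiles; uniqueness backward in time uses this half.
  have hD1 : 16 * D ≤ 2⁻¹ * ‖w - w'‖ₑ := by
    calc 16 * D ≤ 16 * (2000⁻¹ * (32 * ‖w - w'‖ₑ)) := by gcongr; exact hD.trans (by gcongr)
      _ = 512 * (2000⁻¹ * ‖w - w'‖ₑ) := by ring
      _ ≤ _ := by exact_mod_cast numeral_mul_inv_le 512 2 (by norm_num) (by norm_num) _
  refine ⟨hN1, hD1, fun t ht => ?_⟩
  have h1 := hdiff ht
  simp only at h1
  rw [h1]
  refine (enorm_linearFlow_le _ _ t).trans ?_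
  rw [two_mul]
  gcongr
  refine hD1.trans ?_
  exact mul_le_of_le_one_left' (by simp)

/-- Small solutions by the contraction principle. -/
theorem exists_small_solution (hG : IsCubic G K) (hJ : MeasurableSet J) {e : NNReal}
    (he : IsSmallRadius K (13 * e)) {w : L2} (hw : normL4C J (fun t => propagator t w) ≤ e) :
    ∃ ψ : ℝ → L2, MemL4C0 univ ψ ∧ normL4C J ψ ≤ 13 * e ∧
      ∀ t, ψ t = linearFlow w (forcing G J ψ) t := by
  have : Fact ((1 : ℝ≥0∞) ≤ 4 / 3) := ⟨one_le_four_thirds⟩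
  have hflow : ∀ F : Lp (Lp ℂ 1 lam) (4 / 3) (volume : Measure ℝ), MemL4C J (linearFlow w F) :=
    fun F => (memL4C0_linearFlow w (Lp.memLp F) J).toMemL4C
  have hnorm : ∀ F : Lp (Lp ℂ 1 lam) (4 / 3) (volume : Measure ℝ),
      F ∈ Metric.closedEBall 0 (e : ℝ≥0∞) → normL4C J (linearFlow w F) ≤ 13 * e := by
    intro F hF
    rw [Metric.mem_closedEBall, edist_zero_right, Lp.enorm_def] at hF
    refine (normL4C_linearFlow_le w (Lp.memLp F) J).trans ?_
    calc _ ≤ (e : ℝ≥0∞) + 12 * e := by gcongr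
      _ = _ := by ring
  -- The fixed point is sought among forcings rather than solutions: they form a complete Lebesgue
  -- space, and the linear flow of a forcing has continuous representatives automatically.
  set Φ : Lp (Lp ℂ 1 lam) (4 / 3) (volume : Measure ℝ) → Lp (Lp ℂ 1 lam) (4 / 3) volume :=
    fun F => (memLp_forcing hG hJ (hflow F)).toLp _ with hΦ
  have hmaps : MapsTo Φ (Metric.closedEBall 0 (e : ℝ≥0∞)) (Metric.closedEBall 0 (e : ℝ≥0∞)) := by
    intro F hF
    rw [Metric.mem_closedEBall, edist_zero_right, hΦ, Lp.enorm_toLp]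
    refine (eLpNorm_forcing_le hG hJ (hflow F)).trans ?_
    have h1 := hnorm F hF
    calc _ ≤ (K * (normL4C J (linearFlow w F) ^ 2 + normL4C J (linearFlow w F) ^ 2)) *
          normL4C J (linearFlow w F) := by gcongr; exact le_self_add
      _ ≤ 2000⁻¹ * normL4C J (linearFlow w F) := he.mul_le h1 h1
      _ ≤ 2000⁻¹ * (13 * e) := by gcongr
      _ = 13 * (2000⁻¹ * e) := by ring
      _ ≤ e := by simpa using numeral_mul_inv_le 13 1 (by norm_num) (by norm_num) e
  have hcontr : ContractingWith 2⁻¹ (hmaps.restrict Φ _ _) := by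
    refine ⟨by rw [← NNReal.coe_lt_coe]; norm_num, fun F F' => ?_⟩
    rw [Subtype.edist_eq, Subtype.edist_eq]
    simp only [MapsTo.val_restrict_apply]
    rw [hΦ, Lp.edist_toLp_toLp, ENNReal.coe_inv (by norm_num), ENNReal.coe_ofNat]
    have h1 := eLpNorm_forcing_sub_le hG hJ (hflow F.1) (hflow F'.1)
    have h2 : normL4C J (fun t => linearFlow w F.1 t - linearFlow w F'.1 t) ≤
        12 * edist F.1 F'.1 := by
      have e1 : (fun t => linearFlow w F.1 t - linearFlow w F'.1 t) =
          linearFlow 0 fun r => F.1 r - F'.1 r := by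
        ext1 t
        rw [linearFlow_sub w w (Lp.memLp F.1) (Lp.memLp F'.1), sub_self]
      rw [e1]
      refine (normL4C_linearFlow_le 0 ((Lp.memLp F.1).sub (Lp.memLp F'.1)) J).trans ?_
      have h0 : normL4C J (fun t => propagator t (0 : L2)) = 0 := by
        simpa using normL4C_propagator_le (0 : L2) J
      rw [h0, zero_add, Lp.edist_def]
    calc _ ≤ 2000⁻¹ * (12 * edist F.1 F'.1) := h1.trans
          ((he.mul_le (hnorm _ F.2) (hnorm _ F'.2)).trans (by gcongr))
      _ = 12 * (2000⁻¹ * edist F.1 F'.1) := by ring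
      _ ≤ _ := by exact_mod_cast numeral_mul_inv_le 12 2 (by norm_num) (by norm_num) _
  obtain ⟨F, hF, hfix, -⟩ := hcontr.exists_fixedPoint' Metric.isClosed_closedEBall.isComplete hmaps
    (Metric.mem_closedEBall_self (x := 0)) (edist_ne_top _ _)
  have hae : (F : ℝ → Lp ℂ 1 lam) =ᵐ[volume] forcing G J (linearFlow w F) := by
    have h1 := MemLp.coeFn_toLp (memLp_forcing hG hJ (hflow F))
    have h2 : (memLp_forcing hG hJ (hflow F)).toLp _ = F := hfix
    rwa [h2] at h1
  -- The fixed-point equation holds almost everywhere, but the dual operator sees only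
  -- almost-everywhere classes, so the flow equation holds at every time.
  refine ⟨linearFlow w F, memL4C0_linearFlow w (Lp.memLp F) univ, hnorm F hF, fun t => ?_⟩
  rw [linearFlow, linearFlow, duhamelTerm, duhamelTerm, dualStrichartz_congr_ae
    (hae.indicator (s := Iic t))]

end Small

end Cubic

/-! ### Interval arguments on the line -/

theorem of_forall_short_step {P : ℝ → Prop} {a b δ : ℝ} (hab : a ≤ b) (hδ : 0 < δ) (ha : P a)
    (h : ∀ x y, a ≤ x → x ≤ y → y ≤ b → y - x ≤ δ → P x → P y) : P b := by
  obtain ⟨n, hn⟩ := exists_nat_gt ((b - a) / δ)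
  have hn0 : 0 < (n : ℝ) := (div_nonneg (by linarith) hδ.le).trans_lt hn
  have hstep : (b - a) / n ≤ δ := by
    rw [div_lt_iff₀ hδ] at hn
    rw [div_le_iff₀ hn0]
    linarith
  have h0 : 0 ≤ (b - a) / n := div_nonneg (by linarith) hn0.le
  have key : ∀ k : ℕ, k ≤ n → P (a + k * ((b - a) / n)) := by
    intro k
    induction k with
    | zero => intro _; simpa using ha
    | succ k ih =>
      intro hk
      refine h _ _ ?_ ?_ ?_ ?_ (ih (by omega))
      · have : 0 ≤ (k : ℝ) * ((b - a) / n) := by positivity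
        linarith
      · push_cast
        linarith
      · have h1 : ((k + 1 : ℕ) : ℝ) * ((b - a) / n) ≤ n * ((b - a) / n) := by
          gcongr
        rw [mul_div_cancel₀ _ hn0.ne'] at h1
        linarith
      · push_cast
        linarith
  have := key n le_rfl
  rwa [mul_div_cancel₀ _ hn0.ne', add_sub_cancel] at this

theorem iff_of_forall_short_iff {P : ℝ → Prop} {a b δ : ℝ} (hab : a ≤ b) (hδ : 0 < δ)
    (h : ∀ x y, a ≤ x → x ≤ y → y ≤ b → y - x ≤ δ → (P x ↔ P y)) : P a ↔ P b :=
  of_forall_short_step (P := fun x => P a ↔ P x) hab hδ Iff.rfl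
    fun x y hx hxy hy hd hP => hP.trans (h x y hx hxy hy hd)

/-- Every point of $I$ has a neighbourhood in $I$ cut out by two points of $I$; the point itself
serves on a side where $I$ has no others. -/
theorem continuousOn_of_forall_Icc {E : Type*} [TopologicalSpace E] {f : ℝ → E} {I : Set ℝ}
    (h : ∀ a ∈ I, ∀ b ∈ I, ContinuousOn f (Icc a b)) : ContinuousOn f I := by
  intro x hx
  obtain ⟨a, ha, hax, ha'⟩ : ∃ a ∈ I, a ≤ x ∧ Ici a ∈ 𝓝[I] x := by
    by_cases hy : ∃ y ∈ I, y < x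
    · obtain ⟨y, hyI, hyx⟩ := hy
      exact ⟨y, hyI, hyx.le, mem_nhdsWithin_of_mem_nhds (Ici_mem_nhds hyx)⟩
    · push Not at hy
      exact ⟨x, hx, le_rfl, mem_of_superset self_mem_nhdsWithin hy⟩
  obtain ⟨b, hb, hxb, hb'⟩ : ∃ b ∈ I, x ≤ b ∧ Iic b ∈ 𝓝[I] x := by
    by_cases hy : ∃ y ∈ I, x < y
    · obtain ⟨y, hyI, hyx⟩ := hy
      exact ⟨y, hyI, hyx.le, mem_nhdsWithin_of_mem_nhds (Iic_mem_nhds hyx)⟩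
    · push Not at hy
      exact ⟨x, hx, le_rfl, mem_of_superset self_mem_nhdsWithin hy⟩
  exact (h a ha b hb x ⟨hax, hxb⟩).mono_of_mem_nhdsWithin (inter_mem ha' hb')

/-! ### Mild solutions -/

section Mild

variable {lam : Measure ℝ}

/-- Mild solutions with nonlinearity `G`, in the interaction picture. -/
structure IsMild (G : (ℝ →ᵇ ℂ) → Lp ℂ 1 lam) (I : Set ℝ) (ψ : ℝ → L2) : Prop where
  interval : I.OrdConnected
  memL4C : ∀ a ∈ I, ∀ b ∈ I, MemL4C (Icc a b) ψ
  eq : ∀ s ∈ I, ∀ t ∈ I, s ≤ t →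
    propagator (-t) (ψ t) = propagator (-s) (ψ s) + dualStrichartz (forcing G (Ioc s t) ψ)

variable {G : (ℝ →ᵇ ℂ) → Lp ℂ 1 lam} {K : NNReal} {I J : Set ℝ} {ψ φ : ℝ → L2} {a b : ℝ}

theorem IsMild.mono (h : IsMild G I ψ) (hJI : J ⊆ I) (hJ : J.OrdConnected) : IsMild G J ψ :=
  ⟨hJ, fun a ha b hb => h.memL4C a (hJI ha) b (hJI hb),
    fun s hs t ht => h.eq s (hJI hs) t (hJI ht)⟩

theorem IsMild.congr (h : IsMild G I ψ) (heq : EqOn ψ φ I) : IsMild G I φ := by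
  refine ⟨h.interval, fun a ha b hb => (h.memL4C a ha b hb).congr measurableSet_Icc
    (heq.mono (h.interval.out ha hb)), fun s hs t ht hst => ?_⟩
  rw [← heq ht, ← heq hs, ← forcing_congr (heq.mono (Ioc_subset_Icc_self.trans
    (h.interval.out hs ht)))]
  exact h.eq s hs t ht hst

theorem forcing_ae_eq {A B : Set ℝ} (h : A =ᵐ[volume] B) :
    forcing G A ψ =ᵐ[volume] forcing G B ψ := indicator_ae_eq_of_ae_eq_set h

theorem duhamelTerm_forcing (hJ : J.OrdConnected) (haJ : a ∈ J) (hJa : J ⊆ Ici a) {t : ℝ}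
    (ht : t ∈ J) : duhamelTerm (forcing G J ψ) t = dualStrichartz (forcing G (Ioc a t) ψ) := by
  rw [duhamelTerm, indicator_forcing]
  have e : Iic t ∩ J = Icc a t := by
    ext r
    exact ⟨fun hr => ⟨hJa hr.2, hr.1⟩, fun hr => ⟨hr.2, hJ.out haJ ht hr⟩⟩
  rw [e]
  exact dualStrichartz_congr_ae (forcing_ae_eq Ioc_ae_eq_Icc.symm)

theorem IsMild.eq_linearFlow (h : IsMild G I ψ) (hJI : J ⊆ I) (hJ : J.OrdConnected) (haJ : a ∈ J)
    (hJa : J ⊆ Ici a) {t : ℝ} (ht : t ∈ J) :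
    ψ t = linearFlow (propagator (-a) (ψ a)) (forcing G J ψ) t := by
  rw [linearFlow, duhamelTerm_forcing hJ haJ hJa ht, ← h.eq a (hJI haJ) t (hJI ht) (hJa ht),
    propagator_propagator_neg]

theorem IsMild.eq_linearFlow_Icc (h : IsMild G I ψ) (ha : a ∈ I) (hb : b ∈ I) {t : ℝ}
    (ht : t ∈ Icc a b) :
    ψ t = linearFlow (propagator (-a) (ψ a)) (forcing G (Icc a b) ψ) t :=
  h.eq_linearFlow (h.interval.out ha hb) ordConnected_Icc ⟨le_rfl, ht.1.trans ht.2⟩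
    (fun _ h => h.1) ht

theorem isMild_of_linearFlow (hG : IsCubic G K) (hJ : J.OrdConnected) (h : MemL4C J ψ) {w : L2}
    (heq : ∀ t ∈ J, ψ t = linearFlow w (forcing G J ψ) t) : IsMild G J ψ := by
  refine ⟨hJ, fun a ha b hb => h.mono (hJ.out ha hb), fun s hs t ht hst => ?_⟩
  have hF := memLp_forcing hG hJ.measurableSet h
  rw [heq t ht, heq s hs, propagator_neg_linearFlow, propagator_neg_linearFlow, add_assoc]
  congr 1
  rw [← sub_eq_iff_eq_add', duhamelTerm_sub_duhamelTerm hF hst, indicator_forcing,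
    inter_eq_left.2 (Ioc_subset_Icc_self.trans (hJ.out hs ht))]

theorem dualStrichartz_forcing_Ioc (hG : IsCubic G K) {s t : ℝ} (h : MemL4C (Icc s b) ψ)
    (h' : MemL4C (Icc b t) ψ) (hsb : s ≤ b) (hbt : b ≤ t) :
    dualStrichartz (forcing G (Ioc s t) ψ) =
      dualStrichartz (forcing G (Ioc s b) ψ) + dualStrichartz (forcing G (Ioc b t) ψ) := by
  rw [← dualStrichartz_add (memLp_forcing hG measurableSet_Ioc (h.mono Ioc_subset_Icc_self))
    (memLp_forcing hG measurableSet_Ioc (h'.mono Ioc_subset_Icc_self))]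
  congr 1
  ext1 r
  by_cases h1 : s < r
  · by_cases h2 : r ≤ b
    · simp [forcing, indicator, h1, h2, h2.trans hbt, not_lt.2 h2]
    · simp [forcing, indicator, h1, h2, not_le.1 h2]
  · simp [forcing, indicator, h1, not_lt.2 ((not_lt.1 h1).trans hsb)]

/-- The mild identity is an additive statement about increments over $(s,t]$, so it can be split at
$b$. No matching beyond the common value at $b$ is needed. -/
theorem IsMild.union (hG : IsCubic G K) (h : IsMild G I ψ) (h' : IsMild G J ψ) (hbI : b ∈ I)
    (hbJ : b ∈ J) (hI : I ⊆ Iic b) (hJ : J ⊆ Ici b) : IsMild G (I ∪ J) ψ := by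
  refine ⟨⟨?_⟩, ?_, ?_⟩
  · rintro x hx y hy z ⟨hxz, hzy⟩
    rcases le_total z b with hz | hz
    · refine Or.inl ?_
      rcases hx with hx | hx
      · exact h.interval.out hx hbI ⟨hxz, hz⟩
      · rwa [le_antisymm hz ((hJ hx).trans hxz)]
    · refine Or.inr ?_
      rcases hy with hy | hy
      · rwa [le_antisymm (hzy.trans (hI hy)) hz]
      · exact h'.interval.out hbJ hy ⟨hz, hzy⟩
  · rintro x (hx | hx) y (hy | hy)
    · exact h.memL4C x hx y hy
    · refine ((h.memL4C x hx b hbI).union (h'.memL4C b hbJ y hy)).mono fun z hz => ?_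
      rcases le_total z b with hzb | hzb
      · exact Or.inl ⟨hz.1, hzb⟩
      · exact Or.inr ⟨hzb, hz.2⟩
    · exact (h.memL4C b hbI b hbI).mono (Icc_subset_Icc (hJ hx) (hI hy))
    · exact h'.memL4C x hx y hy
  · rintro s (hs | hs) t (ht | ht) hst
    · exact h.eq s hs t ht hst
    · rw [dualStrichartz_forcing_Ioc hG (h.memL4C s hs b hbI) (h'.memL4C b hbJ t ht) (hI hs)
        (hJ ht), ← add_assoc, ← h.eq s hs b hbI (hI hs), ← h'.eq b hbJ t ht (hJ ht)]
    · have e1 : s = b := le_antisymm (hst.trans (hI ht)) (hJ hs)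
      have e2 : t = b := le_antisymm (hI ht) ((hJ hs).trans hst)
      subst e1
      subst e2
      exact h.eq t ht t ht le_rfl
    · exact h'.eq s hs t ht hst

theorem IsMild.append (hG : IsCubic G K) (h : IsMild G I ψ) (h' : IsMild G J φ) (hbI : b ∈ I)
    (hbJ : b ∈ J) (hI : I ⊆ Iic b) (hJ : J ⊆ Ici b) (hb : ψ b = φ b) :
    ∃ χ, IsMild G (I ∪ J) χ ∧ EqOn χ ψ I ∧ EqOn χ φ J := by
  classical
  set χ : ℝ → L2 := fun t => if t ≤ b then ψ t else φ t with hχ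
  have e1 : EqOn χ ψ I := fun t ht => if_pos (hI ht)
  have e2 : EqOn χ φ J := by
    intro t ht
    rcases (mem_Ici.1 (hJ ht)).eq_or_lt with rfl | hlt
    · rw [← hb]
      exact if_pos le_rfl
    · exact if_neg (not_le.2 hlt)
  exact ⟨χ, (h.congr e1.symm).union hG (h'.congr e2.symm) hbI hbJ hI hJ, e1, e2⟩

/-! ### Uniqueness and local existence of mild solutions -/

variable [IsFiniteMeasure lam]

theorem IsMild.memL4C0 (hG : IsCubic G K) (h : IsMild G I ψ) (ha : a ∈ I) (hb : b ∈ I) :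
    MemL4C0 (Icc a b) ψ :=
  (memL4C0_linearFlow _ (memLp_forcing hG measurableSet_Icc (h.memL4C a ha b hb))
    (Icc a b)).congr measurableSet_Icc fun _ ht => (h.eq_linearFlow_Icc ha hb ht).symm

omit [IsFiniteMeasure lam] in
theorem IsMild.continuousOn (hG : IsCubic G K) (h : IsMild G I ψ) : ContinuousOn ψ I :=
  continuousOn_of_forall_Icc fun a ha b hb =>
    (continuous_linearFlow (propagator (-a) (ψ a)) (memLp_forcing hG measurableSet_Icc
      (h.memL4C a ha b hb))).continuousOn.congr fun _ ht => h.eq_linearFlow_Icc ha hb ht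

theorem enorm_propagator (t : ℝ) (f : L2) : ‖propagator t f‖ₑ = ‖f‖ₑ := by
  rw [← ofReal_norm, LinearIsometry.norm_map, ofReal_norm]

/-- The last clause is uniqueness backward in time, obtained from the forward theory so that
negative times need no separate treatment. -/
theorem IsMild.stability (hG : IsCubic G K) (h : IsMild G I ψ) (h' : IsMild G I φ) (ha : a ∈ I)
    (hb : b ∈ I) (hab : a ≤ b) {r : ℝ≥0∞} (hr : IsSmallRadius K r)
    (hs : normL4C (Icc a b) ψ ≤ r) (hs' : normL4C (Icc a b) φ ≤ r) :
    normL4C (Icc a b) (fun t => ψ t - φ t) ≤ 32 * ‖ψ a - φ a‖ₑ ∧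
    (∀ t ∈ Icc a b, ‖ψ t - φ t‖ₑ ≤ 2 * ‖ψ a - φ a‖ₑ) ∧ (ψ b = φ b → ψ a = φ a) := by
  have hm := h.memL4C a ha b hb
  have hm' := h'.memL4C a ha b hb
  have hw : ‖propagator (-a) (ψ a) - propagator (-a) (φ a)‖ₑ = ‖ψ a - φ a‖ₑ := by
    rw [← map_sub, enorm_propagator]
  obtain ⟨h1, h2, h3⟩ := stability_of_isSmallRadius hG measurableSet_Icc hr hm hm' hs hs'
    (fun t ht => h.eq_linearFlow_Icc ha hb ht) (fun t ht => h'.eq_linearFlow_Icc ha hb ht)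
  rw [hw] at h1 h2 h3
  refine ⟨h1, h3, fun hbb => ?_⟩
  have hbJ : b ∈ Icc a b := ⟨hab, le_rfl⟩
  have e1 := h.eq_linearFlow_Icc ha hb hbJ
  have e2 := h'.eq_linearFlow_Icc ha hb hbJ
  have hF := memLp_forcing hG measurableSet_Icc hm
  have hF' := memLp_forcing hG measurableSet_Icc hm'
  have e3 := linearFlow_sub (propagator (-a) (ψ a)) (propagator (-a) (φ a)) hF hF' b
  rw [← e1, ← e2, hbb, sub_self, linearFlow, eq_comm, ← map_zero (propagator b),
    (propagator b).injective.eq_iff] at e3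
  -- Equality at $b$ makes the difference of the profiles at $a$ minus the difference of the Duhamel
  -- terms, which is at most half as large.
  have h4 : ‖ψ a - φ a‖ₑ ≤ 2⁻¹ * ‖ψ a - φ a‖ₑ := by
    rw [← hw, eq_neg_of_add_eq_zero_left e3, enorm_neg]
    refine (norm_duhamelTerm_le _ _).trans (h2.trans (le_of_eq ?_))
    rw [← hw, eq_neg_of_add_eq_zero_left e3, enorm_neg]
  have h5 := le_two_mul_of_le_add_half (N := ‖ψ a - φ a‖ₑ) (A := 0) (by simp) (by simpa using h4)
  rw [mul_zero, nonpos_iff_eq_zero, enorm_eq_zero, sub_eq_zero] at h5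
  exact h5

/-- Unconditional uniqueness of mild solutions. -/
theorem IsMild.eqOn (hG : IsCubic G K) (h : IsMild G I ψ) (h' : IsMild G I φ) {t₁ : ℝ}
    (ht₁ : t₁ ∈ I) (heq : ψ t₁ = φ t₁) : EqOn ψ φ I := by
  obtain ⟨e, he, hr⟩ := exists_isSmallRadius K
  -- An equivalence, because the time of agreement may be interior and equality must spread both
  -- ways.
  have key : ∀ a ∈ I, ∀ b ∈ I, a ≤ b → (ψ a = φ a ↔ ψ b = φ b) := by
    intro a ha b hb hab
    obtain ⟨δ, hδ, hs⟩ := exists_pos_normL4C_le (h.memL4C a ha b hb) (ε := 13 * e) (by positivity)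
    obtain ⟨δ', hδ', hs'⟩ := exists_pos_normL4C_le (h'.memL4C a ha b hb) (ε := 13 * e)
      (by positivity)
    have e13 : ENNReal.ofReal (13 * e) = 13 * e := by
      rw [ENNReal.ofReal_mul (by norm_num), ENNReal.ofReal_coe_nnreal]
      simp
    rw [e13] at hs hs'
    refine iff_of_forall_short_iff (P := fun x => ψ x = φ x) hab (lt_min hδ hδ') fun x y hax hxy hyb hd => ?_
    have hI : Icc a b ⊆ I := h.interval.out ha hb
    have hx : x ∈ I := hI ⟨hax, hxy.trans hyb⟩
    have hy : y ∈ I := hI ⟨hax.trans hxy, hyb⟩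
    obtain ⟨-, h2, h3⟩ := h.stability hG h' hx hy hxy hr
      (hs x y hax hyb (hd.trans (min_le_left _ _))) (hs' x y hax hyb (hd.trans (min_le_right _ _)))
    refine ⟨fun hxe => ?_, h3⟩
    have := h2 y ⟨hxy, le_rfl⟩
    rwa [hxe, sub_self, enorm_zero, mul_zero, nonpos_iff_eq_zero, enorm_eq_zero, sub_eq_zero] at this
  intro t ht
  rcases le_total t t₁ with hle | hle
  · exact (key t ht t₁ ht₁ hle).2 heq
  · exact (key t₁ ht₁ t ht hle).1 heq

theorem exists_small_mild (hG : IsCubic G K) (hJ : J.OrdConnected) (haJ : a ∈ J) (hJa : J ⊆ Ici a)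
    {e : NNReal} (he : IsSmallRadius K (13 * e)) {f : L2}
    (hf : normL4C J (fun t => propagator t (propagator (-a) f)) ≤ e) :
    ∃ ψ, IsMild G J ψ ∧ ψ a = f ∧ MemL4C0 univ ψ ∧ normL4C J ψ ≤ 13 * e := by
  obtain ⟨ψ, h1, h2, h3⟩ := exists_small_solution hG hJ.measurableSet he hf
  refine ⟨ψ, isMild_of_linearFlow hG hJ (h1.toMemL4C.mono (subset_univ J)) fun t _ => h3 t,
    ?_, h1, h2⟩
  rw [h3 a, linearFlow, duhamelTerm_forcing hJ haJ hJa haJ, Ioc_self]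
  have e0 : dualStrichartz (forcing G ∅ ψ) = 0 := by
    have := norm_dualStrichartz_le (forcing G ∅ ψ)
    rw [forcing, indicator_empty, show eLpNorm (fun _ : ℝ => (0 : Lp ℂ 1 lam)) (4 / 3) volume = 0
      from eLpNorm_zero', mul_zero, nonpos_iff_eq_zero, enorm_eq_zero] at this
    rw [forcing, indicator_empty]
    exact this
  rw [e0, add_zero, propagator_propagator_neg]

/-- The free evolution has finite $L^4_tC_x$ norm, hence small norm on a short interval. The length
depends on $f$ itself and not only on its norm, as the problem is critical for this argument. -/
theorem exists_local_mild (hG : IsCubic G K) (a : ℝ) (f : L2) :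
    ∃ δ > 0, ∃ ψ, IsMild G (Icc a (a + δ)) ψ ∧ ψ a = f := by
  obtain ⟨e, he, hr⟩ := exists_isSmallRadius K
  obtain ⟨δ, hδ, hs⟩ := exists_pos_normL4C_le
    (memL4C0_propagator (propagator (-a) f) (Icc a (a + 1))).toMemL4C (ε := e) (by positivity)
  rw [ENNReal.ofReal_coe_nnreal] at hs
  have h1 : a ∈ Icc a (a + min δ 1) := ⟨le_rfl, by linarith [lt_min hδ one_pos]⟩
  obtain ⟨ψ, h2, h3, -, -⟩ := exists_small_mild hG ordConnected_Icc h1 (fun _ h => h.1) hr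
    (hs a (a + min δ 1) le_rfl (by linarith [min_le_right δ 1]) (by linarith [min_le_left δ 1]))
  exact ⟨min δ 1, lt_min hδ one_pos, ψ, h2, h3⟩

end Mild

theorem normL4C_union_le (J J' : Set ℝ) (u : ℝ → L2) :
    normL4C (J ∪ J') u ≤ normL4C J u + normL4C J' u := by
  refine (eLpNorm_mono_measure _ (Measure.restrict_union_le J J')).trans ?_
  simp only [normL4C]
  rw [eLpNorm_eq_lintegral_rpow_enorm_toReal (by norm_num) (by norm_num),
    eLpNorm_eq_lintegral_rpow_enorm_toReal (by norm_num) (by norm_num),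
    eLpNorm_eq_lintegral_rpow_enorm_toReal (by norm_num) (by norm_num), lintegral_add_measure]
  exact ENNReal.rpow_add_le_add_rpow _ _ (by norm_num) (by norm_num)

/-! ### The maximal mild solution -/

section Maximal

variable {lam : Measure ℝ}

/-- The times `t ≥ 0` up to which a mild solution with data `f` at time `0` exists. -/
def lifespan (G : (ℝ →ᵇ ℂ) → Lp ℂ 1 lam) (f : L2) : Set ℝ :=
  {t | 0 ≤ t ∧ ∃ ψ, IsMild G (Icc 0 t) ψ ∧ ψ 0 = f}

variable {G : (ℝ →ᵇ ℂ) → Lp ℂ 1 lam} {K : NNReal} {f : L2} {ψ : ℝ → L2}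

theorem lifespan_subset : lifespan G f ⊆ Ici 0 := fun _ ht => ht.1

theorem mem_lifespan_of_isMild {I : Set ℝ} (h : IsMild G I ψ) (h0 : (0 : ℝ) ∈ I) {t : ℝ}
    (ht : t ∈ I) (ht0 : 0 ≤ t) : t ∈ lifespan G (ψ 0) :=
  ⟨ht0, ψ, h.mono (h.interval.out h0 ht) ordConnected_Icc, rfl⟩

theorem mem_lifespan_of_le {s t : ℝ} (ht : t ∈ lifespan G f) (hs : 0 ≤ s) (hst : s ≤ t) :
    s ∈ lifespan G f := by
  obtain ⟨-, ψ, h, rfl⟩ := ht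
  exact mem_lifespan_of_isMild h ⟨le_rfl, hs.trans hst⟩ ⟨hs, hst⟩ hs

theorem ordConnected_lifespan : (lifespan G f).OrdConnected :=
  ⟨fun _ hs _ ht _ hx => mem_lifespan_of_le ht (hs.1.trans hx.1) hx.2⟩

variable [IsFiniteMeasure lam]

/-- Restarting at $t$ and gluing shows that the lifespan contains no last time, which makes it
half-open. -/
theorem exists_add_mem_lifespan (hG : IsCubic G K) {t : ℝ} (ht : t ∈ lifespan G f) :
    ∃ δ > 0, t + δ ∈ lifespan G f := by
  obtain ⟨ht0, ψ, h, rfl⟩ := ht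
  obtain ⟨δ, hδ, φ, h1, h2⟩ := exists_local_mild hG t (ψ t)
  obtain ⟨χ, h3, h4, -⟩ := h.append hG h1 ⟨ht0, le_rfl⟩ ⟨le_rfl, by linarith⟩ (fun _ h => h.2)
    (fun _ h => h.1) h2.symm
  refine ⟨δ, hδ, ?_⟩
  rw [← h4 ⟨le_rfl, ht0⟩]
  exact mem_lifespan_of_isMild h3 (Or.inl ⟨le_rfl, ht0⟩) (Or.inr ⟨by linarith, le_rfl⟩)
    (by linarith)

theorem zero_mem_lifespan (hG : IsCubic G K) (f : L2) : (0 : ℝ) ∈ lifespan G f := by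
  obtain ⟨δ, hδ, ψ, h, h0⟩ := exists_local_mild hG 0 f
  rw [zero_add] at h
  rw [← h0]
  exact mem_lifespan_of_isMild h ⟨le_rfl, hδ.le⟩ ⟨le_rfl, hδ.le⟩ le_rfl

/-- A solution is chosen on each $[0,t]$ and evaluated on the diagonal. Uniqueness makes the choices
consistent. -/
theorem exists_isMild_lifespan (hG : IsCubic G K) (f : L2) :
    ∃ ψ, IsMild G (lifespan G f) ψ ∧ ψ 0 = f := by
  classical
  have hex : ∀ t, ∃ ψ, t ∈ lifespan G f → IsMild G (Icc 0 t) ψ ∧ ψ 0 = f := by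
    intro t
    by_cases ht : t ∈ lifespan G f
    · obtain ⟨-, ψ, h⟩ := ht
      exact ⟨ψ, fun _ => h⟩
    · exact ⟨0, fun h => absurd h ht⟩
  choose Ψ hΨ using hex
  have heq : ∀ t ∈ lifespan G f, EqOn (Ψ t) (fun s => Ψ s s) (Icc 0 t) := by
    intro t ht s hs
    have hs' := mem_lifespan_of_le ht hs.1 hs.2
    have h1 := (hΨ t ht).1.mono (Icc_subset_Icc_right hs.2) ordConnected_Icc
    exact h1.eqOn hG (hΨ s hs').1 ⟨le_rfl, hs.1⟩ ((hΨ t ht).2.trans (hΨ s hs').2.symm)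
      ⟨hs.1, le_rfl⟩
  have hmild : ∀ t ∈ lifespan G f, IsMild G (Icc 0 t) fun s => Ψ s s := fun t ht =>
    (hΨ t ht).1.congr (heq t ht)
  refine ⟨fun s => Ψ s s, ⟨ordConnected_lifespan, fun a ha b hb => ?_, fun s hs t ht hst => ?_⟩,
    (hΨ 0 (zero_mem_lifespan hG f)).2⟩
  · exact ((hmild b hb).memL4C 0 ⟨le_rfl, hb.1⟩ b ⟨hb.1, le_rfl⟩).mono (Icc_subset_Icc_left ha.1)
  · exact (hmild t ht).eq s ⟨hs.1, hst⟩ t ⟨ht.1, le_rfl⟩ hst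

/-- Continuation and scattering under a global bound on the forcing. -/
theorem lifespan_eq_and_scattersForward (hG : IsCubic G K) (h : IsMild G (lifespan G f) ψ)
    (h0 : ψ 0 = f) (hF : MemLp (forcing G (lifespan G f) ψ) (4 / 3) volume) :
    lifespan G f = Ici 0 ∧ ScattersForward ψ := by
  have hz := zero_mem_lifespan hG f
  set w := propagator (-0) (ψ 0)
  have heq : ∀ t ∈ lifespan G f, ψ t = linearFlow w (forcing G (lifespan G f) ψ) t := fun t ht =>
    h.eq_linearFlow subset_rfl h.interval hz lifespan_subset ht
  have hglobal : lifespan G f = Ici 0 := by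
    by_contra hne
    obtain ⟨B, hB0, hB⟩ : ∃ B, 0 ≤ B ∧ B ∉ lifespan G f := by
      by_contra! hcon
      exact hne (subset_antisymm lifespan_subset hcon)
    have hbdd : BddAbove (lifespan G f) := ⟨B, fun t ht => by
      by_contra! hlt
      exact hB (mem_lifespan_of_le ht hB0 hlt.le)⟩
    set T := sSup (lifespan G f)
    have hT0 : 0 ≤ T := le_csSup hbdd hz
    have hsub : lifespan G f ⊆ Icc 0 T := fun t ht => ⟨ht.1, le_csSup hbdd ht⟩
    have hsub' : Ico 0 T ⊆ lifespan G f := by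
      intro t ht
      obtain ⟨s, hs, hts⟩ := exists_lt_of_lt_csSup ⟨0, hz⟩ ht.2
      exact mem_lifespan_of_le hs ht.1 hts.le
    have hae : lifespan G f =ᵐ[volume] Icc 0 T :=
      (LE.le.eventuallyLE hsub).antisymm
        (Ico_ae_eq_Icc.symm.le.trans (LE.le.eventuallyLE hsub'))
    set χ := linearFlow w (forcing G (lifespan G f) ψ) with hχ
    -- The flow driven by the full forcing is defined at every time and agrees with $\psi$ on the
    -- lifespan. The lifespan differs from $[0,T]$ by a null set, so this flow is a mild solution up
    -- to and including $T$, against the half-openness of the lifespan.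
    have hforce : forcing G (lifespan G f) ψ =ᵐ[volume] forcing G (Icc 0 T) χ := by
      rw [forcing_congr (φ := χ) heq]
      exact forcing_ae_eq hae
    have hmild : IsMild G (Icc 0 T) χ := by
      refine isMild_of_linearFlow hG ordConnected_Icc (memL4C0_linearFlow w hF _).toMemL4C
        (w := w) fun t _ => ?_
      rw [hχ, linearFlow, linearFlow, duhamelTerm, duhamelTerm,
        dualStrichartz_congr_ae (hforce.indicator (s := Iic t))]
    have hTmem : T ∈ lifespan G f := by
      have h1 := mem_lifespan_of_isMild hmild ⟨le_rfl, hT0⟩ ⟨hT0, le_rfl⟩ hT0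
      rwa [← heq 0 hz, h0] at h1
    obtain ⟨δ, hδ, hδ'⟩ := exists_add_mem_lifespan hG hTmem
    linarith [le_csSup hbdd hδ']
  refine ⟨hglobal, w + dualStrichartz (forcing G (lifespan G f) ψ), ?_⟩
  have h1 := (tendsto_iff_norm_sub_tendsto_zero.1 (tendsto_duhamelTerm_atTop hF))
  refine h1.congr' ?_
  filter_upwards [eventually_ge_atTop 0] with t ht
  rw [heq t (hglobal ▸ ht), linearFlow, ← propagator_apply, ← map_sub, LinearIsometry.norm_map,
    add_sub_add_left_eq_sub]

theorem exists_global_of_small (hG : IsCubic G K) {e : NNReal} (he : IsSmallRadius K (13 * e))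
    (hf : 16 * ‖f‖ₑ ≤ e) :
    ∃ ψ, IsMild G (Ici 0) ψ ∧ ψ 0 = f ∧ MemL4C univ ψ := by
  obtain ⟨ψ, h1, h2, h3, -⟩ := exists_small_mild hG (J := Ici 0) (a := 0) ordConnected_Ici
    self_mem_Ici subset_rfl he (f := f)
    ((normL4C_propagator_le _ _).trans (by rwa [enorm_propagator]))
  exact ⟨ψ, h1, h2, h3.toMemL4C⟩

/-- One step of the continuous dependence argument. -/
theorem exists_extension_of_close (hG : IsCubic G K) {e : NNReal} (he : IsSmallRadius K (13 * e))
    {I : Set ℝ} (h : IsMild G I ψ) {x y : ℝ} (hx : x ∈ I) (hy : y ∈ I) (hxy : x ≤ y)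
    (hs : 4 * normL4C (Icc x y) ψ ≤ e) {g : L2} (hg : 32 * ‖g - ψ x‖ₑ ≤ e) :
    ∃ χ, IsMild G (Icc x y) χ ∧ χ x = g ∧
      normL4C (Icc x y) (fun t => χ t - ψ t) ≤ 32 * ‖g - ψ x‖ₑ ∧
      ∀ t ∈ Icc x y, ‖χ t - ψ t‖ₑ ≤ 2 * ‖g - ψ x‖ₑ := by
  have hm := h.memL4C x hx y hy
  set N := normL4C (Icc x y) ψ with hN
  have hN1 : N ≤ 13 * e := by
    calc N ≤ 4 * N := le_mul_of_one_le_left' (by norm_num)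
      _ ≤ e := hs
      _ ≤ 13 * e := le_mul_of_one_le_left' (by norm_num)
  -- Removing the Duhamel part from the small solution costs at most another $N$.
  have hψ : normL4C (Icc x y) (fun t => propagator t (propagator (-x) (ψ x))) ≤ N + N := by
    have hF := memLp_forcing hG measurableSet_Icc hm
    refine (normL4C_propagator_le_linearFlow _ hF _).trans ?_
    refine add_le_add (le_of_eq ?_) ?_
    · exact (normL4C_congr measurableSet_Icc fun t ht => h.eq_linearFlow_Icc hx hy ht).symm
    · calc _ ≤ 12 * (K * N ^ 2 * N) := by
            gcongr
            exact eLpNorm_forcing_le hG measurableSet_Icc hm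
        _ ≤ 12 * ((K * (N ^ 2 + N ^ 2)) * N) := by gcongr; exact le_self_add
        _ ≤ 12 * (2000⁻¹ * N) := by gcongr 12 * ?_; exact he.mul_le hN1 hN1
        _ ≤ N := by simpa using numeral_mul_inv_le 12 1 (by norm_num) (by norm_num) N
  have hgU : normL4C (Icc x y) (fun t => propagator t (propagator (-x) g)) ≤ e := by
    have e1 : (fun t => propagator t (propagator (-x) g)) = fun t =>
        propagator t (propagator (-x) (ψ x)) + propagator t (propagator (-x) (g - ψ x)) := by
      ext1 t
      rw [← map_add, ← map_add, add_sub_cancel]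
    rw [e1]
    refine ((memL4C0_propagator _ _).normL4C_add_le (memL4C0_propagator _ _).toMemL4C).trans ?_
    have h1 := normL4C_propagator_le (propagator (-x) (g - ψ x)) (Icc x y)
    rw [enorm_propagator] at h1
    -- The two smallness assumptions are calibrated to add up to this doubled bound.
    have h2 : 2 * (N + N + 16 * ‖g - ψ x‖ₑ) ≤ 2 * e := by
      calc _ = 4 * N + 32 * ‖g - ψ x‖ₑ := by ring
        _ ≤ e + e := add_le_add hs hg
        _ = _ := by ring
    exact (add_le_add hψ h1).trans ((ENNReal.mul_le_mul_iff_right (by simp) (by simp)).1 h2)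
  obtain ⟨χ, h1, h2, -, h4⟩ := exists_small_mild hG ordConnected_Icc
    (⟨le_rfl, hxy⟩ : x ∈ Icc x y) (fun _ h => h.1) he hgU
  obtain ⟨h5, h6, -⟩ := h1.stability hG (h.mono (h.interval.out hx hy) ordConnected_Icc)
    ⟨le_rfl, hxy⟩ ⟨hxy, le_rfl⟩ hxy he h4 hN1
  rw [h2] at h5 h6
  exact ⟨χ, h1, h2, h5, h6⟩

/-- Continuous dependence on the data, on compact subintervals of the lifespan. -/
theorem continuous_dependence (hG : IsCubic G K) {T : ℝ} (hT : 0 ≤ T)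
    (h : IsMild G (Icc 0 T) ψ) {φ : ℕ → ℝ → L2} {g : ℕ → L2}
    (hφ : ∀ n, IsMild G (lifespan G (g n)) (φ n)) (hφ0 : ∀ n, φ n 0 = g n)
    (hg : Tendsto g atTop (𝓝 (ψ 0))) :
    ∃ C : ℝ≥0∞, C ≠ ∞ ∧ ∀ᶠ n in atTop, T ∈ lifespan G (g n) ∧
      normL4C (Icc 0 T) (fun t => φ n t - ψ t) ≤ C * ‖g n - ψ 0‖ₑ ∧
      ∀ t ∈ Icc 0 T, ‖φ n t - ψ t‖ₑ ≤ C * ‖g n - ψ 0‖ₑ := by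
  obtain ⟨e, hepos, he⟩ := exists_isSmallRadius K
  obtain ⟨δ, hδ, hsmall⟩ := exists_pos_normL4C_le (h.memL4C 0 ⟨le_rfl, hT⟩ T ⟨hT, le_rfl⟩)
    (ε := e / 4) (by positivity)
  have hg0 : Tendsto (fun n => ‖g n - ψ 0‖ₑ) atTop (𝓝 0) := by
    simpa [edist_eq_enorm_sub] using tendsto_iff_edist_tendsto_0.1 hg
  refine of_forall_short_step (P := fun x => ∃ C : ℝ≥0∞, C ≠ ∞ ∧ ∀ᶠ n in atTop,
    x ∈ lifespan G (g n) ∧ normL4C (Icc 0 x) (fun t => φ n t - ψ t) ≤ C * ‖g n - ψ 0‖ₑ ∧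
      ∀ t ∈ Icc 0 x, ‖φ n t - ψ t‖ₑ ≤ C * ‖g n - ψ 0‖ₑ) hT hδ ?_ ?_
  · refine ⟨1, by simp, Eventually.of_forall fun n => ⟨zero_mem_lifespan hG _, ?_, ?_⟩⟩
    · have : volume.restrict (Icc (0 : ℝ) 0) = 0 := by simp
      rw [normL4C, this, eLpNorm_measure_zero]
      exact zero_le
    · rintro t ⟨h1, h2⟩
      rw [le_antisymm h2 h1, hφ0, one_mul]
  · rintro x y hx hxy hyT hd ⟨C, hC, hev⟩
    have hxI : x ∈ Icc 0 T := ⟨hx, hxy.trans hyT⟩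
    have hyI : y ∈ Icc 0 T := ⟨hx.trans hxy, hyT⟩
    have hs : 4 * normL4C (Icc x y) ψ ≤ e := by
      have h1 := hsmall x y hx hyT hd
      calc _ ≤ 4 * ENNReal.ofReal (e / 4) := by gcongr
        _ = ENNReal.ofReal (4 * (e / 4)) := by rw [ENNReal.ofReal_mul (by norm_num)]; simp
        _ = e := by rw [mul_div_cancel₀ _ (by norm_num), ENNReal.ofReal_coe_nnreal]
    -- The error reached at $x$ must still be within the tolerance of the extension step; this holds
    -- for large $n$ because $C$ does not depend on $n$.
    have hclose : ∀ᶠ n in atTop, 32 * (C * ‖g n - ψ 0‖ₑ) < e := by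
      have h1 := ENNReal.Tendsto.const_mul (a := 32) (ENNReal.Tendsto.const_mul (a := C) hg0
        (Or.inr hC)) (Or.inr (by simp))
      rw [mul_zero, mul_zero] at h1
      exact h1.eventually_lt_const (by exact_mod_cast hepos)
    -- $C$ covers $[0,x]$ and $32C$ the new piece. Only finitely many steps occur, so the constant
    -- stays finite.
    refine ⟨C + 32 * C, by finiteness, ?_⟩
    filter_upwards [hev, hclose] with n ⟨hn1, hn2, hn3⟩ hn4
    have hxn := hn3 x ⟨hx, le_rfl⟩
    obtain ⟨χ, h1, h2, h3, h4⟩ := exists_extension_of_close hG he h hxI hyI hxy hs (g := φ n x)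
      ((mul_le_mul_right hxn 32).trans hn4.le)
    have hy : y ∈ lifespan G (g n) := by
      have h5 := (hφ n).mono (ordConnected_lifespan.out (zero_mem_lifespan hG _) hn1)
        ordConnected_Icc
      obtain ⟨ρ, h6, h7, -⟩ := h5.append hG h1 ⟨hx, le_rfl⟩ ⟨le_rfl, hxy⟩ (fun _ h => h.2)
        (fun _ h => h.1) h2.symm
      have h8 := mem_lifespan_of_isMild h6 (Or.inl ⟨le_rfl, hx⟩) (Or.inr ⟨hxy, le_rfl⟩)
        (hx.trans hxy)
      rwa [h7 ⟨le_rfl, hx⟩, hφ0] at h8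
    have hsub : Icc x y ⊆ lifespan G (g n) := ordConnected_lifespan.out hn1 hy
    have heq : EqOn χ (φ n) (Icc x y) :=
      h1.eqOn hG ((hφ n).mono hsub ordConnected_Icc) ⟨le_rfl, hxy⟩ h2
    have hbound : ∀ k : ℝ≥0∞, k ≤ 32 → k * ‖φ n x - ψ x‖ₑ ≤ 32 * C * ‖g n - ψ 0‖ₑ := by
      intro k hk
      rw [mul_assoc]
      gcongr
    refine ⟨hy, ?_, fun t ht => ?_⟩
    · rw [← Icc_union_Icc_eq_Icc hx hxy, add_mul]
      refine (normL4C_union_le _ _ _).trans (add_le_add hn2 ?_)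
      rw [← normL4C_congr (u := fun t => χ t - ψ t) measurableSet_Icc fun t ht => by
        simp only; rw [heq ht]]
      exact h3.trans (hbound 32 le_rfl)
    · rw [add_mul]
      rcases le_total t x with htx | htx
      · exact (hn3 t ⟨ht.1, htx⟩).trans le_self_add
      · rw [← heq ⟨htx, ht.2⟩]
        exact ((h4 t ⟨htx, ht.2⟩).trans (hbound 2 (by norm_num))).trans le_add_self

end Maximal

/-! ### The cubic nonlinearity against a signed measure -/

/-- The Hahn decomposition supplies a unimodular real sign that turns integration against the signed
measure into integration against its total variation. -/
theorem exists_sign (μ : SignedMeasure ℝ) : ∃ h : ℝ → ℂ, Measurable h ∧ (∀ x, ‖h x‖ = 1) ∧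
    (∀ x, (starRingEnd ℂ) (h x) = h x) ∧ ∀ f : ℝ → ℂ, Integrable f μ.totalVariation →
      ∫ᵛ x, f x ∂<•μ = ∫ x, h x * f x ∂μ.totalVariation := by
  classical
  set j := μ.toJordanDecomposition with hj
  obtain ⟨s, hs, h1, h2⟩ := j.mutuallySingular
  have hμ : μ = j.posPart.toSignedMeasure - j.negPart.toSignedMeasure :=
    (SignedMeasure.toSignedMeasure_toJordanDecomposition μ).symm
  have htv : μ.totalVariation = j.posPart + j.negPart := rfl
  -- Here $s$ is null for the positive part and carries the negative part.
  refine ⟨fun x => if x ∈ s then -1 else 1, Measurable.ite hs measurable_const measurable_const,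
    fun x => ?_, fun x => ?_, fun f hf => ?_⟩
  · simp only; split_ifs <;> simp
  · simp only; split_ifs <;> simp
  · rw [htv] at hf
    have hf1 := hf.left_of_add_measure
    have hf2 := hf.right_of_add_measure
    have hb : ∀ x : ℝ, ‖(if x ∈ s then (-1 : ℂ) else 1)‖ ≤ 1 := fun x => by split_ifs <;> simp
    have hm : Measurable fun x : ℝ => if x ∈ s then (-1 : ℂ) else 1 :=
      Measurable.ite hs measurable_const measurable_const
    have hp : ∀ᵐ x ∂j.posPart, x ∉ s := measure_eq_zero_iff_ae_notMem.1 h1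
    have hn : ∀ᵐ x ∂j.negPart, x ∈ s := by
      filter_upwards [measure_eq_zero_iff_ae_notMem.1 h2] with x hx
      exact not_not.1 hx
    rw [htv, integral_add_measure (hf1.bdd_mul hm.aestronglyMeasurable (Eventually.of_forall hb))
      (hf2.bdd_mul hm.aestronglyMeasurable (Eventually.of_forall hb))]
    have e1 : ∫ᵛ x, f x ∂<•μ = ∫ x, f x ∂j.posPart - ∫ x, f x ∂j.negPart := by
      conv_lhs => rw [hμ]
      rw [VectorMeasure.integral_sub_vectorMeasure]
      · rw [VectorMeasure.integral_toSignedMeasure, VectorMeasure.integral_toSignedMeasure]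
      · rw [VectorMeasure.Integrable, Measure.variation_toSignedMeasure]; exact hf1
      · rw [VectorMeasure.Integrable, Measure.variation_toSignedMeasure]; exact hf2
    rw [e1, sub_eq_add_neg, ← integral_neg]
    congr 1
    · refine integral_congr_ae ?_
      filter_upwards [hp] with x hx
      simp [hx]
    · refine integral_congr_ae ?_
      filter_upwards [hn] with x hx
      simp [hx]

/-- The sign of a signed measure relative to its total variation. -/
def sgn (μ : SignedMeasure ℝ) : ℝ → ℂ := (exists_sign μ).choose

section Sign

variable (μ : SignedMeasure ℝ)

theorem measurable_sgn : Measurable (sgn μ) := (exists_sign μ).choose_spec.1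

theorem norm_sgn (x : ℝ) : ‖sgn μ x‖ = 1 := (exists_sign μ).choose_spec.2.1 x

theorem conj_sgn (x : ℝ) : (starRingEnd ℂ) (sgn μ x) = sgn μ x :=
  (exists_sign μ).choose_spec.2.2.1 x

theorem integral_eq_integral_sgn {f : ℝ → ℂ} (hf : Integrable f μ.totalVariation) :
    ∫ᵛ x, f x ∂<•μ = ∫ x, sgn μ x * f x ∂μ.totalVariation :=
  (exists_sign μ).choose_spec.2.2.2 f hf

/-- The pointwise cubic nonlinearity. -/
def cube (z : ℂ) : ℂ := ((‖z‖ ^ 2 : ℝ) : ℂ) * z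

theorem continuous_cube : Continuous cube := by
  unfold cube
  fun_prop

theorem norm_cube (z : ℂ) : ‖cube z‖ = ‖z‖ ^ 3 := by
  rw [cube, norm_mul, Complex.norm_real, Real.norm_of_nonneg (by positivity)]
  ring

theorem norm_cube_sub_le (z w : ℂ) :
    ‖cube z - cube w‖ ≤ 2 * (‖z‖ ^ 2 + ‖w‖ ^ 2) * ‖z - w‖ := by
  have e : cube z - cube w =
      ((‖z‖ ^ 2 : ℝ) : ℂ) * (z - w) + (((‖z‖ ^ 2 - ‖w‖ ^ 2 : ℝ)) : ℂ) * w := by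
    unfold cube
    push_cast
    ring
  have h1 : |‖z‖ - ‖w‖| ≤ ‖z - w‖ := abs_norm_sub_norm_le z w
  have h2 : |‖z‖ ^ 2 - ‖w‖ ^ 2| ≤ ‖z - w‖ * (‖z‖ + ‖w‖) := by
    rw [show ‖z‖ ^ 2 - ‖w‖ ^ 2 = (‖z‖ - ‖w‖) * (‖z‖ + ‖w‖) by ring, abs_mul,
      abs_of_nonneg (by positivity : 0 ≤ ‖z‖ + ‖w‖)]
    gcongr
  rw [e]
  refine (norm_add_le _ _).trans ?_
  rw [norm_mul, norm_mul, Complex.norm_real, Complex.norm_real,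
    Real.norm_of_nonneg (by positivity), Real.norm_eq_abs]
  calc _ ≤ ‖z‖ ^ 2 * ‖z - w‖ + ‖z - w‖ * (‖z‖ + ‖w‖) * ‖w‖ := by gcongr
    _ = (‖z‖ ^ 2 + (‖z‖ + ‖w‖) * ‖w‖) * ‖z - w‖ := by ring
    _ ≤ _ := by
        gcongr
        nlinarith [sq_nonneg (‖z‖ - ‖w‖), sq_nonneg (‖z‖), sq_nonneg ‖w‖]

theorem memLp_density (f : ℝ →ᵇ ℂ) :
    MemLp (fun x => -Complex.I * (sgn μ x * cube (f x))) 1 μ.totalVariation := by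
  refine MemLp.of_bound (((measurable_sgn μ).aestronglyMeasurable.mul
    (continuous_cube.comp f.continuous).aestronglyMeasurable).const_mul _) (‖f‖ ^ 3)
    (Eventually.of_forall fun x => ?_)
  rw [norm_mul, norm_neg, Complex.norm_I, one_mul, norm_mul, norm_sgn, one_mul, norm_cube]
  gcongr
  exact f.norm_coe_le_norm x

/-- The density `-i|f|²f dμ` relative to the total variation of `μ`. -/
def density (f : ℝ →ᵇ ℂ) : Lp ℂ 1 μ.totalVariation := (memLp_density μ f).toLp _

theorem coeFn_density (f : ℝ →ᵇ ℂ) :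
    density μ f =ᵐ[μ.totalVariation] fun x => -Complex.I * (sgn μ x * cube (f x)) :=
  MemLp.coeFn_toLp _

theorem isCubic_density : IsCubic (density μ) (2 * (μ.totalVariation univ).toNNReal) := by
  refine ⟨?_, fun f g => ?_⟩
  · refine Lp.ext ?_
    filter_upwards [coeFn_density μ 0, Lp.coeFn_zero ℂ 1 μ.totalVariation] with x h1 h2
    rw [h1, h2]
    simp [cube]
  · rw [density, density, ← MemLp.toLp_sub, Lp.enorm_toLp]
    refine (eLpNorm_le_of_ae_bound (C := 2 * (‖f‖ ^ 2 + ‖g‖ ^ 2) * ‖f - g‖)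
      (Eventually.of_forall fun x => ?_)).trans (le_of_eq ?_)
    · rw [Pi.sub_apply, ← mul_sub, ← mul_sub, norm_mul, norm_neg, Complex.norm_I, one_mul,
        norm_mul, norm_sgn, one_mul]
      refine (norm_cube_sub_le _ _).trans ?_
      have h1 : ‖f x - g x‖ ≤ ‖f - g‖ := (f - g).norm_coe_le_norm x
      have h2 := f.norm_coe_le_norm x
      have h3 := g.norm_coe_le_norm x
      gcongr
    · rw [ENNReal.toReal_one, inv_one, ENNReal.rpow_one, ENNReal.ofReal_mul (by positivity),
        ENNReal.ofReal_mul (by norm_num), ENNReal.ofReal_add (by positivity) (by positivity),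
        ENNReal.ofReal_pow (norm_nonneg _), ENNReal.ofReal_pow (norm_nonneg _), ofReal_norm,
        ofReal_norm, ofReal_norm, ENNReal.coe_mul, ENNReal.coe_toNNReal (measure_ne_top _ _)]
      simp only [ENNReal.ofReal_ofNat, ENNReal.coe_ofNat]
      ring

/-- The $L^1(|\mu|)$ norm of the density is $\|f\|_{L^3(|\mu|)}^3$. Its power $4/3$ is
$\|f\|_{L^3}^4$, which Hölder on the finite measure compares with $\|f\|_{L^4}^4$. This links the
scattering criterion to the $L^{4/3}$ norm of the forcing. -/
theorem enorm_density_rpow_le (f : ℝ →ᵇ ℂ) :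
    ‖density μ f‖ₑ ^ (4 / 3 : ℝ) ≤
      μ.totalVariation univ ^ (1 / 3 : ℝ) * ∫⁻ x, ‖f x‖ₑ ^ 4 ∂μ.totalVariation := by
  have h1 : ‖density μ f‖ₑ = eLpNorm f 3 μ.totalVariation ^ (3 : ℝ) := by
    rw [density, Lp.enorm_toLp, eLpNorm_one_eq_lintegral_enorm,
      eLpNorm_eq_lintegral_rpow_enorm_toReal (p := 3) (by norm_num) (by norm_num),
      ← ENNReal.rpow_mul]
    norm_num
    refine lintegral_congr fun x => ?_
    rw [← ofReal_norm (sgn μ x), norm_sgn, ← ofReal_norm (cube _), norm_cube,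
      ENNReal.ofReal_pow (norm_nonneg _), ofReal_norm, ← ofReal_norm Complex.I, Complex.norm_I]
    simp
  have h2 := eLpNorm_le_eLpNorm_mul_rpow_measure_univ (μ := μ.totalVariation) (f := f) (p := 3)
    (q := 4) (by norm_num) f.continuous.aestronglyMeasurable
  rw [h1, ← ENNReal.rpow_mul]
  calc _ ≤ (eLpNorm f 4 μ.totalVariation *
        μ.totalVariation univ ^ (1 / (3 : ℝ≥0∞).toReal - 1 / (4 : ℝ≥0∞).toReal)) ^ (4 : ℝ) := by
        rw [show (3 * (4 / 3) : ℝ) = 4 by norm_num]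
        gcongr
    _ = _ := by
        rw [ENNReal.mul_rpow_of_nonneg _ _ (by norm_num), ← ENNReal.rpow_mul, mul_comm,
          eLpNorm_eq_lintegral_rpow_enorm_toReal (p := 4) (by norm_num) (by norm_num),
          ← ENNReal.rpow_mul]
        norm_num

theorem pairing_density (f φ : ℝ →ᵇ ℂ) :
    pairing μ.totalVariation (density μ f) φ =
      Complex.I * ∫ x, sgn μ x * ((starRingEnd ℂ) (cube (f x)) * φ x) ∂μ.totalVariation := by
  rw [pairing_apply, ← integral_const_mul]
  refine integral_congr_ae ?_
  filter_upwards [coeFn_density μ f] with x h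
  rw [h, map_mul, map_mul, map_neg, Complex.conj_I, conj_sgn]
  ring

/-- The distributional action is bilinear while the pairing is conjugate-linear in the density,
whence the two conjugations. -/
theorem nonlinearity_eq_pairing (f : ℝ →ᵇ ℂ) (φ : 𝓢(ℝ, ℂ)) (g : ℝ →ᵇ ℂ)
    (h : ∀ x, φ x = (starRingEnd ℂ) (g x)) :
    -(Complex.I * nonlinearity μ f φ) =
      (starRingEnd ℂ) (pairing μ.totalVariation (density μ f) g) := by
  have hb : Integrable (fun x => φ x * (((‖f x‖ ^ 2 : ℝ) : ℂ) * f x)) μ.totalVariation := by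
    refine MemLp.integrable le_rfl (MemLp.of_bound ?_ (‖g‖ * ‖f‖ ^ 3)
      (Eventually.of_forall fun x => ?_))
    · exact φ.continuous.aestronglyMeasurable.mul
        (continuous_cube.comp f.continuous).aestronglyMeasurable
    · change ‖φ x * cube (f x)‖ ≤ _
      rw [norm_mul, norm_cube, h, RCLike.norm_conj]
      gcongr
      · exact g.norm_coe_le_norm x
      · exact f.norm_coe_le_norm x
  rw [nonlinearity, integral_eq_integral_sgn μ hb, pairing_density, map_mul, Complex.conj_I,
    ← integral_conj, neg_mul]
  congr 2
  refine integral_congr_ae (Eventually.of_forall fun x => ?_)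
  simp only [map_mul, conj_sgn, Complex.conj_conj, h]
  rw [mul_comm ((starRingEnd ℂ) (g x))]
  rfl

/-- Gauge invariance of the nonlinearity. -/
theorem re_pairing_density_self (f : ℝ →ᵇ ℂ) :
    (pairing μ.totalVariation (density μ f) f).re = 0 := by
  have e : ∀ x, sgn μ x * ((starRingEnd ℂ) (cube (f x)) * f x) =
      (((sgn μ x).re * ‖f x‖ ^ 4 : ℝ) : ℂ) := by
    intro x
    have h1 : sgn μ x = ((sgn μ x).re : ℂ) := (Complex.conj_eq_iff_re.1 (conj_sgn μ x)).symm
    have h2 : (starRingEnd ℂ) (f x) * f x = ((‖f x‖ ^ 2 : ℝ) : ℂ) := by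
      rw [mul_comm, Complex.mul_conj, Complex.normSq_eq_norm_sq]
    rw [cube, map_mul, Complex.conj_ofReal, mul_assoc, h2]
    conv_lhs => rw [h1]
    push_cast
    ring
  rw [pairing_density]
  simp_rw [e]
  rw [integral_complex_ofReal, Complex.re_mul_ofReal, Complex.I_re, zero_mul]

end Sign

/-! ### The Duhamel formula in the interaction picture -/

/-- Complex conjugation on the Schwartz space. -/
def conjSchwartz (χ : 𝓢(ℝ, ℂ)) : 𝓢(ℝ, ℂ) :=
  χ.postcompCLM (𝕜 := ℝ) (Complex.conjCLE : ℂ →L[ℝ] ℂ)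

theorem conjSchwartz_apply (χ : 𝓢(ℝ, ℂ)) (x : ℝ) : conjSchwartz χ x = (starRingEnd ℂ) (χ x) := rfl

theorem conjSchwartz_conjSchwartz (χ : 𝓢(ℝ, ℂ)) : conjSchwartz (conjSchwartz χ) = χ := by
  ext x
  simp [conjSchwartz_apply]

theorem inner_schwartz (χ : 𝓢(ℝ, ℂ)) (g : L2) :
    inner ℂ (χ.toLp 2 : L2) g = ∫ x, conjSchwartz χ x * g x := by
  rw [L2.inner_def]
  refine integral_congr_ae ?_
  filter_upwards [SchwartzMap.coeFn_toLp χ 2 volume] with x h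
  rw [h, conjSchwartz_apply, RCLike.inner_apply']

theorem symbol_neg_right (t ξ : ℝ) : symbol t (-ξ) = symbol t ξ := by
  rw [symbol, symbol, neg_sq]

theorem wave_neg_neg (x ξ : ℝ) : wave (-x) (-ξ) = wave x ξ := by
  rw [wave, wave, neg_mul_neg]

theorem conj_fourier_neg (χ : 𝓢(ℝ, ℂ)) (ξ : ℝ) :
    (starRingEnd ℂ) ((𝓕 χ : 𝓢(ℝ, ℂ)) (-ξ)) = (𝓕 (conjSchwartz χ) : 𝓢(ℝ, ℂ)) ξ := by
  rw [SchwartzMap.fourier_coe, SchwartzMap.fourier_coe, Real.fourier_eq', Real.fourier_eq',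
    ← integral_conj]
  refine integral_congr_ae (Eventually.of_forall fun x => ?_)
  simp only [smul_eq_mul, map_mul, conjSchwartz_apply, ← Complex.exp_conj, Complex.conj_ofReal,
    Complex.conj_I]
  congr 2
  simp

/-- Complex conjugation reverses time in the Schrödinger group. This reconciles the bilinear test
pairing of the Duhamel formula with the sesquilinear inner product of $L^2$. -/
theorem schwartzEvolution_conj (τ : ℝ) (χ : 𝓢(ℝ, ℂ)) (x : ℝ) :
    schwartzEvolution τ (conjSchwartz χ) x =
      (starRingEnd ℂ) (contRep (propagator (-τ) (χ.toLp 2 : L2)) x) := by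
  have hi := integrable_fourier_schwartz χ
  have hae : (𝓕 (χ.toLp 2 : L2) : L2) =ᵐ[volume] (𝓕 χ : 𝓢(ℝ, ℂ)) := by
    rw [SchwartzMap.toLp_fourier_eq]
    exact SchwartzMap.coeFn_toLp _ 2 _
  -- The reflection $\xi\mapsto-\xi$ undoes the effect of conjugation on frequencies; the symbol is
  -- even.
  rw [contRep_propagator hi, invFourier_apply (integrable_symbol_mul hi _), schwartzEvolution,
    SchwartzMap.fourierMultiplierCLM_apply, SchwartzMap.fourierInv_coe,
    fourierInv_eq_integral_wave, ← integral_conj, ← integral_neg_eq_self]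
  refine integral_congr_ae ?_
  have hae' : ∀ᵐ ξ : ℝ, (𝓕 (χ.toLp 2 : L2) : L2) ξ = (𝓕 χ : 𝓢(ℝ, ℂ)) ξ := hae
  filter_upwards [hae'] with ξ h
  rw [h, SchwartzMap.smulLeftCLM_apply_apply (hasTemperateGrowth_symbol τ), smul_eq_mul,
    ← conj_fourier_neg, neg_neg, map_mul, map_mul, conj_wave, conj_symbol, neg_neg,
    symbol_neg_right, ← wave_neg_neg, neg_neg]

section Duhamel

variable {μ : SignedMeasure ℝ} {ψ : ℝ → L2} {I : Set ℝ}

theorem inner_duhamelTerm_sub {lam : Measure ℝ} {F : ℝ → Lp ℂ 1 lam}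
    (hF : MemLp F (4 / 3) volume) (s t : ℝ) (f : L2) :
    inner ℂ (duhamelTerm F t - duhamelTerm F s) f =
      ∫ r in s..t, pairing lam (F r) (contRep (propagator r f)) := by
  have hi := integrable_pairing hF (memLp_contRep_propagator f)
  have h : ∀ t, inner ℂ (duhamelTerm F t) f =
      ∫ r in Iic t, pairing lam (F r) (contRep (propagator r f)) := by
    intro t
    rw [duhamelTerm, inner_dualStrichartz (hF.indicator measurableSet_Iic),
      ← integral_indicator measurableSet_Iic]
    refine integral_congr_ae (Eventually.of_forall fun r => ?_)
    by_cases hr : r ∈ Iic t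
    · simp only [indicator_of_mem hr]
    · simp [indicator_of_notMem hr]
  rw [inner_sub_left, h, h, intervalIntegral.integral_Iic_sub_Iic hi.integrableOn hi.integrableOn]

theorem integral_nonlinearity_eq_inner {a b t₀ t : ℝ} (h : MemL4C (Icc a b) ψ)
    (ht₀ : t₀ ∈ Icc a b) (ht : t ∈ Icc a b) (χ : 𝓢(ℝ, ℂ)) :
    -(Complex.I * ∫ s in t₀..t, nonlinearity μ (contRep (ψ s))
        (schwartzEvolution (t - s) (conjSchwartz χ))) =
      inner ℂ (propagator (-t) (χ.toLp 2 : L2))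
        (duhamelTerm (forcing (density μ) (Icc a b) ψ) t -
          duhamelTerm (forcing (density μ) (Icc a b) ψ) t₀) := by
  have hF := memLp_forcing (isCubic_density μ) measurableSet_Icc h
  rw [← inner_conj_symm, inner_duhamelTerm_sub hF, ← intervalIntegral.integral_const_mul,
    ← intervalIntegral.integral_neg, intervalIntegral.intervalIntegral_eq_integral_uIoc,
    intervalIntegral.intervalIntegral_eq_integral_uIoc, Complex.real_smul, Complex.real_smul,
    map_mul, Complex.conj_ofReal, ← integral_conj]
  congr 1
  refine setIntegral_congr_fun measurableSet_uIoc fun s hs => ?_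
  have hsI : s ∈ Icc a b := ordConnected_Icc.uIcc_subset ht₀ ht (uIoc_subset_uIcc hs)
  rw [forcing, indicator_of_mem hsI, ← propagator_add]
  refine nonlinearity_eq_pairing μ _ _ _ fun x => ?_
  rw [schwartzEvolution_conj, neg_sub, sub_eq_add_neg]

/-- Schwartz functions are dense in $L^2$, so the weak formula is an identity in $L^2$, which the
propagator carries to the interaction picture. -/
theorem duhamel_iff {a b t₀ t : ℝ} (h : MemL4C (Icc a b) ψ) (ht₀ : t₀ ∈ Icc a b)
    (ht : t ∈ Icc a b) :
    Duhamel μ ψ t₀ t ↔ propagator (-t) (ψ t) = propagator (-t₀) (ψ t₀) +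
      (duhamelTerm (forcing (density μ) (Icc a b) ψ) t -
        duhamelTerm (forcing (density μ) (Icc a b) ψ) t₀) := by
  set Δ := duhamelTerm (forcing (density μ) (Icc a b) ψ) t -
        duhamelTerm (forcing (density μ) (Icc a b) ψ) t₀ with hΔ
  have key : ∀ χ : 𝓢(ℝ, ℂ), ((∫ x, conjSchwartz χ x * ψ t x =
      (∫ x, conjSchwartz χ x * freeEvolution (t - t₀) (ψ t₀) x) -
        Complex.I * ∫ s in t₀..t, nonlinearity μ (contRep (ψ s))
          (schwartzEvolution (t - s) (conjSchwartz χ))) ↔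
      inner ℂ (χ.toLp 2 : L2) (ψ t) =
        inner ℂ (χ.toLp 2 : L2) (propagator t (propagator (-t₀) (ψ t₀) + Δ))) := by
    intro χ
    rw [sub_eq_add_neg _ (Complex.I * _), integral_nonlinearity_eq_inner h ht₀ ht,
      ← inner_schwartz, ← inner_schwartz, map_add, inner_add_right, ← propagator_apply,
      sub_eq_add_neg, propagator_add, inner_propagator_left, neg_neg]
  constructor
  · intro hD
    have h1 : ψ t = propagator t (propagator (-t₀) (ψ t₀) + Δ) := by
      refine ext_inner_left ℂ fun f => ?_
      refine DenseRange.induction_on (p := fun f : L2 => inner ℂ f (ψ t) =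
        inner ℂ f (propagator t (propagator (-t₀) (ψ t₀) + Δ))) denseRange_schwartz f
        (isClosed_eq (by fun_prop) (by fun_prop)) fun χ => (key χ).1 (hD _)
    rw [h1, propagator_neg_propagator]
  · intro hD φ
    rw [← conjSchwartz_conjSchwartz φ]
    refine (key _).2 ?_
    rw [← hD, propagator_propagator_neg]

/-- One base time suffices: subtracting the formulas for $s$ and $t$ removes it. -/
theorem IsSolution.isMild (h : IsSolution μ I ψ) : IsMild (density μ) I ψ := by
  refine ⟨h.interval, h.memL4C_loc, fun s hs t ht hst => ?_⟩
  obtain ⟨t₀, ht₀, hD⟩ := h.duhamel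
  have ha : min s t₀ ∈ I := by rcases min_choice s t₀ with h | h <;> rwa [h]
  have hb : max t t₀ ∈ I := by rcases max_choice t t₀ with h | h <;> rwa [h]
  have hm := h.memL4C_loc _ ha _ hb
  have hF := memLp_forcing (isCubic_density μ) measurableSet_Icc hm
  have m0 : t₀ ∈ Icc (min s t₀) (max t t₀) := ⟨min_le_right _ _, le_max_right _ _⟩
  have ms : s ∈ Icc (min s t₀) (max t t₀) := ⟨min_le_left _ _, hst.trans (le_max_left _ _)⟩
  have mt : t ∈ Icc (min s t₀) (max t t₀) := ⟨(min_le_left _ _).trans hst, le_max_left _ _⟩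
  have h1 := (duhamel_iff hm m0 ms).1 (hD s hs)
  have h2 := (duhamel_iff hm m0 mt).1 (hD t ht)
  have h3 := duhamelTerm_sub_duhamelTerm hF hst
  rw [indicator_forcing, inter_eq_left.2 (Ioc_subset_Icc_self.trans
    (Icc_subset_Icc ms.1 mt.2))] at h3
  rw [h1, h2, ← h3]
  abel

theorem IsMild.isSolution (h : IsMild (density μ) I ψ) (hne : I.Nonempty)
    (hb : ∃ C : ℝ, ∀ t ∈ I, ‖ψ t‖ ≤ C) : IsSolution μ I ψ := by
  refine ⟨h.interval, h.continuousOn (isCubic_density μ), hb, h.memL4C, ?_⟩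
  obtain ⟨t₀, ht₀⟩ := hne
  refine ⟨t₀, ht₀, fun t ht => ?_⟩
  have key : ∀ s ∈ I, ∀ t ∈ I, s ≤ t →
      duhamelTerm (forcing (density μ) (Icc s t) ψ) t -
        duhamelTerm (forcing (density μ) (Icc s t) ψ) s =
      dualStrichartz (forcing (density μ) (Ioc s t) ψ) := by
    intro s hs t ht hst
    rw [duhamelTerm_sub_duhamelTerm (memLp_forcing (isCubic_density μ) measurableSet_Icc
      (h.memL4C s hs t ht)) hst, indicator_forcing, inter_eq_left.2 Ioc_subset_Icc_self]
  rcases le_total t₀ t with hle | hle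
  · refine (duhamel_iff (h.memL4C t₀ ht₀ t ht) ⟨le_rfl, hle⟩ ⟨hle, le_rfl⟩).2 ?_
    rw [key t₀ ht₀ t ht hle, h.eq t₀ ht₀ t ht hle]
  · refine (duhamel_iff (h.memL4C t ht t₀ ht₀) ⟨hle, le_rfl⟩ ⟨le_rfl, hle⟩).2 ?_
    rw [← neg_sub, key t ht t₀ ht₀ hle, h.eq t ht t₀ ht₀ hle, add_neg_cancel_right]

end Duhamel

/-! ### Conservation of mass -/

theorem mass_eq_norm_sq (f : L2) : mass f = ‖f‖ ^ 2 := by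
  have h : ((mass f : ℝ) : ℂ) = ((‖f‖ ^ 2 : ℝ) : ℂ) := by
    rw [mass, ← integral_complex_ofReal]
    have h1 := inner_self_eq_norm_sq_to_K (𝕜 := ℂ) f
    rw [L2.inner_def] at h1
    push_cast
    refine Eq.trans ?_ h1
    refine integral_congr_ae (Eventually.of_forall fun x => ?_)
    simp only
    rw [inner_self_eq_norm_sq_to_K]
    rfl
  exact_mod_cast h

/-- A function whose increments are superlinearly small in a continuous monotone clock is
constant. -/
theorem eq_of_abs_sub_le_rpow {g ω : ℝ → ℝ} {a b C : ℝ} (hab : a ≤ b)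
    (hω : ContinuousOn ω (Icc a b)) (hmono : MonotoneOn ω (Icc a b))
    (h : ∀ s t, a ≤ s → s ≤ t → t ≤ b → |g t - g s| ≤ C * (ω t - ω s) ^ (3 / 2 : ℝ)) :
    g a = g b := by
  -- Halving the clock doubles the number of pieces and divides each bound by $2^{3/2}$. The net
  -- factor is below one because the exponent exceeds one.
  set ρ : ℝ := 2 * (1 / 2 : ℝ) ^ (3 / 2 : ℝ) with hρ
  have hρ0 : 0 ≤ ρ := by positivity
  have hρ1 : ρ < 1 := by
    have h1 : (1 / 2 : ℝ) ^ (3 / 2 : ℝ) < (1 / 2 : ℝ) ^ (1 : ℝ) :=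
      Real.rpow_lt_rpow_of_exponent_gt (by norm_num) (by norm_num) (by norm_num)
    rw [Real.rpow_one] at h1
    rw [hρ]
    linarith
  have key : ∀ n : ℕ, ∀ s t, a ≤ s → s ≤ t → t ≤ b →
      |g t - g s| ≤ C * ρ ^ n * (ω t - ω s) ^ (3 / 2 : ℝ) := by
    intro n
    induction n with
    | zero => simpa using h
    | succ n ih =>
      intro s t hs hst ht
      have hm : ω s ≤ ω t := hmono ⟨hs, hst.trans ht⟩ ⟨hs.trans hst, ht⟩ hst
      -- The interval is bisected in clock time, which is why continuity of $\omega$ is needed.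
      obtain ⟨c, hc, hcω⟩ := intermediate_value_Icc hst (hω.mono (Icc_subset_Icc hs ht))
        (⟨by linarith, by linarith⟩ : (ω s + ω t) / 2 ∈ Icc (ω s) (ω t))
      have h1 := ih s c hs hc.1 (hc.2.trans ht)
      have h2 := ih c t (hs.trans hc.1) hc.2 ht
      have e1 : ω c - ω s = (ω t - ω s) * (1 / 2) := by rw [hcω]; ring
      have e2 : ω t - ω c = (ω t - ω s) * (1 / 2) := by rw [hcω]; ring
      rw [e1, Real.mul_rpow (by linarith) (by norm_num)] at h1
      rw [e2, Real.mul_rpow (by linarith) (by norm_num)] at h2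
      calc |g t - g s| = |(g t - g c) + (g c - g s)| := by ring_nf
        _ ≤ |g t - g c| + |g c - g s| := abs_add_le _ _
        _ ≤ _ := add_le_add h2 h1
        _ = _ := by rw [hρ]; ring
  have hlim : Tendsto (fun n : ℕ => C * ρ ^ n * (ω b - ω a) ^ (3 / 2 : ℝ)) atTop (𝓝 0) := by
    have := ((tendsto_pow_atTop_nhds_zero_of_lt_one hρ0 hρ1).const_mul C).mul_const
      ((ω b - ω a) ^ (3 / 2 : ℝ))
    simpa using this
  have h0 := ge_of_tendsto' hlim fun n => key n a b le_rfl hab le_rfl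
  have h1 := abs_nonpos_iff.1 h0
  linarith

section Mass

variable {lam : Measure ℝ} [IsFiniteMeasure lam] {F : ℝ → Lp ℂ 1 lam}

theorem norm_integral_pairing_duhamel_le (hF : MemLp F (4 / 3) volume) (J : Set ℝ) :
    ‖∫ r in J, pairing lam (F r) (contRep (propagator r (duhamelTerm F r)))‖ ≤
      12 * (eLpNorm F (4 / 3) volume).toReal ^ 2 := by
  obtain ⟨h1, h2⟩ := memL4C0_duhamelTerm hF
  have hm := h1.memLp.1
  rw [normL4C, Measure.restrict_univ] at h2
  rw [Measure.restrict_univ] at hm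
  have h3 : ‖∫ r in J, pairing lam (F r) (contRep (propagator r (duhamelTerm F r)))‖ₑ ≤
      12 * eLpNorm F (4 / 3) volume ^ 2 := by
    calc _ ≤ _ := enorm_integral_le_lintegral_enorm _
      _ ≤ _ := lintegral_mono' Measure.restrict_le_self le_rfl
      _ ≤ _ := lintegral_enorm_pairing_le hF.1 hm
      _ ≤ eLpNorm F (4 / 3) volume * (12 * eLpNorm F (4 / 3) volume) := by gcongr
      _ = _ := by ring
  have hfin := hF.2.ne
  have h4 := ENNReal.toReal_mono (by finiteness) h3
  simpa [ENNReal.toReal_mul] using h4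

/-- Expanding $\|v+D\|^2$ about the profile $v$ at time $s$ leaves $2\,\mathrm{Re}\langle
D,v\rangle+\|D\|^2$. In the first term the free evolution of $v$ is $\psi$ minus the propagated
Duhamel term; $\psi$ contributes nothing to the real part and the remainder is quadratic in the
forcing. The constant is $2\cdot12+16^2=280$. -/
theorem IsMild.abs_norm_sq_sub_le {G : (ℝ →ᵇ ℂ) → Lp ℂ 1 lam} {K : NNReal} (hG : IsCubic G K)
    (hre : ∀ f, (pairing lam (G f) f).re = 0) {I : Set ℝ} {ψ : ℝ → L2} (h : IsMild G I ψ)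
    {s t : ℝ} (hs : s ∈ I) (ht : t ∈ I) (hst : s ≤ t) :
    |‖ψ t‖ ^ 2 - ‖ψ s‖ ^ 2| ≤
      280 * (eLpNorm (forcing G (Icc s t) ψ) (4 / 3) volume).toReal ^ 2 := by
  have hm := h.memL4C s hs t ht
  have hF := memLp_forcing hG measurableSet_Icc hm
  set F := forcing G (Icc s t) ψ with hFdef
  set n := (eLpNorm F (4 / 3) volume).toReal with hn
  set v := propagator (-s) (ψ s) with hv
  have hflow : ∀ r ∈ Icc s t, ψ r = propagator r v + propagator r (duhamelTerm F r) := by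
    intro r hr
    rw [h.eq_linearFlow_Icc hs ht hr, linearFlow, map_add]
  have h1 : ‖ψ t‖ = ‖v + duhamelTerm F t‖ := by
    rw [hflow t ⟨hst, le_rfl⟩, ← map_add, LinearIsometry.norm_map]
  have h2 : ‖ψ s‖ = ‖v‖ := by rw [hv, LinearIsometry.norm_map]
  have hΔ : ‖duhamelTerm F t‖ ≤ 16 * n := by
    have := ENNReal.toReal_mono (ENNReal.mul_ne_top (by simp) hF.2.ne) (norm_duhamelTerm_le F t)
    simpa [ENNReal.toReal_mul] using this
  have hinner : inner ℂ (duhamelTerm F t) v =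
      ∫ r in Icc s t, pairing lam (F r) (contRep (propagator r v)) := by
    rw [duhamelTerm, inner_dualStrichartz (hF.indicator measurableSet_Iic),
      ← integral_indicator measurableSet_Icc]
    refine integral_congr_ae (Eventually.of_forall fun r => ?_)
    by_cases hr : r ∈ Icc s t
    · simp [indicator_of_mem hr, indicator_of_mem (show r ∈ Iic t from hr.2)]
    · have : (Iic t).indicator F r = 0 := by
        by_cases hr' : r ∈ Iic t <;> simp [hr', hFdef, forcing, indicator_of_notMem hr]
      simp [indicator_of_notMem hr, this]
  have hD := memL4C0_duhamelTerm hF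
  have hDmem : MemLp (fun r => contRep (propagator r (duhamelTerm F r))) 4
      (volume.restrict (Icc s t)) := (hD.1.mono (subset_univ _)).memLp
  have hFJ : MemLp F (4 / 3) (volume.restrict (Icc s t)) := hF.restrict _
  have hsplit : ∫ r in Icc s t, pairing lam (F r) (contRep (propagator r v)) =
      (∫ r in Icc s t, pairing lam (F r) (contRep (ψ r))) -
        ∫ r in Icc s t, pairing lam (F r) (contRep (propagator r (duhamelTerm F r))) := by
    rw [← integral_sub (integrable_pairing hFJ hm.memLp) (integrable_pairing hFJ hDmem)]
    refine integral_congr_ae ?_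
    filter_upwards [hm.ae_eq, (hD.1.mono (subset_univ (Icc s t))).ae_eq,
      ae_restrict_mem measurableSet_Icc] with r h3 h4 hr
    have e : propagator r v = ψ r - propagator r (duhamelTerm F r) := by
      rw [hflow r hr, add_sub_cancel_right]
    rw [e, contRep_sub h3 h4, map_sub]
  -- Gauge invariance, applied at each time.
  have hzero : (∫ r in Icc s t, pairing lam (F r) (contRep (ψ r))).re = 0 := by
    have e := integral_re (𝕜 := ℂ) (integrable_pairing hFJ hm.memLp)
    simp only [RCLike.re_eq_complex_re] at e
    rw [← e]
    refine integral_eq_zero_of_ae ?_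
    filter_upwards [ae_restrict_mem measurableSet_Icc] with r hr
    rw [hFdef, forcing, indicator_of_mem hr, hre]
    rfl
  have hre2 : |(inner ℂ (duhamelTerm F t) v).re| ≤ 12 * n ^ 2 := by
    rw [hinner, hsplit, Complex.sub_re, hzero, zero_sub, abs_neg]
    exact (Complex.abs_re_le_norm _).trans (norm_integral_pairing_duhamel_le hF _)
  have hexp : ‖ψ t‖ ^ 2 - ‖ψ s‖ ^ 2 =
      2 * (inner ℂ (duhamelTerm F t) v).re + ‖duhamelTerm F t‖ ^ 2 := by
    rw [h1, h2, add_comm, @norm_add_sq ℂ]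
    simp only [RCLike.re_eq_complex_re]
    ring
  rw [hexp]
  calc _ ≤ |2 * (inner ℂ (duhamelTerm F t) v).re| + |‖duhamelTerm F t‖ ^ 2| := abs_add_le _ _
    _ ≤ 2 * (12 * n ^ 2) + (16 * n) ^ 2 := by
        rw [abs_mul, abs_of_pos (by norm_num : (0 : ℝ) < 2), abs_of_nonneg (sq_nonneg ‖_‖)]
        gcongr
    _ = _ := by ring

/-- The clock is $\omega(t)=\int_a^t\|F\|^{4/3}$. The squared $L^{4/3}$ norm of the forcing on
$[s,t]$ is then exactly $(\omega(t)-\omega(s))^{3/2}$, a superlinear increment. -/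
theorem IsMild.norm_eq {G : (ℝ →ᵇ ℂ) → Lp ℂ 1 lam} {K : NNReal} (hG : IsCubic G K)
    (hre : ∀ f, (pairing lam (G f) f).re = 0) {I : Set ℝ} {ψ : ℝ → L2} (h : IsMild G I ψ)
    {a b : ℝ} (ha : a ∈ I) (hb : b ∈ I) : ‖ψ a‖ = ‖ψ b‖ := by
  wlog hab : a ≤ b generalizing a b
  · exact (this hb ha (le_of_not_ge hab)).symm
  have hF := memLp_forcing hG measurableSet_Icc (h.memL4C a ha b hb)
  set F := forcing G (Icc a b) ψ with hFdef
  have hi : Integrable fun r => ‖F r‖ ^ (4 / 3 : ℝ) := by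
    have := hF.integrable_norm_rpow (by simp) four_thirds_ne_top
    rwa [four_thirds_toReal] at this
  set ω : ℝ → ℝ := fun t => ∫ r in a..t, ‖F r‖ ^ (4 / 3 : ℝ) with hω
  have hωsub : ∀ s t, ω t - ω s = ∫ r in s..t, ‖F r‖ ^ (4 / 3 : ℝ) := fun s t =>
    intervalIntegral.integral_interval_sub_left hi.intervalIntegrable hi.intervalIntegrable
  have hsq : ‖ψ a‖ ^ 2 = ‖ψ b‖ ^ 2 := by
    refine eq_of_abs_sub_le_rpow (g := fun t => ‖ψ t‖ ^ 2) (ω := ω) (C := 280) hab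
      (intervalIntegral.continuous_primitive (fun _ _ => hi.intervalIntegrable) a).continuousOn
      ?_ ?_
    · intro s hs t ht hst
      have h1 : 0 ≤ ω t - ω s := by
        rw [hωsub]
        exact intervalIntegral.integral_nonneg hst fun r _ => by positivity
      linarith
    · intro s t hs hst ht
      have hI : Icc a b ⊆ I := h.interval.out ha hb
      have hsub : Icc s t ⊆ Icc a b := Icc_subset_Icc hs ht
      refine (h.abs_norm_sq_sub_le hG hre (hI ⟨hs, hst.trans ht⟩) (hI ⟨hs.trans hst, ht⟩)
        hst).trans (le_of_eq ?_)
      have hFst : forcing G (Icc s t) ψ = (Icc s t).indicator F := by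
        rw [hFdef, indicator_forcing, inter_eq_left.2 hsub]
      have hmem := hF.indicator (measurableSet_Icc (a := s) (b := t))
      rw [hFst, hmem.eLpNorm_eq_integral_rpow_norm (by simp) four_thirds_ne_top,
        four_thirds_toReal, ENNReal.toReal_ofReal (by positivity), hωsub,
        intervalIntegral.integral_of_le hst, ← integral_Icc_eq_integral_Ioc,
        ← integral_indicator measurableSet_Icc, ← Real.rpow_natCast, ← Real.rpow_mul
          (integral_nonneg fun r => by positivity)]
      congr 1
      rw [show ((4 / 3 : ℝ)⁻¹ * ((2 : ℕ) : ℝ)) = 3 / 2 by norm_num]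
      congr 1
      refine integral_congr_ae (Eventually.of_forall fun r => ?_)
      by_cases hr : r ∈ Icc s t
      · simp only [indicator_of_mem hr]
      · simp only [indicator_of_notMem hr]
        rw [norm_zero, Real.zero_rpow (by norm_num)]
  exact (pow_left_inj₀ (norm_nonneg _) (norm_nonneg _) two_ne_zero).1 hsq

end Mass

/-! ### The maximal solution -/

section MaximalSolution

variable {μ : SignedMeasure ℝ} {f : L2} {ψ : ℝ → L2} {I : Set ℝ}

theorem IsMild.isSolution_of_nonempty (h : IsMild (density μ) I ψ) (hne : I.Nonempty) :
    IsSolution μ I ψ := by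
  obtain ⟨t₀, ht₀⟩ := hne
  exact h.isSolution ⟨t₀, ht₀⟩ ⟨‖ψ t₀‖, fun t ht =>
    (h.norm_eq (isCubic_density μ) (re_pairing_density_self μ) ht ht₀).le⟩

/-- The theorem admits arbitrary intervals in $[0,\infty)$ containing $0$; restriction to $[0,t]$
loses nothing, and mass conservation supplies the bound a solution must satisfy. -/
theorem maxInterval_eq_lifespan (μ : SignedMeasure ℝ) (f : L2) :
    maxInterval μ f = lifespan (density μ) f := by
  ext t
  constructor
  · rintro ⟨I, ψ, hI, h0, ht, h, rfl⟩
    exact mem_lifespan_of_isMild h.isMild h0 ht (hI ht)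
  · rintro ⟨ht, ψ, h, h0⟩
    exact ⟨Icc 0 t, ψ, fun _ h => h.1, ⟨le_rfl, ht⟩, ⟨ht, le_rfl⟩,
      h.isSolution_of_nonempty ⟨t, ht, le_rfl⟩, h0⟩

theorem ofReal_le_Tmax {t : ℝ} (ht : t ∈ maxInterval μ f) : ENNReal.ofReal t ≤ Tmax μ f :=
  le_iSup₂ (f := fun t (_ : t ∈ maxInterval μ f) => ENNReal.ofReal t) t ht

theorem exists_lt_of_lt_Tmax {y : ℝ≥0∞} (hy : y < Tmax μ f) :
    ∃ t ∈ maxInterval μ f, y < ENNReal.ofReal t := by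
  simpa only [Tmax, lt_iSup_iff, exists_prop] using hy

theorem ofReal_lt_Tmax {t : ℝ} (ht : t ∈ maxInterval μ f) : ENNReal.ofReal t < Tmax μ f := by
  rw [maxInterval_eq_lifespan] at ht
  obtain ⟨δ, hδ, h⟩ := exists_add_mem_lifespan (isCubic_density μ) ht
  rw [← maxInterval_eq_lifespan] at h
  refine lt_of_lt_of_le ?_ (ofReal_le_Tmax h)
  exact (ENNReal.ofReal_lt_ofReal_iff (by linarith [ht.1])).2 (by linarith)

theorem maxInterval_eq_setOf_lt (μ : SignedMeasure ℝ) (f : L2) :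
    maxInterval μ f = {t | 0 ≤ t ∧ ENNReal.ofReal t < Tmax μ f} := by
  ext t
  constructor
  · intro ht
    refine ⟨?_, ofReal_lt_Tmax ht⟩
    rw [maxInterval_eq_lifespan] at ht
    exact ht.1
  · rintro ⟨h0, ht⟩
    obtain ⟨s, hs, hts⟩ := exists_lt_of_lt_Tmax ht
    rw [maxInterval_eq_lifespan] at hs ⊢
    exact mem_lifespan_of_le hs h0 ((ENNReal.ofReal_lt_ofReal_iff_of_nonneg h0).1 hts).le

theorem zero_mem_maxInterval (μ : SignedMeasure ℝ) (f : L2) : (0 : ℝ) ∈ maxInterval μ f := by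
  rw [maxInterval_eq_lifespan]
  exact zero_mem_lifespan (isCubic_density μ) f

theorem Tmax_pos (μ : SignedMeasure ℝ) (f : L2) : 0 < Tmax μ f := by
  simpa using ofReal_lt_Tmax (zero_mem_maxInterval μ f)

theorem exists_isMaximalSolution (μ : SignedMeasure ℝ) (f : L2) :
    ∃ ψ, IsMaximalSolution μ f ψ := by
  obtain ⟨ψ, h, h0⟩ := exists_isMild_lifespan (isCubic_density μ) f
  rw [← maxInterval_eq_lifespan] at h
  exact ⟨ψ, h.isSolution_of_nonempty ⟨0, zero_mem_maxInterval μ f⟩, h0⟩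

theorem IsMaximalSolution.isMild (h : IsMaximalSolution μ f ψ) :
    IsMild (density μ) (lifespan (density μ) f) ψ := by
  rw [← maxInterval_eq_lifespan]
  exact h.isSolution.isMild

theorem Tmax_eq_top (h : lifespan (density μ) f = Ici 0) : Tmax μ f = ∞ := by
  refine ENNReal.eq_top_of_forall_nnreal_le fun r => ?_
  have hr : (r : ℝ) ∈ maxInterval μ f := by
    rw [maxInterval_eq_lifespan, h]
    exact r.2
  simpa using ofReal_le_Tmax hr

/-- Measurability is known only on compact subintervals. Half-openness exhausts the lifespan by
countably many intervals with rational endpoints. -/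
theorem aestronglyMeasurable_lifespan (h : IsMild (density μ) (lifespan (density μ) f) ψ) :
    AEStronglyMeasurable (fun t => contRep (ψ t))
      (volume.restrict (lifespan (density μ) f)) := by
  have hU : lifespan (density μ) f =
      ⋃ q : {q : ℚ // (q : ℝ) ∈ lifespan (density μ) f}, Icc 0 ((q : ℚ) : ℝ) := by
    ext t
    rw [mem_iUnion]
    constructor
    · intro ht
      obtain ⟨δ, hδ, hδ'⟩ := exists_add_mem_lifespan (isCubic_density μ) ht
      obtain ⟨q, hq1, hq2⟩ := exists_rat_btwn (show t < t + δ by linarith)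
      exact ⟨⟨q, mem_lifespan_of_le hδ' (ht.1.trans hq1.le) hq2.le⟩, ht.1, hq1.le⟩
    · rintro ⟨⟨q, hq⟩, ht0, htq⟩
      exact mem_lifespan_of_le hq ht0 htq
  rw [hU, aestronglyMeasurable_iUnion_iff]
  exact fun q => (h.memL4C 0 (zero_mem_lifespan (isCubic_density μ) f) _ q.2).memLp.1

theorem IsMaximalSolution.global_and_scattersForward (h : IsMaximalSolution μ f ψ)
    (hc : ScatteringCriterion μ f ψ) : Tmax μ f = ∞ ∧ ScattersForward ψ := by
  have hmild := h.isMild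
  have hL : MeasurableSet (lifespan (density μ) f) := ordConnected_lifespan.measurableSet
  have hF : MemLp (forcing (density μ) (lifespan (density μ) f) ψ) (4 / 3) volume := by
    refine (memLp_indicator_iff_restrict hL).2 ⟨(isCubic_density μ).continuous
      |>.comp_aestronglyMeasurable (aestronglyMeasurable_lifespan hmild), ?_⟩
    rw [eLpNorm_lt_top_iff_lintegral_rpow_enorm_lt_top (by simp) four_thirds_ne_top,
      four_thirds_toReal]
    rw [ScatteringCriterion, maxInterval_eq_lifespan] at hc
    calc _ ≤ ∫⁻ t in lifespan (density μ) f, μ.totalVariation univ ^ (1 / 3 : ℝ) *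
          ∫⁻ x, ‖contRep (ψ t) x‖ₑ ^ 4 ∂μ.totalVariation :=
          lintegral_mono fun t => enorm_density_rpow_le μ _
      _ = μ.totalVariation univ ^ (1 / 3 : ℝ) * ∫⁻ t in lifespan (density μ) f,
          ∫⁻ x, ‖contRep (ψ t) x‖ₑ ^ 4 ∂μ.totalVariation :=
          lintegral_const_mul' _ _ (by finiteness)
      _ < ∞ := ENNReal.mul_lt_top (by finiteness) hc
  obtain ⟨h1, h2⟩ := lifespan_eq_and_scattersForward (isCubic_density μ) hmild h.initial hF
  exact ⟨Tmax_eq_top h1, h2⟩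

/-- Strichartz makes the free evolution small on all of $[0,\infty)$, so the contraction gives a
global solution in $L^4_tC_x$, which uniqueness identifies with the maximal one. The sup norm then
bounds the inner integral of the criterion at the cost of $|\mu|(\mathbb R)$. -/
theorem exists_small_data_threshold (μ : SignedMeasure ℝ) :
    ∃ η₀ : ℝ, 0 < η₀ ∧ ∀ f : L2, ‖f‖ ≤ η₀ → ∀ ψ : ℝ → L2, IsMaximalSolution μ f ψ →
      ScatteringCriterion μ f ψ := by
  have hG := isCubic_density μ
  obtain ⟨e, hepos, he⟩ := exists_isSmallRadius (2 * (μ.totalVariation univ).toNNReal)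
  refine ⟨e / 16, by positivity, fun f hf ψ hψ => ?_⟩
  have hf' : 16 * ‖f‖ₑ ≤ e := by
    rw [← ofReal_norm, ← ENNReal.ofReal_coe_nnreal, ← ENNReal.ofReal_ofNat,
      ← ENNReal.ofReal_mul (by norm_num)]
    exact ENNReal.ofReal_le_ofReal (by linarith)
  obtain ⟨φ, h1, h2, h3⟩ := exists_global_of_small hG he hf'
  have hL : lifespan (density μ) f = Ici 0 := subset_antisymm lifespan_subset fun t ht => by
    rw [← h2]
    exact mem_lifespan_of_isMild h1 self_mem_Ici ht ht
  have hmild := hψ.isMild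
  rw [hL] at hmild
  have heq : EqOn φ ψ (Ici 0) := h1.eqOn hG hmild self_mem_Ici (h2.trans hψ.initial.symm)
  have hm := (h3.mono (subset_univ (Ici 0))).congr measurableSet_Ici heq
  rw [ScatteringCriterion, maxInterval_eq_lifespan, hL]
  have hfin := lintegral_rpow_enorm_lt_top_of_eLpNorm_lt_top (by norm_num) (by norm_num) hm.memLp.2
  calc _ ≤ ∫⁻ t in Ici 0, ‖contRep (ψ t)‖ₑ ^ (4 : ℝ≥0∞).toReal * μ.totalVariation univ := by
        refine lintegral_mono fun t => ?_
        rw [← lintegral_const]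
        refine lintegral_mono fun x => ?_
        have h4 : ‖contRep (ψ t) x‖ₑ ≤ ‖contRep (ψ t)‖ₑ := by
          rw [← ofReal_norm, ← ofReal_norm]
          exact ENNReal.ofReal_le_ofReal ((contRep (ψ t)).norm_coe_le_norm x)
        calc _ ≤ ‖contRep (ψ t)‖ₑ ^ 4 := by gcongr
          _ = _ := by norm_num
    _ = (∫⁻ t in Ici 0, ‖contRep (ψ t)‖ₑ ^ (4 : ℝ≥0∞).toReal) * μ.totalVariation univ :=
        lintegral_mul_const' _ _ (measure_ne_top _ _)
    _ < ∞ := ENNReal.mul_lt_top hfin (measure_lt_top _ _)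

theorem maximalSolution_continuous_dependence {g : ℕ → L2} {φ : ℕ → ℝ → L2}
    (hg : Tendsto g atTop (𝓝 f)) (hψ : IsMaximalSolution μ f ψ)
    (hφ : ∀ n, IsMaximalSolution μ (g n) (φ n)) {T : ℝ} (hT : 0 ≤ T)
    (hTmax : ENNReal.ofReal T < Tmax μ f) :
    (∀ᶠ n in atTop, ENNReal.ofReal T < Tmax μ (g n)) ∧
      MemL4C0 (Icc 0 T) ψ ∧
      (∀ᶠ n in atTop, MemL4C0 (Icc 0 T) (φ n)) ∧
      Tendsto (fun n => normCL2 (Icc 0 T) (fun t => φ n t - ψ t)) atTop (𝓝 0) ∧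
      Tendsto (fun n => normL4C (Icc 0 T) (fun t => φ n t - ψ t)) atTop (𝓝 0) := by
  have hG := isCubic_density μ
  have hTmem : T ∈ lifespan (density μ) f := by
    rw [← maxInterval_eq_lifespan, maxInterval_eq_setOf_lt]
    exact ⟨hT, hTmax⟩
  have hz := zero_mem_lifespan hG f
  have hmild := hψ.isMild.mono (ordConnected_lifespan.out hz hTmem) ordConnected_Icc
  rw [← hψ.initial] at hg
  obtain ⟨C, hC, hev⟩ := continuous_dependence hG hT hmild (fun n => (hφ n).isMild)
    (fun n => (hφ n).initial) hg
  have hg0 : Tendsto (fun n => C * ‖g n - ψ 0‖ₑ) atTop (𝓝 0) := by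
    have h1 : Tendsto (fun n => ‖g n - ψ 0‖ₑ) atTop (𝓝 0) := by
      simpa [edist_eq_enorm_sub] using tendsto_iff_edist_tendsto_0.1 hg
    simpa using ENNReal.Tendsto.const_mul h1 (Or.inr hC)
  refine ⟨?_, hψ.isMild.memL4C0 hG hz hTmem, ?_, ?_, ?_⟩
  · filter_upwards [hev] with n hn
    refine ofReal_lt_Tmax ?_
    rw [maxInterval_eq_lifespan]
    exact hn.1
  · filter_upwards [hev] with n hn
    exact (hφ n).isMild.memL4C0 hG (zero_mem_lifespan hG _) hn.1
  · refine tendsto_of_tendsto_of_tendsto_of_le_of_le' tendsto_const_nhds hg0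
      (Eventually.of_forall fun _ => zero_le) ?_
    filter_upwards [hev] with n hn
    exact iSup₂_le hn.2.2
  · refine tendsto_of_tendsto_of_tendsto_of_le_of_le' tendsto_const_nhds hg0
      (Eventually.of_forall fun _ => zero_le) ?_
    filter_upwards [hev] with n hn
    exact hn.2.1

/-- In the metric space $L^2$ sequences suffice, and continuous dependence lets nearby solutions
live at least up to any given time of the lifespan. -/
theorem lowerSemicontinuous_Tmax (μ : SignedMeasure ℝ) : LowerSemicontinuous (Tmax μ) := by
  intro f y hy
  refine eventually_iff_seq_eventually.2 fun g hg => ?_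
  obtain ⟨t, ht, hyt⟩ := exists_lt_of_lt_Tmax hy
  have ht0 : 0 ≤ t := by
    rw [maxInterval_eq_lifespan] at ht
    exact ht.1
  obtain ⟨ψ, hψ⟩ := exists_isMaximalSolution μ f
  choose φ hφ using fun n => exists_isMaximalSolution μ (g n)
  filter_upwards [(maximalSolution_continuous_dependence hg hψ hφ ht0 (ofReal_lt_Tmax ht)).1]
    with n hn using hyt.trans hn

end MaximalSolution

end NLSMu

end

/-! ### The well-posedness theorem -/

theorem theorem2p3 (μ : SignedMeasure ℝ) :
    -- local existence
    (∀ ψ₀ : L2, ∃ T : ℝ, 0 < T ∧ ∃ ψ : ℝ → L2, IsSolution μ (Ico 0 T) ψ ∧ ψ 0 = ψ₀) ∧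
    -- uniqueness
    (∀ (I J : Set ℝ) (ψ φ : ℝ → L2), IsSolution μ I ψ → IsSolution μ J φ →
      (∃ t₁ ∈ I ∩ J, ψ t₁ = φ t₁) → ∀ t ∈ I ∩ J, ψ t = φ t) ∧
    -- the maximal solution, its half-open lifespan, and the blowup/scattering criterion
    (∀ ψ₀ : L2,
      0 < Tmax μ ψ₀ ∧
      maxInterval μ ψ₀ = {t | 0 ≤ t ∧ ENNReal.ofReal t < Tmax μ ψ₀} ∧
      (∃ ψ : ℝ → L2, IsMaximalSolution μ ψ₀ ψ) ∧
      ∀ ψ : ℝ → L2, IsMaximalSolution μ ψ₀ ψ → ScatteringCriterion μ ψ₀ ψ →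
        Tmax μ ψ₀ = ∞ ∧ ScattersForward ψ) ∧
    -- small data
    (∃ η₀ : ℝ, 0 < η₀ ∧ ∀ ψ₀ : L2, ‖ψ₀‖ ≤ η₀ →
      ∀ ψ : ℝ → L2, IsMaximalSolution μ ψ₀ ψ →
        ScatteringCriterion μ ψ₀ ψ ∧ Tmax μ ψ₀ = ∞ ∧ ScattersForward ψ) ∧
    -- continuous dependence and lower semicontinuity of the lifespan
    (∀ (ψ₀ : L2) (ψ₀n : ℕ → L2) (ψ : ℝ → L2) (ψn : ℕ → ℝ → L2),
      Tendsto ψ₀n atTop (𝓝 ψ₀) → IsMaximalSolution μ ψ₀ ψ →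
      (∀ n, IsMaximalSolution μ (ψ₀n n) (ψn n)) →
      ∀ T : ℝ, 0 ≤ T → ENNReal.ofReal T < Tmax μ ψ₀ →
        (∀ᶠ n in atTop, ENNReal.ofReal T < Tmax μ (ψ₀n n)) ∧
        MemL4C0 (Icc 0 T) ψ ∧
        (∀ᶠ n in atTop, MemL4C0 (Icc 0 T) (ψn n)) ∧
        Tendsto (fun n => normCL2 (Icc 0 T) (fun t => ψn n t - ψ t)) atTop (𝓝 0) ∧
        Tendsto (fun n => normL4C (Icc 0 T) (fun t => ψn n t - ψ t)) atTop (𝓝 0)) ∧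
    LowerSemicontinuous (Tmax μ) ∧
    -- conservation of mass
    (∀ (I : Set ℝ) (ψ : ℝ → L2), IsSolution μ I ψ →
      ∀ t₀ ∈ I, ∀ t ∈ I, mass (ψ t) = mass (ψ t₀)) := by
  have hG := isCubic_density μ
  refine ⟨fun ψ₀ => ?_, ?_, fun ψ₀ => ⟨Tmax_pos μ ψ₀, maxInterval_eq_setOf_lt μ ψ₀,
    exists_isMaximalSolution μ ψ₀, fun ψ h hc => h.global_and_scattersForward hc⟩, ?_,
    fun ψ₀ ψ₀n ψ ψn hlim hψ hψn T hT hTmax =>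
      maximalSolution_continuous_dependence hlim hψ hψn hT hTmax,
    lowerSemicontinuous_Tmax μ, fun I ψ h t₀ ht₀ t ht => ?_⟩
  · obtain ⟨δ, hδ, ψ, h, h0⟩ := exists_local_mild hG 0 ψ₀
    rw [zero_add] at h
    exact ⟨δ, hδ, ψ, (h.mono Ico_subset_Icc_self ordConnected_Ico).isSolution_of_nonempty
      ⟨0, le_rfl, hδ⟩, h0⟩
  · rintro I J ψ φ hI hJ ⟨t₁, ht₁, heq⟩
    have hIJ := hI.interval.inter hJ.interval
    exact (hI.isMild.mono inter_subset_left hIJ).eqOn hG (hJ.isMild.mono inter_subset_right hIJ)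
      ht₁ heq
  · obtain ⟨η₀, hη₀, h⟩ := exists_small_data_threshold μ
    exact ⟨η₀, hη₀, fun ψ₀ hψ₀ ψ hψ =>
      ⟨h ψ₀ hψ₀ ψ hψ, hψ.global_and_scattersForward (h ψ₀ hψ₀ ψ hψ)⟩⟩
  · rw [mass_eq_norm_sq, mass_eq_norm_sq,
      h.isMild.norm_eq hG (re_pairing_density_self μ) ht ht₀]
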